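/- **Theorem (completeness for first-order consequences of dependence logic).** Let $L$ be a vocabulary, let $T$ be a set of sentences of dependence logic over $L$, and let $\varphi$ be a first-order formula over $L$ (in particular, any first-order sentence). Then $$T\models\varphi\quad\Longleftrightarrow\quad T\vdash_{\mathcal D}\varphi .$$ *Dependence logic.* The formulas are built from the first-order atoms $t=t'$, $R(t_1,\dots,t_n)$ and the dependence atoms $=\!(t_1,\dots,t_n)$ by $\wedge,\vee,\exists x,\forall x$, and by $\neg$, which may be applied only to first-order formulas, that is, formulas without dependence atoms. Models are non-empty. A team $X$ of a model $\mathfrak A$ with universe $A$ is a set of assignments with a common finite domain of variables. A first-order formula holds in $X$ if every $s\in X$ satisfies it; $=\!(t_1,\dots,t_n)$ holds in $X$ if any two $s,s'\in X$ that give equal values to each of $t_1,\dots,t_{n-1}$ give equal values to $t_n$ ($=\!()$ always holds); $\wedge$ is read as usual; $A\vee B$ holds in $X$ iff $X=Y\cup Z$ with $A$ true in $Y$ and $B$ true in $Z$; $\exists x A$ holds in $X$ iff $A$ holds in $\{s(F(s)/x):s\in X\}$ for some $F\colon X\to A$; $\forall xA$ holds in $X$ iff $A$ holds in $\{s(a/x):s\in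 X,a\in A\}$. $T\models\varphi$ means that in every model every team that satisfies all members of $T$, and whose domain contains the free variables of $T$ and $\varphi$, satisfies $\varphi$. *The system.* $T\vdash_{\mathcal D}\varphi$ means that $\varphi$ has a natural deduction whose non-discharged assumptions lie in $T$, by the following rules. Substitutions $A(t/x)$ must not make a variable of $t$ bound; $A\to B$ is $\neg A\vee B$; an empty conjunction is a fixed true first-order sentence. * $\wedge$: the usual introduction and elimination rules. $\vee$I: from $A$, or from $B$, infer $A\vee B$. $\vee$E: from $A\vee B$ and deductions of $C$ from $[A]$ and from $[B]$ infer $C$, for first-order $C$. * $\neg$I: from a deduction of $B\wedge\neg B$ from $[A]$ infer $\neg A$; $\neg$E: from $\neg\neg A$ infer $A$; here $A,B$ are first-order. * $\forall$I: from $A$ infer $\forall xA$, if $x$ is not free in any non-discharged assumption used for $A$. $\forall$E: from $\forall xA$ infer $A(t/x)$. $\exists$I: from $A(t/x)$ infer $\exists xA$. $\exists$E: from $\exists xA$ and a deduction of $B$ from $[A]$ infer $B$, if $x$ is not free in $B$ nor in any non-discharged assumption, other than $A$, used in that deduction. * Disjunction substitution: from $A\vee B$ and a deduction of $C$ from $[B]$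 infer $A\vee C$. Commutation: from $B\vee A$ infer $A\vee B$. Associativity: from $(A\vee B)\vee C$ infer $A\vee(B\vee C)$. * Extending scope: from $QxA\vee B$ infer $Qx(A\vee B)$ for $Q\in\{\forall,\exists\}$, if $x$ is not free in $B$. * Unnesting: from $=\!(t_1,\dots,t_n)$ infer $\exists z(=\!(t_1,\dots,t_{i-1},z,t_{i+1},\dots,t_n)\wedge z=t_i)$, $z$ a new variable. * Dependence distribution: let $A=\exists y_1\dots\exists y_n(\bigwedge_{1\le j\le n}=\!(\vec z^{\,j},y_j)\wedge C)$ and $B=\exists y_{n+1}\dots\exists y_{n+m}(\bigwedge_{n+1\le j\le n+m}=\!(\vec z^{\,j},y_j)\wedge D)$ with $C,D$ quantifier-free and first-order, the $\vec z^{\,j}$ tuples of variables, no $y_i$ with $i\le n$ appearing in $B$, and no $y_i$ with $i>n$ appearing in $A$; the $y_i$ are distinct, and $\vec z^{\,j}$ contains none of $y_j,y_{j+1},\dots$ of its own block. From $A\vee B$ infer $\exists y_1\dots\exists y_{n+m}(\bigwedge_{1\le j\le n+m}=\!(\vec z^{\,j},y_j)\wedge(C\vee D))$. * Dependence introduction: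 from $\exists x\forall yA$ infer $\forall y\exists x(=\!(\vec z,x)\wedge A)$, where $\vec z$ lists the free variables of $A$ other than $x,y$. * Dependence elimination: let $\vec x_0,\vec y_0,\vec x_1,\vec y_1$ consist of distinct variables, $\vec x_1,\vec y_1$ being of the lengths of $\vec x_0,\vec y_0$ and not appearing in $B$. From $\forall\vec x_0\exists\vec y_0(\bigwedge_{1\le j\le k}=\!(\vec w^{\,i_j},y_{0,i_j})\wedge B(\vec x_0,\vec y_0))$, where the variables of $\vec w^{\,i_j}$ are among $\vec x_0,y_{0,1},\dots,y_{0,i_j-1}$, infer $$\forall\vec x_0\exists\vec y_0\Bigl(B(\vec x_0,\vec y_0)\wedge\forall\vec x_1\exists\vec y_1\bigl(B(\vec x_1,\vec y_1)\wedge\bigwedge_{=(\vec w_0,y_{0,p})\in S}(\vec w_0=\vec w_1\to y_{0,p}=y_{1,p})\bigr)\Bigr),$$ where $S$ consists of the atoms $=\!(\vec w^{\,i_j},y_{0,i_j})$ and of $=\!(\vec x_0,y_{0,p})$ for each $y_{0,p}$ not among the $y_{0,i_j}$, and $\vec w_1$ arises from $\vec w_0$ by replacing $\vec x_0,\vec y_0$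 by $\vec x_1,\vec y_1$. * Identity: $t=t$; from $t=t'$ and $A(t/x)$ infer $A(t'/x)$, for first-order $A$. -/

import Mathlib

universe u v w

namespace DepLogic

/-- Raw formulas over the vocabulary `L`, with variables `x₀, x₁, …` named by natural numbers.
`dep [t₁, …, tₙ]` is the dependence atom `=(t₁, …, tₙ)`. The formulas of dependence logic are the
raw formulas that satisfy `IsD` below. -/
inductive Fml (L : FirstOrder.Language.{u, v}) : Type (max u v)
  | eq (t s : L.Term ℕ) : Fml L
  | rel {n : ℕ} (R : L.Relations n) (ts : Fin n → L.Term ℕ) : Fml L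
  | dep (ts : List (L.Term ℕ)) : Fml L
  | neg (A : Fml L) : Fml L
  | and (A B : Fml L) : Fml L
  | or (A B : Fml L) : Fml L
  | ex (x : ℕ) (A : Fml L) : Fml L
  | all (x : ℕ) (A : Fml L) : Fml L

/-- The variables that occur in a list of terms. -/
def listVars {L : FirstOrder.Language.{u, v}} (ts : List (L.Term ℕ)) : Finset ℕ :=
  ts.foldr (fun t V => t.varFinset ∪ V) ∅

namespace Fml

variable {L : FirstOrder.Language.{u, v}}

/-- First-order formulas: no dependence atoms. -/
def IsFO : Fml L → Prop
  | eq _ _ => True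
  | rel _ _ => True
  | dep _ => False
  | neg A => A.IsFO
  | and A B => A.IsFO ∧ B.IsFO
  | or A B => A.IsFO ∧ B.IsFO
  | ex _ A => A.IsFO
  | all _ A => A.IsFO

/-- Formulas of dependence logic: the scope of every negation is first-order. -/
def IsD : Fml L → Prop
  | eq _ _ => True
  | rel _ _ => True
  | dep _ => True
  | neg A => A.IsFO
  | and A B => A.IsD ∧ B.IsD
  | or A B => A.IsD ∧ B.IsD
  | ex _ A => A.IsD
  | all _ A => A.IsD

/-- Quantifier-free formulas. -/
def IsQF : Fml L → Prop
  | eq _ _ => True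
  | rel _ _ => True
  | dep _ => True
  | neg A => A.IsQF
  | and A B => A.IsQF ∧ B.IsQF
  | or A B => A.IsQF ∧ B.IsQF
  | ex _ _ => False
  | all _ _ => False

/-- The free variables of a formula. -/
def fv : Fml L → Finset ℕ
  | eq t s => t.varFinset ∪ s.varFinset
  | rel _ ts => Finset.univ.biUnion fun i => (ts i).varFinset
  | dep ts => listVars ts
  | neg A => A.fv
  | and A B => A.fv ∪ B.fv
  | or A B => A.fv ∪ B.fv
  | ex x A => A.fv.erase x
  | all x A => A.fv.erase x

/-- All variables that appear in a formula, free, bound or quantified. -/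
def vars : Fml L → Finset ℕ
  | eq t s => t.varFinset ∪ s.varFinset
  | rel _ ts => Finset.univ.biUnion fun i => (ts i).varFinset
  | dep ts => listVars ts
  | neg A => A.vars
  | and A B => A.vars ∪ B.vars
  | or A B => A.vars ∪ B.vars
  | ex x A => insert x A.vars
  | all x A => insert x A.vars

def IsSentence (A : Fml L) : Prop := A.fv = ∅

/-- Simultaneous substitution of the terms `σ x` for the free occurrences of the variables `x`. -/
def subst : Fml L → (ℕ → L.Term ℕ) → Fml L
  | eq t s, σ => eq (t.subst σ) (s.subst σ)
  | rel R ts, σ => rel R fun i => (ts i).subst σ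
  | dep ts, σ => dep (ts.map fun t => t.subst σ)
  | neg A, σ => neg (A.subst σ)
  | and A B, σ => and (A.subst σ) (B.subst σ)
  | or A B, σ => or (A.subst σ) (B.subst σ)
  | ex x A, σ => ex x (A.subst (Function.update σ x (FirstOrder.Language.Term.var x)))
  | all x A, σ => all x (A.subst (Function.update σ x (FirstOrder.Language.Term.var x)))

/-- No variable of a substituted term becomes bound when `σ` is substituted in the formula. -/
def SubstOK : Fml L → (ℕ → L.Term ℕ) → Prop
  | eq _ _, _ => True
  | rel _ _, _ => True
  | dep _, _ => True
  | neg A, σ => A.SubstOK σ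
  | and A B, σ => A.SubstOK σ ∧ B.SubstOK σ
  | or A B, σ => A.SubstOK σ ∧ B.SubstOK σ
  | ex x A, σ => (∀ y ∈ A.fv.erase x, x ∉ (σ y).varFinset) ∧
      A.SubstOK (Function.update σ x (FirstOrder.Language.Term.var x))
  | all x A, σ => (∀ y ∈ A.fv.erase x, x ∉ (σ y).varFinset) ∧
      A.SubstOK (Function.update σ x (FirstOrder.Language.Term.var x))

/-- The substitution `t/x`. -/
def single (x : ℕ) (t : L.Term ℕ) : ℕ → L.Term ℕ :=
  Function.update FirstOrder.Language.Term.var x t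

/-- `A → B`, which abbreviates `¬A ∨ B`. -/
def imp (A B : Fml L) : Fml L := or (neg A) B

/-- The true sentence `∀ x₀ (x₀ = x₀)`, used only as the empty conjunction. -/
def top : Fml L := all 0 (eq (FirstOrder.Language.Term.var 0) (FirstOrder.Language.Term.var 0))

/-- The finite conjunction `A₁ ∧ (A₂ ∧ (… ∧ Aₙ))`. -/
def bigAnd : List (Fml L) → Fml L
  | [] => top
  | [A] => A
  | A :: B :: As => and A (bigAnd (B :: As))

/-- `∃ x₁ … ∃ xₙ A`. -/
def exs (xs : List ℕ) (A : Fml L) : Fml L := xs.foldr ex A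

/-- `∀ x₁ … ∀ xₙ A`. -/
def alls (xs : List ℕ) (A : Fml L) : Fml L := xs.foldr all A

/-- The equation `x = y` between variables. -/
def varEq (x y : ℕ) : Fml L := eq (FirstOrder.Language.Term.var x) (FirstOrder.Language.Term.var y)

/-- The dependence atom `=(w₁, …, wₖ, y)` on variables. -/
def depVar (d : List ℕ × ℕ) : Fml L :=
  dep ((d.1 ++ [d.2]).map FirstOrder.Language.Term.var)

/-- `∃ y₁ … ∃ yₙ (⋀ⱼ =(z⃗ʲ, yⱼ) ∧ C)`, where the list `l` consists of the pairs `(z⃗ʲ, yⱼ)`. -/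
def depBlock (l : List (List ℕ × ℕ)) (C : Fml L) : Fml L :=
  exs (l.map Prod.snd) (and (bigAnd (l.map depVar)) C)

/-- The premise `∀x⃗ ∃y⃗ (⋀ⱼ =(w⃗ʲ, yᵢⱼ) ∧ B)` of dependence elimination; `D` lists the pairs
`(w⃗ʲ, yᵢⱼ)`. -/
def depElimPrem (xs ys : List ℕ) (D : List (List ℕ × ℕ)) (B : Fml L) : Fml L :=
  alls xs (exs ys (and (bigAnd (D.map depVar)) B))

/-- The atoms in `D`, and `=(x⃗, y)` for each `y` in `ys` that is not the last entry of an atom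
in `D`. -/
def depElimS (xs ys : List ℕ) (D : List (List ℕ × ℕ)) : List (List ℕ × ℕ) :=
  D ++ (ys.filter fun y => y ∉ D.map Prod.snd).map fun y => (xs, y)

/-- The conclusion
`∀x⃗ ∃y⃗ (B ∧ ∀x⃗' ∃y⃗' (B' ∧ ⋀_{=(w⃗, y) ∈ S} (w⃗ = w⃗' → y = y')))` of dependence elimination, where
the prime is the renaming `ρ` of variables. -/
def depElimConcl (xs ys : List ℕ) (D : List (List ℕ × ℕ)) (ρ : ℕ → ℕ) (B : Fml L) : Fml L :=
  alls xs (exs ys (and B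
    (alls (xs.map ρ) (exs (ys.map ρ)
      (and (B.subst fun x => FirstOrder.Language.Term.var (ρ x))
        (bigAnd ((depElimS xs ys D).map fun d =>
          imp (bigAnd (d.1.map fun x => varEq x (ρ x))) (varEq d.2 (ρ d.2)))))))))

end Fml

section Semantics

variable {L : FirstOrder.Language.{u, v}} {M : Type w}

/-- The assignment `s(a/x)`, for an assignment `s` with domain `V`. -/
def upd {V : Finset ℕ} (s : V → M) (x : ℕ) (a : M) : ↥(insert x V) → M :=
  fun i => if h : i.1 = x then a else s ⟨i.1, (Finset.mem_insert.1 i.2).resolve_left h⟩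

/-- Extension of an assignment with domain `V` by an arbitrary value outside `V`. Terms and formulas
are only evaluated at assignments whose domain contains their free variables, and the values
outside `V` are then irrelevant. -/
noncomputable def ext [Nonempty M] {V : Finset ℕ} (s : V → M) : ℕ → M :=
  fun i => if h : i ∈ V then s ⟨i, h⟩ else Classical.arbitrary M

/-- The value of a term in an assignment. -/
noncomputable def val [L.Structure M] [Nonempty M] {V : Finset ℕ} (t : L.Term ℕ) (s : V → M) : M :=
  t.realize (ext s)

/-- Tarskian satisfaction `𝔄 ⊨ₛ A` of first-order formulas. Dependence atoms do not occur in
first-order formulas; their clause is a dummy. -/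
def FOSat [L.Structure M] : Fml L → (ℕ → M) → Prop
  | .eq t s, e => t.realize e = s.realize e
  | .rel R ts, e => FirstOrder.Language.Structure.RelMap R fun i => (ts i).realize e
  | .dep _, _ => True
  | .neg A, e => ¬ FOSat A e
  | .and A B, e => FOSat A e ∧ FOSat B e
  | .or A B, e => FOSat A e ∨ FOSat B e
  | .ex x A, e => ∃ a : M, FOSat A (Function.update e x a)
  | .all x A, e => ∀ a : M, FOSat A (Function.update e x a)

/-- Team semantics `𝔄 ⊨_X A`, for a team `X` with finite domain `V`. -/
def Sat [L.Structure M] [Nonempty M] : Fml L → (V : Finset ℕ) → Set (V → M) → Prop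
  | .eq t s, _, X => ∀ a ∈ X, val t a = val s a
  | .rel R ts, _, X => ∀ a ∈ X, FirstOrder.Language.Structure.RelMap R fun i => val (ts i) a
  | .dep ts, _, X => ∀ t ∈ ts.getLast?, ∀ a ∈ X, ∀ b ∈ X,
      (∀ s ∈ ts.dropLast, val s a = val s b) → val t a = val t b
  | .neg A, _, X => ∀ a ∈ X, ¬ FOSat A (ext a)
  | .and A B, V, X => Sat A V X ∧ Sat B V X
  | .or A B, V, X => ∃ Y Z : Set (V → M), X = Y ∪ Z ∧ Sat A V Y ∧ Sat B V Z
  | .ex x A, V, X => ∃ F : X → M,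
      Sat A (insert x V) (Set.range fun s : X => upd s.1 x (F s))
  | .all x A, V, X =>
      Sat A (insert x V) {s' | ∃ s ∈ X, ∃ a : M, s' = upd s x a}

end Semantics

/-- Logical consequence `T ⊨ A`: every team, of every (non-empty) model, whose domain contains the
free variables of `T` and `A` and that satisfies `T` satisfies `A`. -/
def Entails {L : FirstOrder.Language.{u, v}} (T : Set (Fml L)) (A : Fml L) : Prop :=
  ∀ (M : Type (max u v)) [L.Structure M] [Nonempty M] (V : Finset ℕ) (X : Set (V → M)),
    (∀ B ∈ T, B.fv ⊆ V) → A.fv ⊆ V → (∀ B ∈ T, Sat B V X) → Sat A V X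

open Fml in
/-- The natural deduction system: `Derives Γ A` says that there is a deduction of `A` all of whose
non-discharged assumptions belong to `Γ`. -/
inductive Derives {L : FirstOrder.Language.{u, v}} : Set (Fml L) → Fml L → Prop
  | assumption {Γ : Set (Fml L)} {A : Fml L} : A ∈ Γ → Derives Γ A
  | andI {Γ : Set (Fml L)} {A B : Fml L} : Derives Γ A → Derives Γ B → Derives Γ (and A B)
  | andE₁ {Γ : Set (Fml L)} {A B : Fml L} : Derives Γ (and A B) → Derives Γ A
  | andE₂ {Γ : Set (Fml L)} {A B : Fml L} : Derives Γ (and A B) → Derives Γ B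
  | orI₁ {Γ : Set (Fml L)} {A B : Fml L} : B.IsD → Derives Γ A → Derives Γ (or A B)
  | orI₂ {Γ : Set (Fml L)} {A B : Fml L} : A.IsD → Derives Γ B → Derives Γ (or A B)
  | orE {Γ : Set (Fml L)} {A B C : Fml L} : C.IsFO → Derives Γ (or A B) →
      Derives (insert A Γ) C → Derives (insert B Γ) C → Derives Γ C
  | negI {Γ : Set (Fml L)} {A B : Fml L} : A.IsFO → B.IsFO →
      Derives (insert A Γ) (and B (neg B)) → Derives Γ (neg A)
  | negE {Γ : Set (Fml L)} {A : Fml L} : A.IsFO → Derives Γ (neg (neg A)) → Derives Γ A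
  /-- `Δ` contains the non-discharged assumptions used in the derivation of `A`. -/
  | allI {Γ Δ : Set (Fml L)} {x : ℕ} {A : Fml L} : Δ ⊆ Γ → (∀ B ∈ Δ, x ∉ B.fv) →
      Derives Δ A → Derives Γ (all x A)
  | allE {Γ : Set (Fml L)} {x : ℕ} {A : Fml L} (t : L.Term ℕ) : A.SubstOK (single x t) →
      Derives Γ (all x A) → Derives Γ (A.subst (single x t))
  | exI {Γ : Set (Fml L)} {x : ℕ} {A : Fml L} (t : L.Term ℕ) : A.SubstOK (single x t) →
      Derives Γ (A.subst (single x t)) → Derives Γ (ex x A)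
  /-- `Δ` contains the non-discharged assumptions, except `A`, used in the derivation of `B`
  from `A`. -/
  | exE {Γ Δ : Set (Fml L)} {x : ℕ} {A B : Fml L} : Δ ⊆ Γ → (∀ C ∈ Δ, x ∉ C.fv) → x ∉ B.fv →
      Derives Γ (ex x A) → Derives (insert A Δ) B → Derives Γ B
  /-- Disjunction substitution. -/
  | orSubst {Γ : Set (Fml L)} {A B C : Fml L} : Derives Γ (or A B) →
      Derives (insert B Γ) C → Derives Γ (or A C)
  /-- Commutation of disjunction. -/
  | orComm {Γ : Set (Fml L)} {A B : Fml L} : Derives Γ (or B A) → Derives Γ (or A B)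
  /-- Associativity of disjunction. -/
  | orAssoc {Γ : Set (Fml L)} {A B C : Fml L} :
      Derives Γ (or (or A B) C) → Derives Γ (or A (or B C))
  /-- Extending scope of `∀`. -/
  | allScope {Γ : Set (Fml L)} {x : ℕ} {A B : Fml L} : x ∉ B.fv →
      Derives Γ (or (all x A) B) → Derives Γ (all x (or A B))
  /-- Extending scope of `∃`. -/
  | exScope {Γ : Set (Fml L)} {x : ℕ} {A B : Fml L} : x ∉ B.fv →
      Derives Γ (or (ex x A) B) → Derives Γ (ex x (or A B))
  /-- Unnesting: the term at position `i` is replaced by the new variable `z`. -/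
  | unnest {Γ : Set (Fml L)} {ts : List (L.Term ℕ)} {z : ℕ} (i : ℕ) (hi : i < ts.length) :
      z ∉ listVars ts → Derives Γ (dep ts) →
      Derives Γ (ex z (and (dep (ts.set i (FirstOrder.Language.Term.var z)))
        (eq (FirstOrder.Language.Term.var z) ts[i])))
  /-- Dependence distribution. In each block the quantified variables are distinct and the tuple
  `z⃗ⁱ` contains none of `yᵢ, yᵢ₊₁, …` of its block. -/
  | depDistr {Γ : Set (Fml L)} {l₁ l₂ : List (List ℕ × ℕ)} {C D : Fml L} :
      C.IsFO → C.IsQF → D.IsFO → D.IsQF →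
      (l₁.map Prod.snd).Nodup → (l₂.map Prod.snd).Nodup →
      (∀ i j : Fin l₁.length, i ≤ j → (l₁.get j).2 ∉ (l₁.get i).1) →
      (∀ i j : Fin l₂.length, i ≤ j → (l₂.get j).2 ∉ (l₂.get i).1) →
      (∀ d ∈ l₁, d.2 ∉ (depBlock l₂ D).vars) →
      (∀ d ∈ l₂, d.2 ∉ (depBlock l₁ C).vars) →
      Derives Γ (or (depBlock l₁ C) (depBlock l₂ D)) →
      Derives Γ (depBlock (l₁ ++ l₂) (or C D))
  /-- Dependence introduction. -/
  | depI {Γ : Set (Fml L)} {x y : ℕ} {A : Fml L} (z : List ℕ) :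
      (∀ i, i ∈ z ↔ i ∈ A.fv ∧ i ≠ x ∧ i ≠ y) →
      Derives Γ (ex x (all y A)) → Derives Γ (all y (ex x (and (depVar (z, x)) A)))
  /-- Dependence elimination. The renaming `ρ` sends the distinct variables `x⃗₀, y⃗₀` to distinct new
  variables `x⃗₁, y⃗₁`, and `w⃗` in an atom `=(w⃗, y₀ₚ)` of `D` consists of variables that come
  from `x⃗₀` or precede `y₀ₚ` in `y⃗₀`. -/
  | depE {Γ : Set (Fml L)} {xs ys : List ℕ} {D : List (List ℕ × ℕ)} {B : Fml L} (ρ : ℕ → ℕ) :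
      (xs ++ ys ++ xs.map ρ ++ ys.map ρ).Nodup →
      (∀ x, x ∉ xs ++ ys → ρ x = x) →
      (∀ x ∈ xs ++ ys, ρ x ∉ B.vars) →
      (∀ d ∈ D, ∃ (p : ℕ) (hp : p < ys.length), d.2 = ys[p] ∧ ∀ x ∈ d.1, x ∈ xs ++ ys.take p) →
      Derives Γ (depElimPrem xs ys D B) → Derives Γ (depElimConcl xs ys D ρ B)
  /-- Identity: reflexivity. -/
  | eqRefl {Γ : Set (Fml L)} (t : L.Term ℕ) : Derives Γ (eq t t)
  /-- Identity: substitution of equals in first-order formulas. -/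
  | eqSubst {Γ : Set (Fml L)} {x : ℕ} {A : Fml L} (t s : L.Term ℕ) : A.IsFO →
      A.SubstOK (single x t) → A.SubstOK (single x s) →
      Derives Γ (eq t s) → Derives Γ (A.subst (single x t)) → Derives Γ (A.subst (single x s))

end DepLogic

namespace DepLogic

open FirstOrder.Language (Term)
open FirstOrder.Language.Structure (RelMap)

/-! ### Values and substitution for terms. -/

section Terms

variable {L : FirstOrder.Language.{u, v}} {M : Type w}

/-! Soundness is an induction on deductions that rests on two properties of team semantics. Truth
depends only on the free variables and passes to subteams (`TSat.local`). First-order formulas are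
flat: they hold in a team iff they hold at each member (`TSat_iff_of_isFO`), which is what makes
∨-elimination and the negation rules sound. The dependence rules are statements about Skolem
functions (`depDistr_sound`, `depI_sound`, `depE_sound`).

Completeness is proved contrapositively. If `T` does not derive `φ`, no finite subset does.
Ultraproducts of teams preserve dependence logic (`TSat_ultraTeam`), so it suffices to satisfy each
finite subset, that is, one sentence, at an assignment that falsifies `φ`. That sentence has a
normal form `∀x⃗ ∃y⃗ (⋀ =(w⃗, y) ∧ C)` with `C` quantifier-free and first-order; it is derivable
from the sentence and semantically implies it (`NegQF.hasNF`).

A normal sentence says that there are functions `y = f_y(w⃗)` with which `C` holds for all `x⃗`.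
They cannot be named in first-order logic, but their graphs can be revealed one tuple at a time: by
dependence elimination, once a tuple has been produced, the sentence still holds with the extra
demand that the next tuple conform to the same functions. Iteration (`NormalSentence.derives_theta`)
yields formulas `theta` that promise a further tuple compatible with all earlier ones.

The model comes from a Henkin construction in ω steps (`NormalSentence.exists_model`). A stage is a
finite consistent set that contains such a `theta`; each step decides a formula, names a witness or
a term, or plays a tuple at prescribed arguments. In the limit, the variables modulo derivable
equality form the model, and the tuples played form the required team: any two are linked, all
satisfy `C`, and all values of `x⃗` occur. Starting with `¬φ` in the set makes `φ` false.

With a trivial normal sentence the same construction gives first-order completeness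
(`derives_of_FOSat`), which in turn justifies pushing negations inward on the way to the normal
form. -/

theorem realize_congr [L.Structure M] {t : L.Term ℕ} {e e' : ℕ → M}
    (h : ∀ i ∈ t.varFinset, e i = e' i) : t.realize e = t.realize e' := by
  induction t with
  | var i => exact h i (by simp [Term.varFinset])
  | func f ts ih =>
    simp only [Term.realize_func]
    congr 1
    funext i
    exact ih i fun j hj => h j (by
      simp only [Term.varFinset, Finset.mem_biUnion, Finset.mem_univ, true_and]; exact ⟨i, hj⟩)

theorem mem_listVars {ts : List (L.Term ℕ)} {i : ℕ} :
    i ∈ listVars ts ↔ ∃ t ∈ ts, i ∈ t.varFinset := by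
  induction ts with
  | nil => simp [listVars]
  | cons t ts ih =>
    have : listVars (t :: ts) = t.varFinset ∪ listVars ts := rfl
    simp [this, ih]

theorem mem_varFinset_subst {t : L.Term ℕ} {σ : ℕ → L.Term ℕ} {i : ℕ} :
    i ∈ (t.subst σ).varFinset ↔ ∃ j ∈ t.varFinset, i ∈ (σ j).varFinset := by
  induction t with
  | var j => simp [Term.subst, Term.varFinset]
  | func f ts ih =>
    simp only [Term.subst, Term.varFinset, Finset.mem_biUnion, Finset.mem_univ, true_and, ih]
    constructor
    · rintro ⟨k, j, hj, hi⟩; exact ⟨j, ⟨k, hj⟩, hi⟩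
    · rintro ⟨j, ⟨k, hj⟩, hi⟩; exact ⟨k, j, hj, hi⟩

theorem term_subst_congr {t : L.Term ℕ} {σ τ : ℕ → L.Term ℕ}
    (h : ∀ i ∈ t.varFinset, σ i = τ i) : t.subst σ = t.subst τ := by
  induction t with
  | var j => exact h j (by simp [Term.varFinset])
  | func f ts ih =>
    simp only [Term.subst]
    congr 1
    funext i
    exact ih i fun j hj => h j (by
      simp only [Term.varFinset, Finset.mem_biUnion, Finset.mem_univ, true_and]; exact ⟨i, hj⟩)

theorem term_subst_var (t : L.Term ℕ) : t.subst Term.var = t := by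
  induction t with
  | var j => rfl
  | func f ts ih => simp only [Term.subst, ih]

theorem term_subst_subst (t : L.Term ℕ) (σ τ : ℕ → L.Term ℕ) :
    (t.subst σ).subst τ = t.subst fun i => (σ i).subst τ := by
  induction t with
  | var j => rfl
  | func f ts ih => simp only [Term.subst, ih]

end Terms

/-! ### Variables and substitution in formulas. -/

namespace Fml

variable {L : FirstOrder.Language.{u, v}}

theorem IsFO.isD {A : Fml L} (h : A.IsFO) : A.IsD := by
  induction A <;> simp_all [IsFO, IsD]

theorem fv_subset_vars (A : Fml L) : A.fv ⊆ A.vars := by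
  induction A with
  | eq | rel | dep => exact subset_rfl
  | neg A ih => exact ih
  | and A B ihA ihB | or A B ihA ihB => exact Finset.union_subset_union ihA ihB
  | ex x A ih | all x A ih =>
    exact (Finset.erase_subset _ _).trans (ih.trans (Finset.subset_insert _ _))

theorem subst_congr {A : Fml L} {σ τ : ℕ → L.Term ℕ} (h : ∀ i ∈ A.fv, σ i = τ i) :
    A.subst σ = A.subst τ := by
  induction A generalizing σ τ with
  | eq t s =>
    simp only [subst]
    rw [term_subst_congr fun i hi => h i (Finset.mem_union_left _ hi),
      term_subst_congr fun i hi => h i (Finset.mem_union_right _ hi)]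
  | rel R ts =>
    simp only [subst]
    congr 1
    funext k
    exact term_subst_congr fun i hi => h i (Finset.mem_biUnion.2 ⟨k, Finset.mem_univ _, hi⟩)
  | dep ts =>
    simp only [subst]
    congr 1
    exact List.map_congr_left fun t ht =>
      term_subst_congr fun i hi => h i (mem_listVars.2 ⟨t, ht, hi⟩)
  | neg A ih => simp only [subst]; rw [ih h]
  | and A B ihA ihB | or A B ihA ihB =>
    simp only [subst]
    rw [ihA fun i hi => h i (Finset.mem_union_left _ hi),
      ihB fun i hi => h i (Finset.mem_union_right _ hi)]
  | ex x A ih | all x A ih =>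
    simp only [subst]
    congr 1
    refine ih fun i hi => ?_
    by_cases hx : i = x
    · subst hx; simp
    · simp [hx, h i (Finset.mem_erase.2 ⟨hx, hi⟩)]

theorem subst_var (A : Fml L) : A.subst Term.var = A := by
  induction A with
  | eq | rel | dep => simp [subst, term_subst_var]
  | neg A ih => simp [subst, ih]
  | and A B ihA ihB | or A B ihA ihB => simp [subst, ihA, ihB]
  | ex x A ih | all x A ih => simp [subst, ih]

/-- Capture is impossible when the substitution introduces only variables that appear nowhere in the
formula. The alternative `j = i` is needed below a quantifier, where the bound variable is sent to
itself. -/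
theorem substOK_of_forall {A : Fml L} {σ : ℕ → L.Term ℕ}
    (h : ∀ i ∈ A.fv, ∀ j ∈ (σ i).varFinset, j = i ∨ j ∉ A.vars) : A.SubstOK σ := by
  induction A generalizing σ with
  | eq | rel | dep => trivial
  | neg A ih => exact ih h
  | and A B ihA ihB | or A B ihA ihB =>
    refine ⟨ihA fun i hi j hj => ?_, ihB fun i hi j hj => ?_⟩
    · exact (h i (Finset.mem_union_left _ hi) j hj).imp_right fun h' h'' =>
        h' (Finset.mem_union_left _ h'')
    · exact (h i (Finset.mem_union_right _ hi) j hj).imp_right fun h' h'' =>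
        h' (Finset.mem_union_right _ h'')
  | ex x A ih | all x A ih =>
    refine ⟨fun i hi hx => ?_, ih fun i hi j hj => ?_⟩
    · rcases h i hi x hx with rfl | h'
      · simp at hi
      · exact h' (Finset.mem_insert_self _ _)
    · by_cases hx : i = x
      · subst hx
        simp only [Function.update_self, Term.varFinset, Finset.mem_singleton] at hj
        exact Or.inl hj
      · rw [Function.update_of_ne hx] at hj
        exact (h i (Finset.mem_erase.2 ⟨hx, hi⟩) j hj).imp_right fun h' h'' =>
          h' (Finset.mem_insert_of_mem h'')

theorem isFO_subst {A : Fml L} {σ : ℕ → L.Term ℕ} : (A.subst σ).IsFO ↔ A.IsFO := by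
  induction A generalizing σ <;> simp_all [IsFO, subst]

theorem isQF_subst {A : Fml L} {σ : ℕ → L.Term ℕ} : (A.subst σ).IsQF ↔ A.IsQF := by
  induction A generalizing σ <;> simp_all [IsQF, subst]

theorem mem_fv_subst {A : Fml L} {σ : ℕ → L.Term ℕ} {i : ℕ} (h : i ∈ (A.subst σ).fv) :
    ∃ j ∈ A.fv, i ∈ (σ j).varFinset := by
  induction A generalizing σ with
  | eq t s =>
    simp only [subst, fv, Finset.mem_union, mem_varFinset_subst] at h ⊢
    rcases h with ⟨j, hj, hi⟩ | ⟨j, hj, hi⟩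
    exacts [⟨j, Or.inl hj, hi⟩, ⟨j, Or.inr hj, hi⟩]
  | rel R ts =>
    simp only [subst, fv, Finset.mem_biUnion, Finset.mem_univ, true_and, mem_varFinset_subst] at h ⊢
    obtain ⟨k, j, hj, hi⟩ := h
    exact ⟨j, ⟨k, hj⟩, hi⟩
  | dep ts =>
    simp only [subst, fv, mem_listVars, List.mem_map] at h ⊢
    obtain ⟨_, ⟨t, ht, rfl⟩, hi⟩ := h
    obtain ⟨j, hj, hi⟩ := mem_varFinset_subst.1 hi
    exact ⟨j, ⟨t, ht, hj⟩, hi⟩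
  | neg A ih => exact ih h
  | and A B ihA ihB | or A B ihA ihB =>
    simp only [subst, fv, Finset.mem_union] at h ⊢
    rcases h with h | h
    · obtain ⟨j, hj, hi⟩ := ihA h; exact ⟨j, Or.inl hj, hi⟩
    · obtain ⟨j, hj, hi⟩ := ihB h; exact ⟨j, Or.inr hj, hi⟩
  | ex x A ih | all x A ih =>
    simp only [subst, fv, Finset.mem_erase] at h ⊢
    obtain ⟨hx, h⟩ := h
    obtain ⟨j, hj, hi⟩ := ih h
    by_cases hjx : j = x
    · subst hjx
      simp only [Function.update_self, Term.varFinset, Finset.mem_singleton] at hi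
      exact absurd hi hx
    · rw [Function.update_of_ne hjx] at hi
      exact ⟨j, ⟨hjx, hj⟩, hi⟩

end Fml

/-! ### Team semantics with total assignments. -/

section TeamSemantics

variable {L : FirstOrder.Language.{u, v}} {M : Type w}

/-- Team semantics for teams of total assignments, in relational form: the supplementation and
the splitting of a team need only cover the team. -/
def TSat [L.Structure M] : Fml L → Set (ℕ → M) → Prop
  | .eq t s, X => ∀ e ∈ X, t.realize e = s.realize e
  | .rel R ts, X => ∀ e ∈ X, RelMap R fun i => (ts i).realize e
  | .dep ts, X => ∀ t ∈ ts.getLast?, ∀ a ∈ X, ∀ b ∈ X,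
      (∀ s ∈ ts.dropLast, s.realize a = s.realize b) → t.realize a = t.realize b
  | .neg A, X => ∀ e ∈ X, ¬ FOSat A e
  | .and A B, X => TSat A X ∧ TSat B X
  | .or A B, X => ∃ Y Z, X ⊆ Y ∪ Z ∧ TSat A Y ∧ TSat B Z
  | .ex x A, X => ∃ Y, TSat A Y ∧ ∀ e ∈ X, ∃ a, Function.update e x a ∈ Y
  | .all x A, X => ∃ Y, TSat A Y ∧ ∀ e ∈ X, ∀ a, Function.update e x a ∈ Y

theorem FOSat_congr [L.Structure M] {A : Fml L} {e e' : ℕ → M} (h : ∀ i ∈ A.fv, e i = e' i) :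
    FOSat A e ↔ FOSat A e' := by
  induction A generalizing e e' with
  | eq t s =>
    simp only [FOSat]
    rw [realize_congr fun i hi => h i (Finset.mem_union_left _ hi),
      realize_congr fun i hi => h i (Finset.mem_union_right _ hi)]
  | rel R ts =>
    simp only [FOSat]
    have : (fun k => (ts k).realize e) = fun k => (ts k).realize e' := by
      funext k
      exact realize_congr fun i hi => h i (Finset.mem_biUnion.2 ⟨k, Finset.mem_univ _, hi⟩)
    rw [this]
  | dep ts => exact Iff.rfl
  | neg A ih => exact not_congr (ih h)
  | and A B ihA ihB =>
    exact and_congr (ihA fun i hi => h i (Finset.mem_union_left _ hi))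
      (ihB fun i hi => h i (Finset.mem_union_right _ hi))
  | or A B ihA ihB =>
    exact or_congr (ihA fun i hi => h i (Finset.mem_union_left _ hi))
      (ihB fun i hi => h i (Finset.mem_union_right _ hi))
  | ex x A ih =>
    refine exists_congr fun a => ih fun i hi => ?_
    by_cases hx : i = x
    · subst hx; simp
    · simp [hx, h i (Finset.mem_erase.2 ⟨hx, hi⟩)]
  | all x A ih =>
    refine forall_congr' fun a => ih fun i hi => ?_
    by_cases hx : i = x
    · subst hx; simp
    · simp [hx, h i (Finset.mem_erase.2 ⟨hx, hi⟩)]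

/-- Locality and downward closure. -/
theorem TSat.local [L.Structure M] {A : Fml L} {X X' : Set (ℕ → M)} (hA : TSat A X)
    (h : ∀ e' ∈ X', ∃ e ∈ X, ∀ i ∈ A.fv, e i = e' i) : TSat A X' := by
  induction A generalizing X X' with
  | eq t s =>
    intro e' he'
    obtain ⟨e, he, hee⟩ := h e' he'
    rw [← realize_congr fun i hi => hee i (Finset.mem_union_left _ hi),
      ← realize_congr fun i hi => hee i (Finset.mem_union_right _ hi)]
    exact hA e he
  | rel R ts =>
    intro e' he'
    obtain ⟨e, he, hee⟩ := h e' he'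
    exact (FOSat_congr (A := .rel R ts) hee).1 (hA e he)
  | dep ts =>
    intro t ht a' ha' b' hb' hab
    obtain ⟨a, ha, haa⟩ := h a' ha'
    obtain ⟨b, hb, hbb⟩ := h b' hb'
    have hva : ∀ s ∈ ts, s.realize a = s.realize a' := fun s hs =>
      realize_congr fun i hi => haa i (mem_listVars.2 ⟨s, hs, hi⟩)
    have hvb : ∀ s ∈ ts, s.realize b = s.realize b' := fun s hs =>
      realize_congr fun i hi => hbb i (mem_listVars.2 ⟨s, hs, hi⟩)
    have htm : t ∈ ts := List.mem_of_getLast? ht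
    rw [← hva t htm, ← hvb t htm]
    refine hA t ht a ha b hb fun s hs => ?_
    rw [hva s (List.mem_of_mem_dropLast hs), hvb s (List.mem_of_mem_dropLast hs)]
    exact hab s hs
  | neg A ih =>
    intro e' he'
    obtain ⟨e, he, hee⟩ := h e' he'
    exact fun hs => hA e he ((FOSat_congr (A := A) hee).2 hs)
  | and A B ihA ihB =>
    exact ⟨ihA hA.1 fun e' he' => (h e' he').imp fun e he =>
        ⟨he.1, fun i hi => he.2 i (Finset.mem_union_left _ hi)⟩,
      ihB hA.2 fun e' he' => (h e' he').imp fun e he =>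
        ⟨he.1, fun i hi => he.2 i (Finset.mem_union_right _ hi)⟩⟩
  | or A B ihA ihB =>
    obtain ⟨Y, Z, hXY, hY, hZ⟩ := hA
    -- Each half is enlarged to all assignments that agree with one of its members on the free
    -- variables of its disjunct; the induction hypothesis admits such teams.
    refine ⟨{e' | ∃ e ∈ Y, ∀ i ∈ A.fv, e i = e' i}, {e' | ∃ e ∈ Z, ∀ i ∈ B.fv, e i = e' i}, ?_,
      ihA hY fun e' he' => he', ihB hZ fun e' he' => he'⟩
    intro e' he'
    obtain ⟨e, he, hee⟩ := h e' he'
    rcases hXY he with h1 | h1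
    · exact Or.inl ⟨e, h1, fun i hi => hee i (Finset.mem_union_left _ hi)⟩
    · exact Or.inr ⟨e, h1, fun i hi => hee i (Finset.mem_union_right _ hi)⟩
  | ex x A ih =>
    obtain ⟨Y, hY, hX⟩ := hA
    refine ⟨{e' | ∃ e ∈ Y, ∀ i ∈ A.fv, e i = e' i}, ih hY fun e' he' => he', ?_⟩
    intro e' he'
    obtain ⟨e, he, hee⟩ := h e' he'
    obtain ⟨a, ha⟩ := hX e he
    refine ⟨a, _, ha, fun i hi => ?_⟩
    by_cases hx : i = x
    · subst hx; simp
    · simp [hx, hee i (Finset.mem_erase.2 ⟨hx, hi⟩)]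
  | all x A ih =>
    obtain ⟨Y, hY, hX⟩ := hA
    refine ⟨{e' | ∃ e ∈ Y, ∀ i ∈ A.fv, e i = e' i}, ih hY fun e' he' => he', ?_⟩
    intro e' he' a
    obtain ⟨e, he, hee⟩ := h e' he'
    refine ⟨_, hX e he a, fun i hi => ?_⟩
    by_cases hx : i = x
    · subst hx; simp
    · simp [hx, hee i (Finset.mem_erase.2 ⟨hx, hi⟩)]

theorem TSat.mono [L.Structure M] {A : Fml L} {X X' : Set (ℕ → M)} (hA : TSat A X)
    (h : X' ⊆ X) : TSat A X' :=
  hA.local fun e he => ⟨e, h he, fun _ _ => rfl⟩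

/-- First-order formulas are flat. -/
theorem TSat_iff_of_isFO [L.Structure M] {A : Fml L} (hA : A.IsFO) {X : Set (ℕ → M)} :
    TSat A X ↔ ∀ e ∈ X, FOSat A e := by
  induction A generalizing X with
  | eq | rel => exact Iff.rfl
  | dep => exact hA.elim
  | neg A ih => exact Iff.rfl
  | and A B ihA ihB =>
    simp only [TSat, FOSat, ihA hA.1, ihB hA.2]
    exact ⟨fun h e he => ⟨h.1 e he, h.2 e he⟩, fun h => ⟨fun e he => (h e he).1,
      fun e he => (h e he).2⟩⟩
  | or A B ihA ihB =>
    simp only [TSat, FOSat, ihA hA.1, ihB hA.2]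
    constructor
    · rintro ⟨Y, Z, hX, hY, hZ⟩ e he
      exact (hX he).imp (hY e) (hZ e)
    · intro h
      -- The two parts need only cover the team, so the largest possible ones serve.
      exact ⟨{e | FOSat A e}, {e | FOSat B e}, h, fun _ h => h, fun _ h => h⟩
  | ex x A ih =>
    simp only [TSat, FOSat, ih hA]
    constructor
    · rintro ⟨Y, hY, hX⟩ e he
      exact (hX e he).imp fun a ha => hY _ ha
    · intro h
      exact ⟨{e | FOSat A e}, fun _ h => h, h⟩
  | all x A ih =>
    simp only [TSat, FOSat, ih hA]
    constructor
    · rintro ⟨Y, hY, hX⟩ e he a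
      exact hY _ (hX e he a)
    · intro h
      exact ⟨{e | FOSat A e}, fun _ h => h, h⟩

/-- The terms substituted for the other free variables do not contain `x`, so a new value of `x`
does not disturb them. This is the quantifier case of both substitution lemmas. -/
theorem realize_subst_update [L.Structure M] {A : Fml L} {σ : ℕ → L.Term ℕ} {x : ℕ}
    (h : ∀ y ∈ A.fv.erase x, x ∉ (σ y).varFinset) (e : ℕ → M) (a : M) {i : ℕ} (hi : i ∈ A.fv) :
    (Function.update σ x (Term.var x) i).realize (Function.update e x a) =
      Function.update (fun j => (σ j).realize e) x a i := by
  by_cases hx : i = x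
  · subst hx; simp
  · rw [Function.update_of_ne hx, Function.update_of_ne hx]
    refine realize_congr fun j hj => ?_
    have : j ≠ x := by
      rintro rfl
      exact h i (Finset.mem_erase.2 ⟨hx, hi⟩) hj
    simp [this]

theorem FOSat_subst [L.Structure M] {A : Fml L} {σ : ℕ → L.Term ℕ} (h : A.SubstOK σ)
    {e : ℕ → M} : FOSat (A.subst σ) e ↔ FOSat A fun i => (σ i).realize e := by
  induction A generalizing σ e with
  | eq t s => simp [FOSat, Fml.subst, Term.realize_subst]
  | rel R ts => simp [FOSat, Fml.subst, Term.realize_subst]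
  | dep ts => exact Iff.rfl
  | neg A ih => exact not_congr (ih h)
  | and A B ihA ihB => exact and_congr (ihA h.1) (ihB h.2)
  | or A B ihA ihB => exact or_congr (ihA h.1) (ihB h.2)
  | ex x A ih =>
    refine exists_congr fun a => (ih h.2).trans (FOSat_congr fun i hi => ?_)
    exact realize_subst_update h.1 e a hi
  | all x A ih =>
    refine forall_congr' fun a => (ih h.2).trans (FOSat_congr fun i hi => ?_)
    exact realize_subst_update h.1 e a hi

/-- The team is pushed forward along the change of assignments induced by `σ`. Splittings travel by
image and preimage; below a quantifier the two evaluations agree only on the free variables of the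
body, and locality closes the gap. -/
theorem TSat_subst [L.Structure M] {A : Fml L} {σ : ℕ → L.Term ℕ} (h : A.SubstOK σ)
    {X : Set (ℕ → M)} :
    TSat (A.subst σ) X ↔ TSat A ((fun e i => (σ i).realize e) '' X) := by
  induction A generalizing σ X with
  | eq t s => simp [TSat, Fml.subst, Term.realize_subst]
  | rel R ts => simp [TSat, Fml.subst, Term.realize_subst]
  | dep ts =>
    simp only [TSat, Fml.subst, List.getLast?_map, ← List.map_dropLast, Set.forall_mem_image,
      Option.mem_map, forall_exists_index, and_imp, forall_apply_eq_imp_iff₂, List.mem_map,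
      Term.realize_subst]
  | neg A ih =>
    simp only [TSat, Fml.subst, Set.forall_mem_image]
    exact forall₂_congr fun e he => not_congr (FOSat_subst (A := A) h)
  | and A B ihA ihB => exact and_congr (ihA h.1) (ihB h.2)
  | or A B ihA ihB =>
    simp only [TSat, Fml.subst]
    constructor
    · rintro ⟨Y, Z, hX, hY, hZ⟩
      refine ⟨_, _, ?_, (ihA h.1).1 hY, (ihB h.2).1 hZ⟩
      rw [← Set.image_union]
      exact Set.image_mono hX
    · rintro ⟨Y, Z, hX, hY, hZ⟩
      refine ⟨(fun e i => (σ i).realize e) ⁻¹' Y, (fun e i => (σ i).realize e) ⁻¹' Z, ?_,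
        (ihA h.1).2 (hY.mono (Set.image_preimage_subset _ _)),
        (ihB h.2).2 (hZ.mono (Set.image_preimage_subset _ _))⟩
      exact fun e he => hX ⟨e, he, rfl⟩
  | ex x A ih =>
    simp only [TSat, Fml.subst, Set.forall_mem_image]
    constructor
    · rintro ⟨Y, hY, hX⟩
      refine ⟨{e' | ∃ e ∈ (fun e i => (Function.update σ x (Term.var x) i).realize e) '' Y,
        ∀ i ∈ A.fv, e i = e' i}, ((ih h.2).1 hY).local fun e' he' => he', fun e he => ?_⟩
      obtain ⟨a, ha⟩ := hX e he
      exact ⟨a, _, ⟨_, ha, rfl⟩, fun i hi => realize_subst_update h.1 e a hi⟩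
    · rintro ⟨Y, hY, hX⟩
      refine ⟨{e | ∃ e' ∈ Y, ∀ i ∈ A.fv, e' i =
        (Function.update σ x (Term.var x) i).realize e}, (ih h.2).2 (hY.local ?_), fun e he => ?_⟩
      · rintro _ ⟨e, he, rfl⟩; exact he
      · obtain ⟨a, ha⟩ := hX he
        exact ⟨a, _, ha, fun i hi => (realize_subst_update h.1 e a hi).symm⟩
  | all x A ih =>
    simp only [TSat, Fml.subst, Set.forall_mem_image]
    constructor
    · rintro ⟨Y, hY, hX⟩
      refine ⟨{e' | ∃ e ∈ (fun e i => (Function.update σ x (Term.var x) i).realize e) '' Y,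
        ∀ i ∈ A.fv, e i = e' i}, ((ih h.2).1 hY).local fun e' he' => he', fun e he a => ?_⟩
      exact ⟨_, ⟨_, hX e he a, rfl⟩, fun i hi => realize_subst_update h.1 e a hi⟩
    · rintro ⟨Y, hY, hX⟩
      refine ⟨{e | ∃ e' ∈ Y, ∀ i ∈ A.fv, e' i =
        (Function.update σ x (Term.var x) i).realize e}, (ih h.2).2 (hY.local ?_), fun e he a => ?_⟩
      · rintro _ ⟨e, he, rfl⟩; exact he
      · exact ⟨_, hX he a, fun i hi => (realize_subst_update h.1 e a hi).symm⟩

theorem ext_upd [Nonempty M] {V : Finset ℕ} (s : V → M) (x : ℕ) (a : M) :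
    ext (upd s x a) = Function.update (ext s) x a := by
  funext i
  by_cases hx : i = x
  · subst hx; simp [ext, upd]
  · simp [ext, upd, hx]

/-- Team semantics over finite domains and over total assignments agree. -/
theorem Sat_iff_TSat [L.Structure M] [Nonempty M] {A : Fml L} {V : Finset ℕ} {X : Set (V → M)} :
    Sat A V X ↔ TSat A (ext '' X) := by
  induction A generalizing V with
  | eq | rel | dep | neg => simp [Sat, TSat, val]
  | and A B ihA ihB => exact and_congr ihA ihB
  | or A B ihA ihB =>
    simp only [Sat, TSat, ihA, ihB]
    constructor
    · rintro ⟨Y, Z, rfl, hY, hZ⟩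
      exact ⟨_, _, by rw [← Set.image_union], hY, hZ⟩
    · rintro ⟨Y, Z, hX, hY, hZ⟩
      refine ⟨{s ∈ X | ext s ∈ Y}, {s ∈ X | ext s ∈ Z}, ?_, hY.mono ?_, hZ.mono ?_⟩
      · ext s
        constructor
        · intro hs
          exact (hX ⟨s, hs, rfl⟩).imp (fun h => ⟨hs, h⟩) (fun h => ⟨hs, h⟩)
        · rintro (h | h) <;> exact h.1
      · rintro _ ⟨s, hs, rfl⟩; exact hs.2
      · rintro _ ⟨s, hs, rfl⟩; exact hs.2
  | ex x A ih =>
    simp only [Sat, TSat, ih, Set.forall_mem_image]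
    constructor
    · rintro ⟨F, hF⟩
      refine ⟨_, hF, fun s hs => ⟨F ⟨s, hs⟩, _, ⟨⟨s, hs⟩, rfl⟩, ext_upd _ _ _⟩⟩
    · rintro ⟨Y, hY, hX⟩
      -- One value per member is selected; downward closure discards the rest of `Y`.
      choose F hF using hX
      refine ⟨fun s => F s.2, hY.mono ?_⟩
      rintro _ ⟨_, ⟨s, rfl⟩, rfl⟩
      simp only [ext_upd]
      exact hF s.2
  | all x A ih =>
    simp only [Sat, TSat, ih, Set.forall_mem_image]
    constructor
    · intro h
      exact ⟨_, h, fun s hs a => ⟨_, ⟨s, hs, a, rfl⟩, ext_upd _ _ _⟩⟩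
    · rintro ⟨Y, hY, hX⟩
      refine hY.mono ?_
      rintro _ ⟨_, ⟨s, hs, a, rfl⟩, rfl⟩
      rw [ext_upd]
      exact hX hs a

end TeamSemantics

end DepLogic

/-! ### Quantifier blocks; soundness of dependence distribution and introduction. -/

namespace DepLogic

open FirstOrder.Language (Term)
open FirstOrder.Language.Structure (RelMap)

namespace Fml

variable {L : FirstOrder.Language.{u, v}}

theorem bigAnd_cons (A : Fml L) {As : List (Fml L)} (h : As ≠ []) :
    bigAnd (A :: As) = and A (bigAnd As) := by
  cases As with
  | nil => exact absurd rfl h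
  | cons B As => rfl

theorem vars_subset_vars_bigAnd {A : Fml L} {As : List (Fml L)} (h : A ∈ As) :
    A.vars ⊆ (bigAnd As).vars := by
  induction As with
  | nil => simp at h
  | cons B As ih =>
    by_cases hAs : As = []
    · subst hAs
      rw [List.mem_singleton] at h
      subst h
      exact subset_rfl
    · rw [bigAnd_cons B hAs]
      rcases List.mem_cons.1 h with rfl | h
      · exact Finset.subset_union_left
      · exact (ih h).trans Finset.subset_union_right

theorem fv_top : (top : Fml L).fv = ∅ := by
  ext i; simp [top, fv, Term.varFinset]

theorem mem_fv_bigAnd {As : List (Fml L)} {i : ℕ} :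
    i ∈ (bigAnd As).fv ↔ ∃ A ∈ As, i ∈ A.fv := by
  induction As with
  | nil => simp [bigAnd, fv_top]
  | cons B As ih =>
    by_cases hAs : As = []
    · subst hAs; simp [bigAnd]
    · rw [bigAnd_cons B hAs]; simp [fv, ih]

theorem isFO_bigAnd {As : List (Fml L)} : (bigAnd As).IsFO ↔ ∀ A ∈ As, A.IsFO := by
  induction As with
  | nil => simp [bigAnd, top, IsFO]
  | cons B As ih =>
    by_cases hAs : As = []
    · subst hAs; simp [bigAnd]
    · rw [bigAnd_cons B hAs]; simp [IsFO, ih]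

theorem subst_bigAnd {As : List (Fml L)} {σ : ℕ → L.Term ℕ} :
    (bigAnd As).subst σ = bigAnd (As.map fun A => A.subst σ) := by
  induction As with
  | nil => simp [bigAnd, top, subst, Term.subst]
  | cons B As ih =>
    by_cases hAs : As = []
    · subst hAs; simp [bigAnd]
    · rw [bigAnd_cons B hAs, List.map_cons, bigAnd_cons _ (by simpa using hAs), ← ih]; rfl

theorem mem_fv_exs {ys : List ℕ} {A : Fml L} {i : ℕ} :
    i ∈ (exs ys A).fv ↔ i ∈ A.fv ∧ i ∉ ys := by
  induction ys with
  | nil => simp [exs]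
  | cons y ys ih =>
    have : exs (y :: ys) A = ex y (exs ys A) := rfl
    rw [this]; simp [fv, ih]; tauto

theorem mem_fv_alls {xs : List ℕ} {A : Fml L} {i : ℕ} :
    i ∈ (alls xs A).fv ↔ i ∈ A.fv ∧ i ∉ xs := by
  induction xs with
  | nil => simp [alls]
  | cons y ys ih =>
    have : alls (y :: ys) A = all y (alls ys A) := rfl
    rw [this]; simp [fv, ih]; tauto

theorem vars_exs {ys : List ℕ} {A : Fml L} : (exs ys A).vars = ys.toFinset ∪ A.vars := by
  induction ys with
  | nil => simp [exs]
  | cons y ys ih =>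
    have : exs (y :: ys) A = ex y (exs ys A) := rfl
    rw [this]; simp [vars, ih]

theorem mem_fv_depVar {d : List ℕ × ℕ} {i : ℕ} :
    i ∈ (depVar d : Fml L).fv ↔ i ∈ d.1 ∨ i = d.2 := by
  simp only [depVar, fv, mem_listVars, List.mem_map]
  constructor
  · rintro ⟨_, ⟨j, hj, rfl⟩, hi⟩
    simp only [Term.varFinset, Finset.mem_singleton] at hi
    subst hi
    simpa using hj
  · intro h
    exact ⟨_, ⟨i, by simpa using h, rfl⟩, by simp [Term.varFinset]⟩

theorem vars_depVar {d : List ℕ × ℕ} : (depVar d : Fml L).vars = (depVar d : Fml L).fv := rfl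

theorem mem_vars_depBlock {l : List (List ℕ × ℕ)} {C : Fml L} {d : List ℕ × ℕ} (hd : d ∈ l)
    {i : ℕ} (hi : i ∈ d.1 ∨ i = d.2) : i ∈ (depBlock l C).vars := by
  rw [depBlock, vars_exs]
  refine Finset.mem_union_right _ (Finset.mem_union_left _ ?_)
  refine vars_subset_vars_bigAnd (List.mem_map_of_mem hd) ?_
  rw [vars_depVar, mem_fv_depVar]
  exact hi

theorem vars_subset_vars_depBlock {l : List (List ℕ × ℕ)} {C : Fml L} :
    C.vars ⊆ (depBlock l C).vars := by
  rw [depBlock, vars_exs]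
  exact Finset.subset_union_right.trans Finset.subset_union_right

end Fml

open Fml

section

variable {L : FirstOrder.Language.{u, v}} {M : Type w} [L.Structure M]

/-- Successive supplementations compose, so a whole block needs one witnessing team; only the values
outside the block are tied to the original assignment. -/
theorem TSat_exs {ys : List ℕ} {A : Fml L} {X : Set (ℕ → M)} :
    TSat (exs ys A) X ↔ ∃ Y, TSat A Y ∧ ∀ e ∈ X, ∃ e' ∈ Y, ∀ i ∉ ys, e' i = e i := by
  induction ys generalizing X with
  | nil =>
    constructor
    · intro h
      exact ⟨X, h, fun e he => ⟨e, he, fun _ _ => rfl⟩⟩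
    · rintro ⟨Y, hY, h⟩
      exact hY.mono fun e he => by
        obtain ⟨e', he', h'⟩ := h e he
        rwa [← funext fun i => h' i (by simp)]
  | cons y ys ih =>
    change TSat (ex y (exs ys A)) X ↔ _
    simp only [TSat, ih]
    constructor
    · rintro ⟨Z, ⟨Y, hY, hZ⟩, hX⟩
      refine ⟨Y, hY, fun e he => ?_⟩
      obtain ⟨a, ha⟩ := hX e he
      obtain ⟨e', he', h'⟩ := hZ _ ha
      refine ⟨e', he', fun i hi => ?_⟩
      simp only [List.mem_cons, not_or] at hi
      rw [h' i hi.2, Function.update_of_ne hi.1]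
    · rintro ⟨Y, hY, hX⟩
      refine ⟨{e | ∃ e' ∈ Y, ∀ i ∉ ys, e' i = e i}, ⟨Y, hY, fun e he => he⟩, fun e he => ?_⟩
      obtain ⟨e', he', h'⟩ := hX e he
      refine ⟨e' y, e', he', fun i hi => ?_⟩
      by_cases hiy : i = y
      · subst hiy; simp
      · rw [Function.update_of_ne hiy, h' i (by simp [hi, hiy])]

theorem TSat_alls {xs : List ℕ} {A : Fml L} {X : Set (ℕ → M)} :
    TSat (alls xs A) X ↔
      ∃ Y, TSat A Y ∧ ∀ e ∈ X, ∀ e' : ℕ → M, (∀ i ∉ xs, e' i = e i) → e' ∈ Y := by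
  induction xs generalizing X with
  | nil =>
    constructor
    · intro h
      refine ⟨X, h, fun e he e' h' => ?_⟩
      rwa [funext fun i => h' i (by simp)]
    · rintro ⟨Y, hY, h⟩
      exact hY.mono fun e he => h e he e fun _ _ => rfl
  | cons y ys ih =>
    change TSat (all y (alls ys A)) X ↔ _
    simp only [TSat, ih]
    constructor
    · rintro ⟨Z, ⟨Y, hY, hZ⟩, hX⟩
      refine ⟨Y, hY, fun e he e' h' => hZ _ (hX e he (e' y)) _ fun i hi => ?_⟩
      by_cases hiy : i = y
      · subst hiy; simp
      · rw [Function.update_of_ne hiy, h' i (by simp [hi, hiy])]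
    · rintro ⟨Y, hY, hX⟩
      refine ⟨{e | ∀ e' : ℕ → M, (∀ i ∉ ys, e' i = e i) → e' ∈ Y}, ⟨Y, hY, fun e he => he⟩,
        fun e he a e' h' => hX e he e' fun i hi => ?_⟩
      simp only [List.mem_cons, not_or] at hi
      rw [h' i hi.2, Function.update_of_ne hi.1]

theorem TSat_empty (A : Fml L) : TSat A (∅ : Set (ℕ → M)) := by
  induction A with
  | eq | rel | dep | neg => simp [TSat]
  | and A B ihA ihB => exact ⟨ihA, ihB⟩
  | or A B ihA ihB => exact ⟨∅, ∅, by simp, ihA, ihB⟩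
  | ex x A ih | all x A ih => exact ⟨∅, ih, by simp⟩

theorem TSat_top (X : Set (ℕ → M)) : TSat (top : Fml L) X :=
  ⟨Set.univ, fun _ _ => rfl, fun _ _ _ => trivial⟩

theorem FOSat_top (e : ℕ → M) : FOSat (top : Fml L) e := fun _ => rfl

theorem TSat_bigAnd {As : List (Fml L)} {X : Set (ℕ → M)} :
    TSat (bigAnd As) X ↔ ∀ A ∈ As, TSat A X := by
  induction As with
  | nil => simpa [bigAnd] using TSat_top X
  | cons B As ih =>
    by_cases hAs : As = []
    · subst hAs; simp [bigAnd]
    · rw [bigAnd_cons B hAs]; simp [TSat, ih]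

theorem FOSat_bigAnd {As : List (Fml L)} {e : ℕ → M} :
    FOSat (bigAnd As) e ↔ ∀ A ∈ As, FOSat A e := by
  induction As with
  | nil => simpa [bigAnd] using FOSat_top e
  | cons B As ih =>
    by_cases hAs : As = []
    · subst hAs; simp [bigAnd]
    · rw [bigAnd_cons B hAs]; simp [FOSat, ih]

theorem TSat_depVar {d : List ℕ × ℕ} {X : Set (ℕ → M)} :
    TSat (depVar d : Fml L) X ↔
      ∀ a ∈ X, ∀ b ∈ X, (∀ i ∈ d.1, a i = b i) → a d.2 = b d.2 := by
  simp [depVar, TSat]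

theorem TSat_depBlock {l : List (List ℕ × ℕ)} {C : Fml L} (hC : C.IsFO) {X : Set (ℕ → M)} :
    TSat (depBlock l C) X ↔ ∃ Y : Set (ℕ → M),
      (∀ d ∈ l, ∀ a ∈ Y, ∀ b ∈ Y, (∀ i ∈ d.1, a i = b i) → a d.2 = b d.2) ∧
      (∀ e ∈ Y, FOSat C e) ∧ ∀ e ∈ X, ∃ e' ∈ Y, ∀ i ∉ l.map Prod.snd, e' i = e i := by
  simp only [depBlock, TSat_exs, TSat, TSat_bigAnd, TSat_iff_of_isFO hC, List.forall_mem_map,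
    TSat_depVar, and_assoc]

/-- Functional equations `y = f_y(z⃗)` in which `z⃗` contains no later variable have a solution. -/
theorem exists_solution (l : List (List ℕ × ℕ)) (hn : (l.map Prod.snd).Nodup)
    (hl : l.Pairwise fun d d' => d'.2 ∉ d.1) (hl' : ∀ d ∈ l, d.2 ∉ d.1)
    (f : List ℕ × ℕ → (ℕ → M) → M)
    (hf : ∀ d ∈ l, ∀ a b : ℕ → M, (∀ i ∈ d.1, a i = b i) → f d a = f d b) (e : ℕ → M) :
    ∃ e' : ℕ → M, (∀ i ∉ l.map Prod.snd, e' i = e i) ∧ ∀ d ∈ l, e' d.2 = f d e' := by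
  induction l generalizing e with
  | nil => exact ⟨e, by simp, by simp⟩
  | cons d l ih =>
    simp only [List.map_cons, List.nodup_cons] at hn
    rw [List.pairwise_cons] at hl
    -- The first equation is solved directly from `e`. Its arguments `d.1` contain neither `d.2` nor
    -- a later variable, so solving the remaining equations does not spoil it.
    obtain ⟨e', h1, h2⟩ := ih hn.2 hl.2 (fun d hd => hl' d (List.mem_cons_of_mem _ hd))
      (fun d hd => hf d (List.mem_cons_of_mem _ hd)) (Function.update e d.2 (f d e))
    refine ⟨e', fun i hi => ?_, fun d' hd' => ?_⟩
    · simp only [List.map_cons, List.mem_cons, not_or] at hi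
      rw [h1 i hi.2, Function.update_of_ne hi.1]
    · rcases List.mem_cons.1 hd' with rfl | hd'
      · rw [h1 _ hn.1, Function.update_self]
        refine hf _ List.mem_cons_self _ _ fun i hi => ?_
        rw [h1 i, Function.update_of_ne]
        · rintro rfl; exact hl' _ List.mem_cons_self hi
        · intro h
          obtain ⟨d'', hd'', rfl⟩ := List.mem_map.1 h
          exact hl.1 d'' hd'' hi
      · exact h2 _ (by assumption)

/-- The functions given by the dependence atoms that hold in a team, made total. -/
theorem exists_dep_functions [Nonempty M] (l : List (List ℕ × ℕ)) {Y : Set (ℕ → M)}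
    (hY : ∀ d ∈ l, ∀ a ∈ Y, ∀ b ∈ Y, (∀ i ∈ d.1, a i = b i) → a d.2 = b d.2) :
    ∃ f : List ℕ × ℕ → (ℕ → M) → M,
      (∀ d ∈ l, ∀ a b : ℕ → M, (∀ i ∈ d.1, a i = b i) → f d a = f d b) ∧
      ∀ d ∈ l, ∀ a ∈ Y, a d.2 = f d a := by
  -- The epsilon term is taken of a predicate that sees `a` only through its values on `d.1`, hence
  -- it is a function of these; on `Y` the atom forces its value.
  refine ⟨fun d a => Classical.epsilon (fun c => c ∈ Y ∧ ∀ i ∈ d.1, a i = c i) d.2,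
    fun d hd a b hab => ?_, fun d hd a ha => ?_⟩
  · have : (fun c => c ∈ Y ∧ ∀ i ∈ d.1, a i = c i) = fun c => c ∈ Y ∧ ∀ i ∈ d.1, b i = c i := by
      funext c
      refine propext (and_congr_right fun _ => forall₂_congr fun i hi => ?_)
      rw [hab i hi]
    simp only [this]
  · have h : ∃ b, b ∈ Y ∧ ∀ i ∈ d.1, a i = b i := ⟨a, ha, fun _ _ => rfl⟩
    have h' := Classical.epsilon_spec h
    exact hY d hd a ha _ h'.1 h'.2

theorem pairwise_of_get {l : List (List ℕ × ℕ)}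
    (h : ∀ i j : Fin l.length, i ≤ j → (l.get j).2 ∉ (l.get i).1) :
    (l.Pairwise fun d d' => d'.2 ∉ d.1) ∧ ∀ d ∈ l, d.2 ∉ d.1 := by
  refine ⟨List.pairwise_iff_get.2 fun i j hij => h i j hij.le, fun d hd => ?_⟩
  obtain ⟨i, rfl⟩ := List.get_of_mem hd
  exact h i i le_rfl

/-- The two halves of the team obey total functions `f` and `g`. The new team consists of all
assignments that obey both systems and satisfy `C ∨ D`. A witness for one disjunct is extended by
solving the equations of the other block, which alters only variables that do not appear in the
first. -/
theorem depDistr_sound [Nonempty M] {l₁ l₂ : List (List ℕ × ℕ)} {C D : Fml L}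
    (hC : C.IsFO) (hD : D.IsFO)
    (hn₁ : (l₁.map Prod.snd).Nodup) (hn₂ : (l₂.map Prod.snd).Nodup)
    (ho₁ : ∀ i j : Fin l₁.length, i ≤ j → (l₁.get j).2 ∉ (l₁.get i).1)
    (ho₂ : ∀ i j : Fin l₂.length, i ≤ j → (l₂.get j).2 ∉ (l₂.get i).1)
    (hv₁ : ∀ d ∈ l₁, d.2 ∉ (depBlock l₂ D).vars) (hv₂ : ∀ d ∈ l₂, d.2 ∉ (depBlock l₁ C).vars)
    {X : Set (ℕ → M)} (h : TSat (.or (depBlock l₁ C) (depBlock l₂ D)) X) :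
    TSat (depBlock (l₁ ++ l₂) (.or C D)) X := by
  obtain ⟨Y, Z, hX, hY, hZ⟩ := h
  rw [TSat_depBlock hC] at hY
  rw [TSat_depBlock hD] at hZ
  rw [TSat_depBlock (show (Fml.or C D).IsFO from ⟨hC, hD⟩)]
  obtain ⟨Y, hYd, hYC, hY⟩ := hY
  obtain ⟨Z, hZd, hZD, hZ⟩ := hZ
  obtain ⟨f, hf, hfY⟩ := exists_dep_functions l₁ hYd
  obtain ⟨g, hg, hgZ⟩ := exists_dep_functions l₂ hZd
  have hp₁ := pairwise_of_get ho₁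
  have hp₂ := pairwise_of_get ho₂
  refine ⟨{e | (∀ d ∈ l₁, e d.2 = f d e) ∧ (∀ d ∈ l₂, e d.2 = g d e) ∧ (FOSat C e ∨ FOSat D e)},
    ?_, fun e he => he.2.2, ?_⟩
  · intro d hd a ha b hb hab
    rcases List.mem_append.1 hd with hd | hd
    · rw [ha.1 d hd, hb.1 d hd]; exact hf d hd a b hab
    · rw [ha.2.1 d hd, hb.2.1 d hd]; exact hg d hd a b hab
  · intro e he
    rcases hX he with he | he
    · obtain ⟨e₁, he₁, h₁⟩ := hY e he
      obtain ⟨e₂, h₂, h₂'⟩ := exists_solution l₂ hn₂ hp₂.1 hp₂.2 g hg e₁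
      have key : ∀ i ∈ (depBlock l₁ C).vars, e₂ i = e₁ i := fun i hi => h₂ i fun hi' => by
        obtain ⟨d, hd, rfl⟩ := List.mem_map.1 hi'
        exact hv₂ d hd hi
      refine ⟨e₂, ⟨fun d hd => ?_, h₂', Or.inl ?_⟩, fun i hi => ?_⟩
      · rw [key _ (mem_vars_depBlock hd (Or.inr rfl)), hfY d hd e₁ he₁]
        exact hf d hd _ _ fun i hi => (key i (mem_vars_depBlock hd (Or.inl hi))).symm
      · exact (FOSat_congr fun i hi =>
          key i (vars_subset_vars_depBlock (fv_subset_vars C hi))).2 (hYC e₁ he₁)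
      · simp only [List.map_append, List.mem_append, not_or] at hi
        rw [h₂ i hi.2, h₁ i hi.1]
    · obtain ⟨e₁, he₁, h₁⟩ := hZ e he
      obtain ⟨e₂, h₂, h₂'⟩ := exists_solution l₁ hn₁ hp₁.1 hp₁.2 f hf e₁
      have key : ∀ i ∈ (depBlock l₂ D).vars, e₂ i = e₁ i := fun i hi => h₂ i fun hi' => by
        obtain ⟨d, hd, rfl⟩ := List.mem_map.1 hi'
        exact hv₁ d hd hi
      refine ⟨e₂, ⟨h₂', fun d hd => ?_, Or.inr ?_⟩, fun i hi => ?_⟩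
      · rw [key _ (mem_vars_depBlock hd (Or.inr rfl)), hgZ d hd e₁ he₁]
        exact hg d hd _ _ fun i hi => (key i (mem_vars_depBlock hd (Or.inl hi))).symm
      · exact (FOSat_congr fun i hi =>
          key i (vars_subset_vars_depBlock (fv_subset_vars D hi))).2 (hZD e₁ he₁)
      · simp only [List.map_append, List.mem_append, not_or] at hi
        rw [h₂ i hi.1, h₁ i hi.2]

/-- The witness `F` for `x` may vary along the team, but the truth of `A` is sensitive only to `z⃗,
x, y`. Evaluating `F` at a representative chosen from the values on `z⃗` turns it into a function of
`z⃗`. -/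
theorem depI_sound [Nonempty M] {x y : ℕ} {A : Fml L} (z : List ℕ)
    (hz : ∀ i, i ∈ z ↔ i ∈ A.fv ∧ i ≠ x ∧ i ≠ y) {X : Set (ℕ → M)}
    (h : TSat (.ex x (.all y A)) X) : TSat (.all y (.ex x (.and (depVar (z, x)) A))) X := by
  obtain ⟨Y, ⟨W, hW, hY⟩, hX⟩ := h
  classical
  choose! F hF using hX
  let Q : (ℕ → M) → (ℕ → M) → Prop := fun e s => s ∈ X ∧ ∀ i ∈ z, s i = e i
  have hQ : ∀ e : ℕ → M, (∃ s, Q e s) → Q e (Classical.epsilon (h := ⟨e⟩) (Q e)) :=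
    fun e he => @Classical.epsilon_spec_aux _ ⟨e⟩ (Q e) he
  have hQcongr : ∀ a b : ℕ → M, (∀ i ∈ z, a i = b i) → Q a = Q b := by
    intro a b hab
    funext s
    exact propext (and_congr_right fun _ => forall₂_congr fun i hi => by rw [hab i hi])
  let r : (ℕ → M) → (ℕ → M) := fun e => Classical.epsilon (h := ⟨e⟩) (Q e)
  have hr : ∀ a b : ℕ → M, (∀ i ∈ z, a i = b i) → r a = r b := by
    intro a b hab
    simp only [r, hQcongr a b hab]
  have hxz : x ∉ z := fun h => ((hz x).1 h).2.1 rfl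
  have hyz : y ∉ z := fun h => ((hz y).1 h).2.2 rfl
  refine ⟨{e | ∃ s ∈ X, ∃ a, e = Function.update s y a},
    ⟨{e | (∃ s, Q e s) ∧ e x = F (r e) ∧ ∃ w ∈ W, ∀ i ∈ A.fv, w i = e i}, ⟨?_, ?_⟩, ?_⟩,
    fun e he a => ⟨e, he, a, rfl⟩⟩
  · rw [TSat_depVar]
    intro a ha b hb hab
    change a x = b x
    rw [ha.2.1, hb.2.1, hr a b hab]
  · exact hW.local fun e he => he.2.2
  · rintro _ ⟨s, hs, a, rfl⟩
    have hsz : ∀ c, ∀ i ∈ z, Function.update (Function.update s y a) x c i = s i := by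
      intro c i hi
      rw [Function.update_of_ne (by rintro rfl; exact hxz hi),
        Function.update_of_ne (by rintro rfl; exact hyz hi)]
    have hQs : Q s (r s) := hQ s ⟨s, hs, fun _ _ => rfl⟩
    refine ⟨F (r s), ⟨s, hs, fun i hi => (hsz _ i hi).symm⟩, ?_, ?_⟩
    · rw [hr _ s (hsz _), Function.update_self]
    -- If the variables coincide, the inner quantifier overwrites the outer one, so `F (r s)` is
    -- also taken as the value for `∀`.
    · by_cases hxy : x = y
      · subst hxy
        refine ⟨_, hY _ (hF (r s) hQs.1) (F (r s)), fun i hi => ?_⟩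
        by_cases hix : i = x
        · subst hix; simp
        · simp only [Function.update_of_ne hix]
          exact hQs.2 i ((hz i).2 ⟨hi, hix, hix⟩)
      · refine ⟨_, hY _ (hF (r s) hQs.1) a, fun i hi => ?_⟩
        by_cases hix : i = x
        · subst hix; simp [hxy]
        · by_cases hiy : i = y
          · subst hiy; simp [hix]
          · simp only [Function.update_of_ne hix, Function.update_of_ne hiy]
            exact hQs.2 i ((hz i).2 ⟨hi, hix, hiy⟩)

end

end DepLogic

/-! ### Soundness of dependence elimination and of the whole system. -/

namespace DepLogic

open FirstOrder.Language (Term)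
open FirstOrder.Language.Structure (RelMap)
open Fml

section

variable {L : FirstOrder.Language.{u, v}} {M : Type w} [L.Structure M]

theorem substOK_rename {A : Fml L} {ρ : ℕ → ℕ} (h : ∀ i ∈ A.fv, ρ i = i ∨ ρ i ∉ A.vars) :
    A.SubstOK fun x => Term.var (ρ x) :=
  substOK_of_forall fun i hi j hj => by
    simp only [Term.varFinset, Finset.mem_singleton] at hj
    subst hj
    exact h i hi

/-- A single Skolem map `g` answers both rounds of quantifiers. The two tuples then lie in the same
team `Y`, so they agree on the value of an atom whenever they agree on its arguments. A `y` without
an atom is still determined by all of `x⃗`, the parameters outside `x⃗` being the same in both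
rounds. -/
theorem depE_sound [Nonempty M] {xs ys : List ℕ} {D : List (List ℕ × ℕ)} {B : Fml L} {ρ : ℕ → ℕ}
    (hn : (xs ++ ys ++ xs.map ρ ++ ys.map ρ).Nodup) (hρ : ∀ x, x ∉ xs ++ ys → ρ x = x)
    (hB : ∀ x ∈ xs ++ ys, ρ x ∉ B.vars)
    (hD : ∀ d ∈ D, ∃ (p : ℕ) (hp : p < ys.length), d.2 = ys[p] ∧ ∀ x ∈ d.1, x ∈ xs ++ ys.take p)
    {X : Set (ℕ → M)} (h : TSat (depElimPrem xs ys D B) X) :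
    TSat (depElimConcl xs ys D ρ B) X := by
  classical
  simp only [depElimPrem, TSat_alls, TSat_exs, TSat, TSat_bigAnd, List.forall_mem_map,
    TSat_depVar] at h
  obtain ⟨Y₀, ⟨Y, ⟨hYD, hYB⟩, hY⟩, hX⟩ := h
  choose! g hgY hg using hY
  have hn' : (xs ++ ys).Nodup ∧ ((xs ++ ys).map ρ).Nodup ∧
      ∀ a ∈ xs ++ ys, ∀ b ∈ xs ++ ys, a ≠ ρ b := by
    rw [List.append_assoc, ← List.map_append, List.nodup_append] at hn
    exact ⟨hn.1, hn.2.1, fun a ha b hb => hn.2.2 a ha _ (List.mem_map_of_mem hb)⟩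
  obtain ⟨hn₁, hn₂, hdisj⟩ := hn'
  have hinj : ∀ a ∈ xs ++ ys, ∀ b ∈ xs ++ ys, ρ a = ρ b → a = b :=
    List.inj_on_of_nodup_map hn₂
  have hxy : ∀ x ∈ xs, x ∉ ys := fun x hx hy =>
    List.disjoint_of_nodup_append hn₁ hx hy
  have hwD : ∀ d ∈ D, d.2 ∈ xs ++ ys ∧ ∀ i ∈ d.1, i ∈ xs ++ ys := by
    intro d hd
    obtain ⟨p, hp, h2, h1⟩ := hD d hd
    refine ⟨List.mem_append_right _ (h2 ▸ List.getElem_mem hp), fun i hi => ?_⟩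
    rcases List.mem_append.1 (h1 i hi) with h | h
    · exact List.mem_append_left _ h
    · exact List.mem_append_right _ (List.mem_of_mem_take h)
  let N : Set (ℕ → M) := {s' | ∃ s ∈ X, ∀ i ∉ xs, s' i = s i}
  have hN : ∀ s' ∈ N, s' ∈ Y₀ := fun s' ⟨s, hs, h⟩ => hX s hs s' h
  simp only [depElimConcl, TSat_alls, TSat_exs, TSat]
  refine ⟨N, ⟨g '' N, ⟨hYB.mono ?_, {u' | ∃ u ∈ g '' N, ∀ i ∉ xs.map ρ, u' i = u i},
      ⟨{w | (∃ v ∈ Y, ∀ i ∈ B.fv, v i = w (ρ i)) ∧ ∀ d ∈ depElimS xs ys D,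
        (∀ i ∈ d.1, w i = w (ρ i)) → w d.2 = w (ρ d.2)}, ⟨?_, ?_⟩, ?_⟩,
      fun u hu u' h => ⟨u, hu, h⟩⟩, fun s hs => ⟨g s, ⟨s, hs, rfl⟩, hg s (hN s hs)⟩⟩,
    fun s hs s' h => ⟨s, hs, h⟩⟩
  · rintro _ ⟨s, hs, rfl⟩; exact hgY s (hN s hs)
  · refine (TSat_subst (substOK_rename fun i hi => ?_)).2 (hYB.local ?_)
    · by_cases h : i ∈ xs ++ ys
      · exact Or.inr (hB i h)
      · exact Or.inl (hρ i h)
    · rintro _ ⟨w, hw, rfl⟩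
      exact hw.1
  · rw [TSat_iff_of_isFO]
    · intro w hw
      rw [FOSat_bigAnd]
      simp only [List.forall_mem_map, imp, FOSat, FOSat_bigAnd, varEq, Term.realize_var]
      intro d hd
      exact (em _).symm.imp id fun h => hw.2 d hd h
    · simp only [isFO_bigAnd, List.forall_mem_map, imp, IsFO, varEq, and_true]
      exact fun _ _ _ _ => trivial
  · rintro u' ⟨_, ⟨s', ⟨s, hs, hss'⟩, rfl⟩, hu'⟩
    -- The new universal values are read back into the original variables, where `g` can be applied;
    -- below, `w` stores the answer in the renamed existential variables and keeps `u'` elsewhere.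
    let s₁ : ℕ → M := fun i => if i ∈ xs then u' (ρ i) else s i
    have hs₁N : s₁ ∈ N := ⟨s, hs, fun i hi => by simp [s₁, hi]⟩
    let v := g s₁
    have hvY : v ∈ Y := hgY s₁ (hN _ hs₁N)
    have hv : ∀ i ∉ ys, v i = s₁ i := hg s₁ (hN _ hs₁N)
    have huY : g s' ∈ Y := hgY s' (hN s' ⟨s, hs, hss'⟩)
    have hu : ∀ i ∉ ys, g s' i = s' i := hg s' (hN s' ⟨s, hs, hss'⟩)
    let w : ℕ → M := fun i => if h : ∃ y ∈ ys, i = ρ y then v h.choose else u' i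
    have hwρ : ∀ i ∈ xs ++ ys, w (ρ i) = v i := by
      intro i hi
      rcases List.mem_append.1 hi with hix | hiy
      · have h : ¬ ∃ y ∈ ys, ρ i = ρ y := by
          rintro ⟨y, hy, h⟩
          exact hxy i hix (hinj i hi y (List.mem_append_right _ hy) h ▸ hy)
        simp only [w, dif_neg h]
        rw [hv i (hxy i hix)]
        simp [s₁, hix]
      · have h : ∃ y ∈ ys, ρ i = ρ y := ⟨i, hiy, rfl⟩
        simp only [w, dif_pos h]
        congr 1
        exact (hinj i hi _ (List.mem_append_right _ h.choose_spec.1) h.choose_spec.2).symm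
    have hwu : ∀ i, (∀ j ∈ xs ++ ys, i ≠ ρ j) → w i = g s' i := by
      intro i hi
      have h : ¬ ∃ y ∈ ys, i = ρ y := fun ⟨y, hy, h⟩ => hi y (List.mem_append_right _ hy) h
      simp only [w, dif_neg h]
      refine hu' i fun h => ?_
      obtain ⟨x, hx, rfl⟩ := List.mem_map.1 h
      exact hi x (List.mem_append_left _ hx) rfl
    refine ⟨w, ⟨⟨v, hvY, fun i hi => ?_⟩, fun d hd h => ?_⟩, fun i hi => ?_⟩
    · by_cases h : i ∈ xs ++ ys
      · exact (hwρ i h).symm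
      · rw [hρ i h, hwu i]
        · simp only [List.mem_append, not_or] at h
          rw [hv i h.2, hu i h.2, hss' i h.1]
          simp [s₁, h.1]
        · rintro j hj rfl
          exact hB j hj (fv_subset_vars B hi)
    · rcases List.mem_append.1 hd with hd | hd
      · have hd' := hwD d hd
        rw [hwρ _ hd'.1, hwu _ fun j hj => hdisj _ hd'.1 j hj]
        refine hYD d hd _ huY _ hvY fun i hi => ?_
        have := h i hi
        rwa [hwρ _ (hd'.2 i hi), hwu _ fun j hj => hdisj _ (hd'.2 i hi) j hj] at this
      · obtain ⟨y, hy, rfl⟩ := List.mem_map.1 hd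
        have hy : y ∈ xs ++ ys := List.mem_append_right _ (List.mem_filter.1 hy).1
        simp only at h ⊢
        have hs : s' = s₁ := by
          funext i
          by_cases hi : i ∈ xs
          · have := h i hi
            have hi' := List.mem_append_left ys hi
            rwa [hwρ _ hi', hwu _ fun j hj => hdisj _ hi' j hj, hv i (hxy i hi),
              hu i (hxy i hi)] at this
          · rw [hss' i hi]; simp [s₁, hi]
        rw [hwρ _ hy, hwu _ fun j hj => hdisj _ hy j hj]
        simp only [v, hs]
    · have h : ¬ ∃ y ∈ ys, i = ρ y := fun ⟨y, hy, h⟩ => hi (h ▸ List.mem_map_of_mem hy)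
      simp only [w, dif_neg h]

theorem realize_single (x : ℕ) (t : L.Term ℕ) (e : ℕ → M) :
    (fun i => (single x t i).realize e) = Function.update e x (t.realize e) := by
  funext i
  by_cases hx : i = x
  · subst hx; simp [single]
  · simp [single, hx]

theorem TSat.update {A : Fml L} {X : Set (ℕ → M)} (hA : TSat A X) {x : ℕ} (hx : x ∉ A.fv)
    {Y : Set (ℕ → M)} (hY : ∀ e' ∈ Y, ∃ e ∈ X, ∃ a, e' = Function.update e x a) : TSat A Y :=
  hA.local fun e' he' => by
    obtain ⟨e, he, a, rfl⟩ := hY e' he'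
    refine ⟨e, he, fun i hi => ?_⟩
    rw [Function.update_of_ne]
    rintro rfl
    exact hx hi

/-- Soundness. -/
theorem Derives.sound [Nonempty M] {Γ : Set (Fml L)} {A : Fml L} (h : Derives Γ A)
    {X : Set (ℕ → M)} (hX : ∀ B ∈ Γ, TSat B X) : TSat A X := by
  induction h generalizing X with
  | assumption h => exact hX _ h
  | andI _ _ ih₁ ih₂ => exact ⟨ih₁ hX, ih₂ hX⟩
  | andE₁ _ ih => exact (ih hX).1
  | andE₂ _ ih => exact (ih hX).2
  | orI₁ _ _ ih =>
    refine ⟨X, ∅, by simp, ih hX, ?_⟩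
    exact TSat_empty _
  | orI₂ _ _ ih =>
    refine ⟨∅, X, by simp, ?_, ih hX⟩
    exact TSat_empty _
  | orE hC _ _ _ ih ih₁ ih₂ =>
    obtain ⟨Y, Z, hYZ, hY, hZ⟩ := ih hX
    -- By flatness `C` may be tested on singletons, each of which lies within one of the two halves.
    rw [TSat_iff_of_isFO hC]
    intro e he
    rcases hYZ he with h | h
    · refine (TSat_iff_of_isFO hC).1 (ih₁ (X := {e}) fun B hB => ?_) e rfl
      rcases hB with rfl | hB
      · exact hY.mono (by simpa using h)
      · exact (hX B hB).mono (by simpa using he)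
    · refine (TSat_iff_of_isFO hC).1 (ih₂ (X := {e}) fun B hB => ?_) e rfl
      rcases hB with rfl | hB
      · exact hZ.mono (by simpa using h)
      · exact (hX B hB).mono (by simpa using he)
  | negI hA hB _ ih =>
    intro e he heA
    have := ih (X := {e}) fun C hC => by
      rcases hC with rfl | hC
      · exact (TSat_iff_of_isFO hA).2 (by simpa using heA)
      · exact (hX C hC).mono (by simpa using he)
    exact this.2 e rfl ((TSat_iff_of_isFO hB).1 this.1 e rfl)
  | negE hA _ ih =>
    rw [TSat_iff_of_isFO hA]
    exact fun e he => not_not.1 (ih hX e he)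
  | @allI Γ Δ x A hΔ hx _ ih =>
    refine ⟨{e' | ∃ e ∈ X, ∃ a, e' = Function.update e x a}, ih fun B hB => ?_,
      fun e he a => ⟨e, he, a, rfl⟩⟩
    exact (hX B (hΔ hB)).update (hx B hB) fun e he => he
  | allE t ht _ ih =>
    obtain ⟨Y, hY, h⟩ := ih hX
    rw [TSat_subst ht]
    refine hY.mono ?_
    rintro _ ⟨e, he, rfl⟩
    simp only [realize_single]
    exact h e he _
  | exI t ht _ ih =>
    refine ⟨_, (TSat_subst ht).1 (ih hX), fun e he => ⟨t.realize e, e, he, ?_⟩⟩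
    exact realize_single _ t e
  | @exE Γ Δ x A B hΔ hx hB _ _ ih₁ ih₂ =>
    obtain ⟨Y, hY, h⟩ := ih₁ hX
    -- Restricting `Y` to `x`-variants of members of `X` keeps the side assumptions in `Δ` true.
    have hBY := ih₂ (X := {e' | e' ∈ Y ∧ ∃ e ∈ X, ∃ a, e' = Function.update e x a}) fun C hC => by
      rcases hC with rfl | hC
      · exact hY.mono fun e he => he.1
      · exact (hX C (hΔ hC)).update (hx C hC) fun e he => he.2
    refine hBY.local fun e he => ?_
    obtain ⟨a, ha⟩ := h e he
    refine ⟨_, ⟨ha, e, he, a, rfl⟩, fun i hi => ?_⟩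
    rw [Function.update_of_ne]
    rintro rfl
    exact hB hi
  | @orSubst Γ A B C _ _ ih₁ ih₂ =>
    obtain ⟨Y, Z, hYZ, hY, hZ⟩ := ih₁ hX
    -- The half `Z` may stick out of `X`; within `X` the assumptions `Γ` hold.
    refine ⟨Y, Z ∩ X, fun e he => (hYZ he).imp id fun h => ⟨h, he⟩, hY, ih₂ fun C hC => ?_⟩
    rcases hC with rfl | hC
    · exact hZ.mono Set.inter_subset_left
    · exact (hX C hC).mono Set.inter_subset_right
  | orComm _ ih =>
    obtain ⟨Y, Z, hYZ, hY, hZ⟩ := ih hX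
    exact ⟨Z, Y, fun e he => (hYZ he).symm, hZ, hY⟩
  | orAssoc _ ih =>
    obtain ⟨Y, Z, hYZ, ⟨U, V, hUV, hU, hV⟩, hZ⟩ := ih hX
    refine ⟨U, V ∪ Z, fun e he => ?_, hU, V, Z, subset_rfl, hV, hZ⟩
    rcases hYZ he with h | h
    · exact (hUV h).imp id Or.inl
    · exact Or.inr (Or.inr h)
  | @allScope Γ x A B hx _ ih =>
    obtain ⟨Y, Z, hYZ, ⟨U, hU, hY⟩, hZ⟩ := ih hX
    refine ⟨_, ⟨U, {e' | ∃ e ∈ Z, ∃ a, e' = Function.update e x a}, subset_rfl, hU,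
      hZ.update hx fun e he => he⟩, fun e he a => ?_⟩
    exact (hYZ he).imp (fun h => hY e h a) fun h => ⟨e, h, a, rfl⟩
  | @exScope Γ x A B hx _ ih =>
    obtain ⟨Y, Z, hYZ, ⟨U, hU, hY⟩, hZ⟩ := ih hX
    refine ⟨_, ⟨U, {e' | ∃ e ∈ Z, ∃ a, e' = Function.update e x a}, subset_rfl, hU,
      hZ.update hx fun e he => he⟩, fun e he => ?_⟩
    rcases hYZ he with h | h
    · obtain ⟨a, ha⟩ := hY e h
      exact ⟨a, Or.inl ha⟩
    · exact ⟨e x, Or.inr ⟨e, h, e x, rfl⟩⟩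
  | @unnest Γ ts z i hi hz _ ih =>
    have hts : ∀ t ∈ ts, ∀ (e : ℕ → M) a, t.realize (Function.update e z a) = t.realize e := by
      intro t ht e a
      refine realize_congr fun j hj => ?_
      rw [Function.update_of_ne]
      rintro rfl
      exact hz (mem_listVars.2 ⟨t, ht, hj⟩)
    have hval : ∀ e : ℕ → M, (ts.set i (Term.var z)).map
        (fun t => t.realize (Function.update e z (ts[i].realize e))) =
        ts.map fun t => t.realize e := by
      intro e
      apply List.ext_getElem (by simp)
      intro j hj hj'
      simp only [List.getElem_map, List.getElem_set]
      split_ifs with hij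
      · subst hij; simp
      · exact hts _ (List.getElem_mem _) _ _
    -- A dependence atom sees only the lists of values of its terms, and by `hval` these lists are
    -- unchanged by the replacement.
    have key : ∀ (us : List (L.Term ℕ)) (X : Set (ℕ → M)), TSat (.dep us) X ↔
        ∀ a ∈ X, ∀ b ∈ X, (us.map fun t => t.realize a).dropLast =
          (us.map fun t => t.realize b).dropLast →
          (us.map fun t => t.realize a).getLast? = (us.map fun t => t.realize b).getLast? := by
      intro us X
      rcases us.eq_nil_or_concat with rfl | ⟨us, u, rfl⟩
      · simp [TSat]
      · simp [TSat, List.map_inj_left]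
    refine ⟨{e' | ∃ e ∈ X, e' = Function.update e z (ts[i].realize e)}, ⟨?_, ?_⟩,
      fun e he => ⟨_, e, he, rfl⟩⟩
    · rw [key]
      rintro _ ⟨a, ha, rfl⟩ _ ⟨b, hb, rfl⟩ hab
      rw [hval, hval] at hab ⊢
      exact (key ts X).1 (ih hX) a ha b hb hab
    · rintro _ ⟨a, ha, rfl⟩
      rw [hts _ (List.getElem_mem hi)]
      simp
  | depDistr hC _ hD _ hn₁ hn₂ ho₁ ho₂ hv₁ hv₂ _ ih =>
    exact depDistr_sound hC hD hn₁ hn₂ ho₁ ho₂ hv₁ hv₂ (ih hX)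
  | depI z hz _ ih => exact depI_sound z hz (ih hX)
  | depE ρ hn hρ hB hD _ ih => exact depE_sound hn hρ hB hD (ih hX)
  | eqRefl t => exact fun _ _ => rfl
  | eqSubst t s hA ht hs _ _ ih₁ ih₂ =>
    rw [TSat_subst hs]
    refine ((TSat_subst ht).1 (ih₂ hX)).mono ?_
    rintro _ ⟨e, he, rfl⟩
    refine ⟨e, he, ?_⟩
    simp only
    rw [realize_single, realize_single, ih₁ hX e he]

end

end DepLogic

/-! ### Ultraproducts and compactness. -/

namespace DepLogic

open FirstOrder.Language (Term)
open FirstOrder.Language.Structure (RelMap)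
open Fml

section Ultraproduct

open Filter

variable {L : FirstOrder.Language.{u, v}} {ι : Type*} {M : ι → Type*} [∀ a, L.Structure (M a)]
  {U : Ultrafilter ι}

/-- The element of the ultraproduct represented by a family of elements. -/
def ultraMk (U : Ultrafilter ι) (m : ∀ a, M a) : (U : Filter ι).Product M := Quotient.mk _ m

/-- The assignment into the ultraproduct represented by a family of assignments. -/
def ultraAssign (U : Ultrafilter ι) (x : ℕ → ∀ a, M a) : ℕ → (U : Filter ι).Product M :=
  fun i => ultraMk U (x i)

theorem ultraMk_surjective : Function.Surjective (ultraMk (M := M) U) := Quotient.mk_surjective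

theorem update_ultraAssign (x : ℕ → ∀ a, M a) (i : ℕ) (m : ∀ a, M a) :
    Function.update (ultraAssign U x) i (ultraMk U m) =
      ultraAssign U (Function.update x i m) := by
  funext j
  by_cases h : j = i
  · subst h; simp [ultraAssign]
  · simp [ultraAssign, h]

theorem update_apply_family (x : ℕ → ∀ a, M a) (i : ℕ) (m : ∀ a, M a) (a : ι) :
    (fun j => Function.update x i m j a) = Function.update (fun j => x j a) i (m a) := by
  funext j
  by_cases h : j = i
  · subst h; simp
  · simp [h]

theorem realize_ultraAssign (t : L.Term ℕ) (x : ℕ → ∀ a, M a) :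
    t.realize (ultraAssign U x) =
      ultraMk U fun a => t.realize fun i => x i a :=
  FirstOrder.Language.Ultraproduct.term_realize_cast x t

theorem mk_eq_mk_iff {m m' : ∀ a, M a} :
    ultraMk U m = ultraMk U m' ↔ ∀ᶠ a in U, m a = m' a :=
  Quotient.eq''

theorem relMap_ultraproduct {n : ℕ} (R : L.Relations n) (x : Fin n → ∀ a, M a) :
    (RelMap R fun i => ultraMk U (x i)) ↔
      ∀ᶠ a in U, RelMap R fun i => x i a :=
  FirstOrder.Language.relMap_quotient_mk' _ _ _

variable [∀ a, Nonempty (M a)]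

/-- Łoś's theorem. -/
theorem FOSat_ultraAssign (A : Fml L) (x : ℕ → ∀ a, M a) :
    FOSat A (ultraAssign U x) ↔ ∀ᶠ a in U, FOSat A fun i => x i a := by
  induction A generalizing x with
  | eq t s => simp only [FOSat, realize_ultraAssign, mk_eq_mk_iff]
  | rel R ts => simp only [FOSat, realize_ultraAssign]; exact relMap_ultraproduct R _
  | dep ts => simp [FOSat]
  | neg A ih => simp only [FOSat, ih]; exact Ultrafilter.eventually_not.symm
  | and A B ihA ihB => simp only [FOSat, ihA, ihB]; exact eventually_and.symm
  | or A B ihA ihB => simp only [FOSat, ihA, ihB]; exact Ultrafilter.eventually_or.symm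
  | ex y A ih =>
    simp only [FOSat]
    constructor
    · rintro ⟨m, hm⟩
      obtain ⟨m, rfl⟩ := ultraMk_surjective m
      rw [update_ultraAssign, ih] at hm
      exact hm.mono fun a ha => ⟨m a, by rwa [update_apply_family] at ha⟩
    · intro h
      -- Witnesses are picked coordinatewise; the arbitrary values at indices without a witness do
      -- not matter, because these indices form a set outside the ultrafilter.
      refine ⟨ultraMk U fun a => Classical.epsilon fun b =>
        FOSat A (Function.update (fun j => x j a) y b), ?_⟩
      rw [update_ultraAssign, ih]
      refine h.mono fun a ha => ?_
      rw [update_apply_family]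
      exact Classical.epsilon_spec ha
  | all y A ih =>
    simp only [FOSat]
    constructor
    · intro h
      have := h (ultraMk U fun a => Classical.epsilon fun b =>
        ¬ FOSat A (Function.update (fun j => x j a) y b))
      rw [update_ultraAssign, ih] at this
      refine this.mono fun a ha => ?_
      rw [update_apply_family] at ha
      by_contra hcon
      exact Classical.epsilon_spec (not_forall.1 hcon) ha
    · intro h m
      obtain ⟨m, rfl⟩ := ultraMk_surjective m
      rw [update_ultraAssign, ih]
      refine h.mono fun a ha => ?_
      rw [update_apply_family]
      exact ha _

/-- The ultraproduct of a family of teams. -/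
def ultraTeam {ι : Type*} {M : ι → Type*} (U : Ultrafilter ι) (X : ∀ a, Set (ℕ → M a)) :
    Set (ℕ → (U : Filter ι).Product M) :=
  {e | ∃ x : ℕ → ∀ a, M a, e = ultraAssign U x ∧ ∀ᶠ a in U, (fun i => x i a) ∈ X a}

/-- Dependence logic is preserved by ultraproducts. -/
theorem TSat_ultraTeam (A : Fml L) {X : ∀ a, Set (ℕ → M a)} (h : ∀ᶠ a in U, TSat A (X a)) :
    TSat A (ultraTeam U X) := by
  induction A generalizing X with
  | eq t s =>
    rintro _ ⟨x, rfl, hx⟩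
    exact (FOSat_ultraAssign (.eq t s) x).2 (h.mp (hx.mono fun a ha h => h _ ha))
  | rel R ts =>
    rintro _ ⟨x, rfl, hx⟩
    exact (FOSat_ultraAssign (.rel R ts) x).2 (h.mp (hx.mono fun a ha h => h _ ha))
  | dep ts =>
    rintro t ht _ ⟨x, rfl, hx⟩ _ ⟨y, rfl, hy⟩ hxy
    simp only [realize_ultraAssign, mk_eq_mk_iff] at hxy ⊢
    have hxy' : ∀ᶠ a in U, ∀ s ∈ ts.dropLast,
        (s.realize fun i => x i a) = s.realize fun i => y i a := by
      -- An atom has finitely many terms, so the equalities hold simultaneously on a set of the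
      -- ultrafilter.
      have : {s | s ∈ ts.dropLast}.Finite := List.finite_toSet _
      exact (eventually_all_finite this).2 hxy
    filter_upwards [h, hx, hy, hxy'] with a h hx hy hxy
    exact h t ht _ hx _ hy hxy
  | neg A ih =>
    rintro _ ⟨x, rfl, hx⟩
    exact (FOSat_ultraAssign (.neg A) x).2 (h.mp (hx.mono fun a ha h => h _ ha))
  | and A B ihA ihB => exact ⟨ihA (h.mono fun _ h => h.1), ihB (h.mono fun _ h => h.2)⟩
  | or A B ihA ihB =>
    -- A splitting is chosen at every index, with empty parts where the disjunction fails, so that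
    -- the ultraproduct of the parts makes sense.
    have : ∀ a, ∃ Y Z, TSat (.or A B) (X a) → X a ⊆ Y ∪ Z ∧ TSat A Y ∧ TSat B Z := by
      intro a
      by_cases h : TSat (.or A B) (X a)
      · obtain ⟨Y, Z, h⟩ := h
        exact ⟨Y, Z, fun _ => h⟩
      · exact ⟨∅, ∅, fun h' => absurd h' h⟩
    choose Y Z hYZ using this
    refine ⟨ultraTeam U Y, ultraTeam U Z, ?_, ihA (h.mono fun a ha => (hYZ a ha).2.1),
      ihB (h.mono fun a ha => (hYZ a ha).2.2)⟩
    rintro _ ⟨x, rfl, hx⟩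
    have : ∀ᶠ a in U, (fun i => x i a) ∈ Y a ∨ (fun i => x i a) ∈ Z a :=
      h.mp (hx.mono fun a hx h => (hYZ a h).1 hx)
    exact (Ultrafilter.eventually_or.1 this).imp (fun h => ⟨x, rfl, h⟩) fun h => ⟨x, rfl, h⟩
  | ex y A ih =>
    have : ∀ a, ∃ Y, TSat (.ex y A) (X a) →
        TSat A Y ∧ ∀ e ∈ X a, ∃ b, Function.update e y b ∈ Y := by
      intro a
      by_cases h : TSat (.ex y A) (X a)
      · obtain ⟨Y, h⟩ := h
        exact ⟨Y, fun _ => h⟩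
      · exact ⟨∅, fun h' => absurd h' h⟩
    choose Y hY using this
    refine ⟨ultraTeam U Y, ih (h.mono fun a ha => (hY a ha).1), ?_⟩
    rintro _ ⟨x, rfl, hx⟩
    refine ⟨ultraMk U fun a => Classical.epsilon fun b =>
      Function.update (fun j => x j a) y b ∈ Y a, _, update_ultraAssign _ _ _, ?_⟩
    filter_upwards [h, hx] with a h hx
    rw [update_apply_family]
    exact Classical.epsilon_spec ((hY a h).2 _ hx)
  | all y A ih =>
    have : ∀ a, ∃ Y, TSat (.all y A) (X a) →
        TSat A Y ∧ ∀ e ∈ X a, ∀ b, Function.update e y b ∈ Y := by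
      intro a
      by_cases h : TSat (.all y A) (X a)
      · obtain ⟨Y, h⟩ := h
        exact ⟨Y, fun _ => h⟩
      · exact ⟨∅, fun h' => absurd h' h⟩
    choose Y hY using this
    refine ⟨ultraTeam U Y, ih (h.mono fun a ha => (hY a ha).1), ?_⟩
    rintro _ ⟨x, rfl, hx⟩ m
    obtain ⟨m, rfl⟩ := ultraMk_surjective m
    refine ⟨_, update_ultraAssign _ _ _, ?_⟩
    filter_upwards [h, hx] with a h hx
    rw [update_apply_family]
    exact (hY a h).2 _ hx _

end Ultraproduct

/-- Compactness of dependence logic, relative to a first-order formula that is to be falsified. -/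
theorem exists_model_of_finite {L : FirstOrder.Language.{u, v}} {T : Set (Fml L)} {φ : Fml L}
    (h : ∀ T₀ : Set (Fml L), T₀ ⊆ T → T₀.Finite → ∃ (M : Type (max u v)) (_ : L.Structure M)
      (e : ℕ → M), (∀ B ∈ T₀, TSat B {e}) ∧ ¬ FOSat φ e) :
    ∃ (M : Type (max u v)) (_ : L.Structure M) (e : ℕ → M),
      (∀ B ∈ T, TSat B {e}) ∧ ¬ FOSat φ e := by
  classical
  have h' : ∀ s : Finset T, ∃ (M : Type (max u v)) (_ : L.Structure M)
      (e : ℕ → M), (∀ B ∈ s, TSat B.1 {e}) ∧ ¬ FOSat φ e := by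
    intro s
    obtain ⟨M, hM, e, h1, h2⟩ := h (Subtype.val '' (s : Set T)) (by rintro _ ⟨B, _, rfl⟩; exact B.2)
      (s.finite_toSet.image _)
    exact ⟨M, hM, e, fun B hB => h1 _ ⟨B, hB, rfl⟩, h2⟩
  choose M hM e hT hφ using h'
  have hne : ∀ s, Nonempty (M s) := fun s => ⟨e s 0⟩
  -- An ultrafilter finer than `atTop` contains, for each `B` in `T`, the set of finite subsets that
  -- contain `B`.
  let U : Ultrafilter (Finset T) := Ultrafilter.of Filter.atTop
  let x : ℕ → ∀ s, M s := fun i s => e s i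
  refine ⟨(U : Filter (Finset T)).Product M, inferInstance, ultraAssign U x, fun B hB => ?_, ?_⟩
  · have := TSat_ultraTeam (U := U) B (X := fun s => {e s}) ?_
    · refine this.mono ?_
      rintro _ rfl
      exact ⟨x, rfl, Filter.Eventually.of_forall fun s => rfl⟩
    · have : ∀ᶠ s in Filter.atTop, TSat B {e s} := by
        filter_upwards [Filter.eventually_ge_atTop ({⟨B, hB⟩} : Finset T)] with s hs
        exact hT s ⟨B, hB⟩ (hs (Finset.mem_singleton_self _))
      exact Ultrafilter.of_le _ this
  · rw [FOSat_ultraAssign]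
    intro h
    obtain ⟨s, hs⟩ := h.exists
    exact hφ s hs

end DepLogic

/-! ### Derived rules. -/

namespace DepLogic

open FirstOrder.Language (Term)
open FirstOrder.Language.Structure (RelMap)
open Fml

variable {L : FirstOrder.Language.{u, v}}

theorem single_self (x : ℕ) : single x (Term.var x : L.Term ℕ) = Term.var := by
  simp [single]

theorem substOK_var (A : Fml L) : A.SubstOK Term.var :=
  substOK_of_forall fun i _ j hj => Or.inl (by simpa [Term.varFinset] using hj)

theorem subst_single_of_notMem {A : Fml L} {x : ℕ} (h : x ∉ A.fv) (t : L.Term ℕ) :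
    A.subst (single x t) = A := by
  rw [subst_congr (τ := Term.var), subst_var]
  intro i hi
  rw [single, Function.update_of_ne]
  rintro rfl
  exact h hi

theorem substOK_congr {A : Fml L} {σ τ : ℕ → L.Term ℕ} (h : ∀ i ∈ A.fv, σ i = τ i)
    (hσ : A.SubstOK σ) : A.SubstOK τ := by
  induction A generalizing σ τ with
  | eq | rel | dep => trivial
  | neg A ih => exact ih h hσ
  | and A B ihA ihB | or A B ihA ihB =>
    exact ⟨ihA (fun i hi => h i (Finset.mem_union_left _ hi)) hσ.1,
      ihB (fun i hi => h i (Finset.mem_union_right _ hi)) hσ.2⟩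
  | ex x A ih | all x A ih =>
    refine ⟨fun y hy => h y hy ▸ hσ.1 y hy, ih (fun i hi => ?_) hσ.2⟩
    by_cases hx : i = x
    · subst hx; simp
    · simp [hx, h i (Finset.mem_erase.2 ⟨hx, hi⟩)]

theorem substOK_single_of_notMem {A : Fml L} {x : ℕ} (h : x ∉ A.fv) (t : L.Term ℕ) :
    A.SubstOK (single x t) :=
  substOK_congr (fun i hi => by
    rw [single, Function.update_of_ne]
    rintro rfl
    exact h hi) (substOK_var A)

theorem substOK_single_var {A : Fml L} {x y : ℕ} (h : y ∉ A.vars) :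
    A.SubstOK (single x (Term.var y)) :=
  substOK_of_forall fun i _ j hj => by
    by_cases hx : i = x
    · subst hx
      simp only [single, Function.update_self, Term.varFinset, Finset.mem_singleton] at hj
      exact Or.inr (hj ▸ h)
    · simp only [single, Function.update_of_ne hx, Term.varFinset, Finset.mem_singleton] at hj
      exact Or.inl hj

theorem substOK_of_isQF {A : Fml L} (hA : A.IsQF) (σ : ℕ → L.Term ℕ) : A.SubstOK σ := by
  induction A with
  | eq | rel | dep => trivial
  | neg A ih => exact ih hA
  | and A B ihA ihB | or A B ihA ihB => exact ⟨ihA hA.1, ihB hA.2⟩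
  | ex | all => exact hA.elim

theorem subst_subst_of_isQF {A : Fml L} (hA : A.IsQF) (σ τ : ℕ → L.Term ℕ) :
    (A.subst σ).subst τ = A.subst fun i => (σ i).subst τ := by
  induction A with
  | eq | rel | dep => simp [subst, term_subst_subst]
  | neg A ih => simp only [subst, ih hA]
  | and A B ihA ihB | or A B ihA ihB => simp only [subst, ihA hA.1, ihB hA.2]
  | ex | all => exact hA.elim

theorem exists_fresh (S : Finset ℕ) : ∃ x, x ∉ S := Infinite.exists_notMem_finset S

theorem exists_fresh_of_finite {Γ : Set (Fml L)} (hΓ : Γ.Finite) (S : Finset ℕ) :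
    ∃ x, x ∉ S ∧ ∀ B ∈ Γ, x ∉ B.vars := by
  obtain ⟨x, hx⟩ := exists_fresh (S ∪ hΓ.toFinset.biUnion vars)
  simp only [Finset.mem_union, Finset.mem_biUnion, Set.Finite.mem_toFinset, not_or, not_exists,
    not_and] at hx
  exact ⟨x, hx.1, hx.2⟩

namespace Derives

variable {Γ Γ' : Set (Fml L)} {A B C : Fml L}

/-- The eigenvariable conditions of `allI` and `exE` concern only `Δ`, so their subdeductions stay
as they are when `Γ` grows. -/
theorem weaken (h : Derives Γ A) (hΓ : Γ ⊆ Γ') : Derives Γ' A := by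
  induction h generalizing Γ' with
  | assumption h => exact .assumption (hΓ h)
  | andI _ _ ih₁ ih₂ => exact .andI (ih₁ hΓ) (ih₂ hΓ)
  | andE₁ _ ih => exact .andE₁ (ih hΓ)
  | andE₂ _ ih => exact .andE₂ (ih hΓ)
  | orI₁ h _ ih => exact .orI₁ h (ih hΓ)
  | orI₂ h _ ih => exact .orI₂ h (ih hΓ)
  | orE h _ _ _ ih ih₁ ih₂ =>
    exact .orE h (ih hΓ) (ih₁ (Set.insert_subset_insert hΓ)) (ih₂ (Set.insert_subset_insert hΓ))
  | negI hA hB _ ih => exact .negI hA hB (ih (Set.insert_subset_insert hΓ))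
  | negE hA _ ih => exact .negE hA (ih hΓ)
  | allI hΔ hx h _ => exact .allI (hΔ.trans hΓ) hx h
  | allE t ht _ ih => exact .allE t ht (ih hΓ)
  | exI t ht _ ih => exact .exI t ht (ih hΓ)
  | exE hΔ hx hB _ h₂ ih₁ _ => exact .exE (hΔ.trans hΓ) hx hB (ih₁ hΓ) h₂
  | orSubst _ _ ih₁ ih₂ => exact .orSubst (ih₁ hΓ) (ih₂ (Set.insert_subset_insert hΓ))
  | orComm _ ih => exact .orComm (ih hΓ)
  | orAssoc _ ih => exact .orAssoc (ih hΓ)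
  | allScope hx _ ih => exact .allScope hx (ih hΓ)
  | exScope hx _ ih => exact .exScope hx (ih hΓ)
  | unnest i hi hz _ ih => exact .unnest i hi hz (ih hΓ)
  | depDistr hC hC' hD hD' hn₁ hn₂ ho₁ ho₂ hv₁ hv₂ _ ih =>
    exact .depDistr hC hC' hD hD' hn₁ hn₂ ho₁ ho₂ hv₁ hv₂ (ih hΓ)
  | depI z hz _ ih => exact .depI z hz (ih hΓ)
  | depE ρ hn hρ hB hD _ ih => exact .depE ρ hn hρ hB hD (ih hΓ)
  | eqRefl t => exact .eqRefl t
  | eqSubst t s hA ht hs _ _ ih₁ ih₂ => exact .eqSubst t s hA ht hs (ih₁ hΓ) (ih₂ hΓ)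

theorem allE_self {x : ℕ} (h : Derives Γ (all x A)) : Derives Γ A := by
  have := allE (Term.var x) (by rw [single_self]; exact substOK_var A) h
  rwa [single_self, subst_var] at this

theorem exI_self {x : ℕ} (h : Derives Γ A) : Derives Γ (ex x A) :=
  exI (Term.var x) (by rw [single_self]; exact substOK_var A)
    (by rwa [single_self, subst_var])

/-- Formulas with dependence atoms cannot be the premise of an implication, so the cut passes
through `∃u A` for a new variable `u`. Finiteness of `Γ` provides a `u` that is free neither in `Γ`
nor in `B`. -/
theorem cut (hΓ : Γ.Finite) (h₁ : Derives Γ A) (h₂ : Derives (insert A Γ) B) : Derives Γ B := by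
  obtain ⟨u, hu, hu'⟩ := exists_fresh_of_finite hΓ (A.fv ∪ B.fv)
  simp only [Finset.mem_union, not_or] at hu
  exact exE subset_rfl (fun C hC h => hu' C hC (fv_subset_vars C h)) hu.2
    (exI_self h₁) h₂

theorem trans (h₁ : Derives {A} B) (h₂ : Derives {B} C) : Derives {A} C :=
  cut (Set.finite_singleton _) h₁ (h₂.weaken (by simp))

theorem of_singleton (hΓ : Γ.Finite) (h₁ : Derives Γ A) (h₂ : Derives {A} B) : Derives Γ B :=
  cut hΓ h₁ (h₂.weaken (by simp))

theorem self : Derives {A} A := assumption rfl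

theorem top : Derives Γ (Fml.top : Fml L) :=
  allI (Set.empty_subset _) (by simp) (eqRefl _)

theorem all_mono {x : ℕ} (h : Derives {A} B) : Derives {all x A} (all x B) :=
  allI subset_rfl (by simp [fv]) (trans (allE_self self) h)

theorem ex_mono {x : ℕ} (h : Derives {A} B) : Derives {ex x A} (ex x B) :=
  exE (Set.empty_subset _) (by simp) (by simp [fv]) self
    ((exI_self h).weaken (by simp))

theorem alls_mono {xs : List ℕ} (h : Derives {A} B) : Derives {alls xs A} (alls xs B) := by
  induction xs with
  | nil => exact h
  | cons x xs ih => exact all_mono ih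

theorem exs_mono {xs : List ℕ} (h : Derives {A} B) : Derives {exs xs A} (exs xs B) := by
  induction xs with
  | nil => exact h
  | cons x xs ih => exact ex_mono ih

/-- ∨-elimination has only first-order conclusions; for arbitrary disjuncts, disjunction
substitution is applied on each side, with commutation in between. -/
theorem or_mono {A' B' : Fml L} (hA : Derives {A} A') (hB : Derives {B} B') :
    Derives {or A B} (or A' B') :=
  orComm (orSubst (orComm (orSubst self (hB.weaken (by simp)))) (hA.weaken (by simp)))

theorem alls_elim {xs : List ℕ} (h : Derives Γ (alls xs A)) : Derives Γ A := by
  induction xs with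
  | nil => exact h
  | cons x xs ih => exact ih (allE_self h)

theorem alls_intro {xs : List ℕ} (hx : ∀ B ∈ Γ, ∀ x ∈ xs, x ∉ B.fv) (h : Derives Γ A) :
    Derives Γ (alls xs A) := by
  induction xs with
  | nil => exact h
  | cons x xs ih =>
    exact allI subset_rfl (fun B hB => hx B hB x List.mem_cons_self)
      (ih fun B hB y hy => hx B hB y (List.mem_cons_of_mem _ hy))

theorem exs_intro {ys : List ℕ} (h : Derives Γ A) : Derives Γ (exs ys A) := by
  induction ys with
  | nil => exact h
  | cons x xs ih => exact exI_self ih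

theorem exs_elim {ys : List ℕ} (hΓ : ∀ C ∈ Γ, ∀ y ∈ ys, y ∉ C.fv) (hB : ∀ y ∈ ys, y ∉ B.fv)
    (h₁ : Derives Γ (exs ys A)) (h₂ : Derives (insert A Γ) B) (hfin : Γ.Finite) : Derives Γ B := by
  induction ys generalizing Γ with
  | nil => exact cut hfin h₁ h₂
  | cons y ys ih =>
    refine exE subset_rfl (fun C hC => hΓ C hC y List.mem_cons_self) (hB y List.mem_cons_self) h₁ ?_
    refine ih ?_ (fun z hz => hB z (List.mem_cons_of_mem _ hz)) (assumption (Set.mem_insert _ _))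
      (h₂.weaken (Set.insert_subset_insert (Set.subset_insert _ _))) (hfin.insert _)
    rintro C (rfl | hC) z hz
    · exact fun h => (mem_fv_exs.1 h).2 hz
    · exact hΓ C hC z (List.mem_cons_of_mem _ hz)

theorem bigAnd_iff {As : List (Fml L)} : Derives Γ (bigAnd As) ↔ ∀ A ∈ As, Derives Γ A := by
  induction As with
  | nil => simpa [bigAnd] using top
  | cons B As ih =>
    by_cases hAs : As = []
    · subst hAs; simp [bigAnd]
    · rw [bigAnd_cons B hAs, List.forall_mem_cons, ← ih]
      exact ⟨fun h => ⟨andE₁ h, andE₂ h⟩, fun h => andI h.1 h.2⟩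

/-- The false sentence. -/
def _root_.DepLogic.falsum : Fml L := neg Fml.top

theorem isFO_top : (Fml.top : Fml L).IsFO := trivial

theorem negI' (hA : A.IsFO) (h : Derives (insert A Γ) falsum) : Derives Γ (neg A) :=
  negI hA isFO_top (andI top h)

theorem byContra (hA : A.IsFO) (h : Derives (insert (neg A) Γ) falsum) : Derives Γ A :=
  negE hA (negI' (A := neg A) hA h)

theorem contra (hA : A.IsFO) (h₁ : Derives Γ A) (h₂ : Derives Γ (neg A)) : Derives Γ falsum :=
  negI isFO_top hA
    (andI (h₁.weaken (Set.subset_insert _ _)) (h₂.weaken (Set.subset_insert _ _)))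

theorem eq_symm {t s : L.Term ℕ} (h : Derives Γ (eq t s)) : Derives Γ (eq s t) := by
  obtain ⟨x, hx⟩ := exists_fresh t.varFinset
  have key : ∀ r : L.Term ℕ, (eq (Term.var x) t).subst (single x r) = eq r t := by
    intro r
    simp only [subst, Term.subst]
    rw [term_subst_congr (t := t) (τ := Term.var), term_subst_var]
    · simp [single]
    · intro i hi
      rw [single, Function.update_of_ne]
      rintro rfl
      exact hx hi
  have := eqSubst (A := eq (Term.var x) t) t s trivial trivial trivial h
    (by rw [key]; exact eqRefl t)
  rwa [key] at this

/-- Substitution of equals for several variables of a quantifier-free first-order formula. -/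
theorem eq_congr (hA : A.IsFO) (hQ : A.IsQF) {σ τ : ℕ → L.Term ℕ}
    (h : ∀ i ∈ A.fv, Derives Γ (eq (σ i) (τ i))) (hσ : Derives Γ (A.subst σ)) :
    Derives Γ (A.subst τ) := by
  classical
  -- The identity rule treats one variable at a time: `S` collects those that already carry `τ`, and
  -- a fresh `z` marks the place of the next one.
  have key : ∀ S ⊆ A.fv, Derives Γ (A.subst (S.piecewise τ σ)) := by
    intro S
    induction S using Finset.induction_on with
    | empty => intro _; simpa using hσ
    | insert k S hk ih =>
      intro hS
      have hS' : S ⊆ A.fv := (Finset.subset_insert _ _).trans hS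
      have hkA : k ∈ A.fv := hS (Finset.mem_insert_self _ _)
      obtain ⟨z, hz⟩ := exists_fresh (A.fv.biUnion fun i => (S.piecewise τ σ i).varFinset)
      simp only [Finset.mem_biUnion, not_exists, not_and] at hz
      have sub : ∀ r, (A.subst (Function.update (S.piecewise τ σ) k (Term.var z))).subst
          (single z r) = A.subst (Function.update (S.piecewise τ σ) k r) := by
        intro r
        rw [subst_subst_of_isQF hQ]
        refine subst_congr fun i hi => ?_
        by_cases hik : i = k
        · subst hik; simp [Term.subst, single]
        · simp only [Function.update_of_ne hik]
          rw [term_subst_congr (τ := Term.var), term_subst_var]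
          intro j hj
          rw [single, Function.update_of_ne]
          rintro rfl
          exact hz i hi hj
      have hq := isQF_subst (σ := Function.update (S.piecewise τ σ) k (Term.var z)) |>.2 hQ
      have := eqSubst (x := z) (A := A.subst (Function.update (S.piecewise τ σ) k (Term.var z)))
        (σ k) (τ k) (isFO_subst.2 hA) (substOK_of_isQF hq _) (substOK_of_isQF hq _) (h k hkA) (by
          rw [sub]
          convert! ih hS' using 2
          refine Function.update_eq_self_iff.2 ?_
          simp [hk])
      rw [sub] at this
      convert! this using 2
      rw [Finset.piecewise_insert]
  have := key A.fv subset_rfl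
  rwa [subst_congr (τ := τ)] at this
  intro i hi
  simp [hi]

theorem rel_congr {n : ℕ} {R : L.Relations n} {ts us : Fin n → L.Term ℕ}
    (h : ∀ i, Derives Γ (eq (ts i) (us i))) (hR : Derives Γ (rel R ts)) :
    Derives Γ (rel R us) := by
  have := eq_congr (Γ := Γ) (A := rel R fun i => Term.var i.1) trivial trivial
    (σ := fun i => if h : i < n then ts ⟨i, h⟩ else Term.var i)
    (τ := fun i => if h : i < n then us ⟨i, h⟩ else Term.var i)
  simp only [subst, Term.subst, Fin.is_lt, dif_pos, Fin.eta] at this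
  refine this (fun i hi => ?_) hR
  simp only [fv, Finset.mem_biUnion, Finset.mem_univ, true_and, Term.varFinset,
    Finset.mem_singleton] at hi
  obtain ⟨k, rfl⟩ := hi
  simpa using h k

theorem func_congr {n : ℕ} {f : L.Functions n} {ts us : Fin n → L.Term ℕ}
    (h : ∀ i, Derives Γ (eq (ts i) (us i))) :
    Derives Γ (eq (Term.func f ts) (Term.func f us)) := by
  -- The variables below `n` mark the arguments to be rewritten, those from `n` to `2n - 1` the
  -- arguments that remain `ts`; the starting instance is a case of reflexivity.
  have := eq_congr (Γ := Γ) (A := eq (Term.func f fun i => Term.var (n + i.1))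
    (Term.func f fun i => Term.var i.1)) trivial trivial
    (σ := fun i => if h : i < n then ts ⟨i, h⟩ else if h : i - n < n then ts ⟨i - n, h⟩
      else Term.var i)
    (τ := fun i => if h : i < n then us ⟨i, h⟩ else if h : i - n < n then ts ⟨i - n, h⟩
      else Term.var i)
  simp only [subst, Term.subst, Fin.is_lt, dif_pos, Fin.eta, add_tsub_cancel_left,
    not_lt.2 (Nat.le_add_right _ _), dif_neg, not_false_eq_true] at this
  refine this (fun i hi => ?_) (eqRefl _)
  simp only [fv, Finset.mem_union, Finset.mem_biUnion, Finset.mem_univ, true_and, Term.varFinset,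
    Finset.mem_singleton] at hi
  rcases hi with ⟨k, rfl⟩ | ⟨k, rfl⟩
  · simpa using eqRefl _
  · simpa using h k

theorem eq_trans {r s t : L.Term ℕ} (h₁ : Derives Γ (eq r s)) (h₂ : Derives Γ (eq s t)) :
    Derives Γ (eq r t) := by
  have := eq_congr (Γ := Γ) (A := eq (Term.var 0) (Term.var 1)) trivial trivial
    (σ := fun i => if i = 0 then r else s) (τ := fun i => if i = 0 then r else t)
  simp only [subst, Term.subst] at this
  refine this (fun i hi => ?_) h₁
  by_cases hi : i = 0
  · simpa [hi] using eqRefl r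
  · simpa [hi] using h₂

end Derives

end DepLogic

/-! ### Finiteness of deductions. -/

namespace DepLogic

open FirstOrder.Language (Term)
open FirstOrder.Language.Structure (RelMap funMap)
open Fml

variable {L : FirstOrder.Language.{u, v}}

namespace Derives

variable {Γ : Set (Fml L)} {A B : Fml L}

theorem exists_finite_of_insert {Δ : Set (Fml L)}
    (h : ∃ Γ₀ ⊆ insert B Δ, Γ₀.Finite ∧ Derives Γ₀ A) :
    ∃ Γ₀ ⊆ Δ, Γ₀.Finite ∧ Derives (insert B Γ₀) A := by
  obtain ⟨Γ₀, h₁, h₂, h₃⟩ := h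
  refine ⟨Γ₀ \ {B}, ?_, h₂.sdiff, h₃.weaken ?_⟩
  · rintro C ⟨hC, hCB⟩
    exact (h₁ hC).resolve_left hCB
  · intro C hC
    by_cases hCB : C = B
    · exact Or.inl hCB
    · exact Or.inr ⟨hC, hCB⟩

/-- A deduction uses finitely many assumptions. -/
theorem exists_finite (h : Derives Γ A) : ∃ Γ₀ ⊆ Γ, Γ₀.Finite ∧ Derives Γ₀ A := by
  induction h with
  | @assumption Γ A h => exact ⟨{A}, by simpa using h, Set.finite_singleton _, self⟩
  | andI _ _ ih₁ ih₂ =>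
    obtain ⟨Γ₁, s₁, f₁, d₁⟩ := ih₁
    obtain ⟨Γ₂, s₂, f₂, d₂⟩ := ih₂
    exact ⟨Γ₁ ∪ Γ₂, Set.union_subset s₁ s₂, f₁.union f₂,
      andI (d₁.weaken Set.subset_union_left) (d₂.weaken Set.subset_union_right)⟩
  | andE₁ _ ih => obtain ⟨Γ₁, s₁, f₁, d₁⟩ := ih; exact ⟨Γ₁, s₁, f₁, andE₁ d₁⟩
  | andE₂ _ ih => obtain ⟨Γ₁, s₁, f₁, d₁⟩ := ih; exact ⟨Γ₁, s₁, f₁, andE₂ d₁⟩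
  | orI₁ h _ ih => obtain ⟨Γ₁, s₁, f₁, d₁⟩ := ih; exact ⟨Γ₁, s₁, f₁, orI₁ h d₁⟩
  | orI₂ h _ ih => obtain ⟨Γ₁, s₁, f₁, d₁⟩ := ih; exact ⟨Γ₁, s₁, f₁, orI₂ h d₁⟩
  | orE hC _ _ _ ih ih₁ ih₂ =>
    obtain ⟨Γ₀, s₀, f₀, d₀⟩ := ih
    obtain ⟨Γ₁, s₁, f₁, d₁⟩ := exists_finite_of_insert ih₁
    obtain ⟨Γ₂, s₂, f₂, d₂⟩ := exists_finite_of_insert ih₂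
    refine ⟨Γ₀ ∪ (Γ₁ ∪ Γ₂), Set.union_subset s₀ (Set.union_subset s₁ s₂), f₀.union (f₁.union f₂),
      orE hC (d₀.weaken Set.subset_union_left) (d₁.weaken ?_) (d₂.weaken ?_)⟩
    · exact Set.insert_subset_insert (Set.subset_union_left.trans Set.subset_union_right)
    · exact Set.insert_subset_insert (Set.subset_union_right.trans Set.subset_union_right)
  | negI hA hB _ ih =>
    obtain ⟨Γ₁, s₁, f₁, d₁⟩ := exists_finite_of_insert ih
    exact ⟨Γ₁, s₁, f₁, negI hA hB d₁⟩
  | negE hA _ ih => obtain ⟨Γ₁, s₁, f₁, d₁⟩ := ih; exact ⟨Γ₁, s₁, f₁, negE hA d₁⟩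
  | allI hΔ hx _ ih =>
    obtain ⟨Γ₁, s₁, f₁, d₁⟩ := ih
    exact ⟨Γ₁, s₁.trans hΔ, f₁, allI subset_rfl (fun B hB => hx B (s₁ hB)) d₁⟩
  | allE t ht _ ih => obtain ⟨Γ₁, s₁, f₁, d₁⟩ := ih; exact ⟨Γ₁, s₁, f₁, allE t ht d₁⟩
  | exI t ht _ ih => obtain ⟨Γ₁, s₁, f₁, d₁⟩ := ih; exact ⟨Γ₁, s₁, f₁, exI t ht d₁⟩
  | exE hΔ hx hB _ _ ih₁ ih₂ =>
    obtain ⟨Γ₁, s₁, f₁, d₁⟩ := ih₁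
    obtain ⟨Γ₂, s₂, f₂, d₂⟩ := exists_finite_of_insert ih₂
    exact ⟨Γ₁ ∪ Γ₂, Set.union_subset s₁ (s₂.trans hΔ), f₁.union f₂,
      exE Set.subset_union_right (fun C hC => hx C (s₂ hC)) hB
        (d₁.weaken Set.subset_union_left) d₂⟩
  | orSubst _ _ ih₁ ih₂ =>
    obtain ⟨Γ₁, s₁, f₁, d₁⟩ := ih₁
    obtain ⟨Γ₂, s₂, f₂, d₂⟩ := exists_finite_of_insert ih₂
    exact ⟨Γ₁ ∪ Γ₂, Set.union_subset s₁ s₂, f₁.union f₂,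
      orSubst (d₁.weaken Set.subset_union_left)
        (d₂.weaken (Set.insert_subset_insert Set.subset_union_right))⟩
  | orComm _ ih => obtain ⟨Γ₁, s₁, f₁, d₁⟩ := ih; exact ⟨Γ₁, s₁, f₁, orComm d₁⟩
  | orAssoc _ ih => obtain ⟨Γ₁, s₁, f₁, d₁⟩ := ih; exact ⟨Γ₁, s₁, f₁, orAssoc d₁⟩
  | allScope hx _ ih => obtain ⟨Γ₁, s₁, f₁, d₁⟩ := ih; exact ⟨Γ₁, s₁, f₁, allScope hx d₁⟩
  | exScope hx _ ih => obtain ⟨Γ₁, s₁, f₁, d₁⟩ := ih; exact ⟨Γ₁, s₁, f₁, exScope hx d₁⟩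
  | unnest i hi hz _ ih => obtain ⟨Γ₁, s₁, f₁, d₁⟩ := ih; exact ⟨Γ₁, s₁, f₁, unnest i hi hz d₁⟩
  | depDistr hC hC' hD hD' hn₁ hn₂ ho₁ ho₂ hv₁ hv₂ _ ih =>
    obtain ⟨Γ₁, s₁, f₁, d₁⟩ := ih
    exact ⟨Γ₁, s₁, f₁, depDistr hC hC' hD hD' hn₁ hn₂ ho₁ ho₂ hv₁ hv₂ d₁⟩
  | depI z hz _ ih => obtain ⟨Γ₁, s₁, f₁, d₁⟩ := ih; exact ⟨Γ₁, s₁, f₁, depI z hz d₁⟩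
  | depE ρ hn hρ hB hD _ ih =>
    obtain ⟨Γ₁, s₁, f₁, d₁⟩ := ih
    exact ⟨Γ₁, s₁, f₁, depE ρ hn hρ hB hD d₁⟩
  | eqRefl t => exact ⟨∅, Set.empty_subset _, Set.finite_empty, eqRefl t⟩
  | eqSubst t s hA ht hs _ _ ih₁ ih₂ =>
    obtain ⟨Γ₁, s₁, f₁, d₁⟩ := ih₁
    obtain ⟨Γ₂, s₂, f₂, d₂⟩ := ih₂
    exact ⟨Γ₁ ∪ Γ₂, Set.union_subset s₁ s₂, f₁.union f₂,
      eqSubst t s hA ht hs (d₁.weaken Set.subset_union_left) (d₂.weaken Set.subset_union_right)⟩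

end Derives

/-! ### Renaming bound variables. -/

section Renaming

theorem update_single_of_ne {x y z : ℕ} (h : z ≠ x) :
    Function.update (single x (Term.var y : L.Term ℕ)) z (Term.var z) = single x (Term.var y) :=
  Function.update_eq_self_iff.2 (by rw [single, Function.update_of_ne h])

theorem update_single_self (x y : ℕ) :
    Function.update (single x (Term.var y : L.Term ℕ)) x (Term.var x) = Term.var := by
  simp [single]

/-- As `y` appears nowhere in `B`, the second substitution undoes the first literally; where `x` is
rebound, the first stops and the second finds no free `y`. Renaming of a quantified variable is
thereby reversible. -/
theorem subst_single_single {B : Fml L} {x y : ℕ} (h : y ∉ B.vars) :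
    (B.subst (single x (Term.var y))).subst (single y (Term.var x)) = B := by
  have hterm : ∀ t : L.Term ℕ, y ∉ t.varFinset →
      (t.subst (single x (Term.var y))).subst (single y (Term.var x)) = t := by
    intro t ht
    rw [term_subst_subst]
    conv_rhs => rw [← term_subst_var t]
    refine term_subst_congr fun i hi => ?_
    by_cases hix : i = x
    · subst hix; simp [single, Term.subst]
    · have hiy : i ≠ y := by rintro rfl; exact ht hi
      simp [single, hix, Term.subst, hiy]
  induction B with
  | eq t s =>
    simp only [vars, Finset.mem_union, not_or] at h
    simp only [subst, hterm t h.1, hterm s h.2]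
  | rel R ts =>
    simp only [vars, Finset.mem_biUnion, Finset.mem_univ, true_and, not_exists] at h
    simp only [subst, fun i => hterm (ts i) (h i)]
  | dep ts =>
    simp only [vars, mem_listVars, not_exists, not_and] at h
    simp only [subst, List.map_map, dep.injEq]
    conv_rhs => rw [← List.map_id ts]
    exact List.map_congr_left fun t ht => hterm t (h t ht)
  | neg A ih => simp only [subst, ih h]
  | and A B ihA ihB | or A B ihA ihB =>
    simp only [vars, Finset.mem_union, not_or] at h
    simp only [subst, ihA h.1, ihB h.2]
  | ex z A ih | all z A ih =>
    simp only [vars, Finset.mem_insert, not_or] at h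
    by_cases hzx : z = x
    · subst hzx
      simp only [subst, update_single_self, subst_var, update_single_of_ne (Ne.symm h.1)]
      rw [subst_single_of_notMem fun h' => h.2 (fv_subset_vars A h')]
    · simp only [subst, update_single_of_ne hzx, update_single_of_ne (Ne.symm h.1), ih h.2]

theorem substOK_single_single {B : Fml L} {x y : ℕ} (h : y ∉ B.vars) :
    (B.subst (single x (Term.var y))).SubstOK (single y (Term.var x)) := by
  induction B with
  | eq | rel | dep => trivial
  | neg A ih => exact ih h
  | and A B ihA ihB | or A B ihA ihB =>
    simp only [vars, Finset.mem_union, not_or] at h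
    exact ⟨ihA h.1, ihB h.2⟩
  | ex z A ih | all z A ih =>
    simp only [vars, Finset.mem_insert, not_or] at h
    have hzy : z ≠ y := Ne.symm h.1
    by_cases hzx : z = x
    · subst hzx
      simp only [subst, SubstOK, update_single_self, subst_var, update_single_of_ne hzy]
      refine ⟨fun i hi => ?_, substOK_single_of_notMem (fun h' => h.2 (fv_subset_vars A h')) _⟩
      rw [Finset.mem_erase] at hi
      have : i ≠ y := by rintro rfl; exact h.2 (fv_subset_vars A hi.2)
      simp [single, this, Term.varFinset, Ne.symm hi.1]
    · simp only [subst, SubstOK, update_single_of_ne hzx, update_single_of_ne hzy]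
      refine ⟨fun i hi => ?_, ih h.2⟩
      rw [Finset.mem_erase] at hi
      by_cases hiy : i = y
      · subst hiy; simp [single, Term.varFinset, hzx]
      · simp [single, hiy, Term.varFinset, Ne.symm hi.1]

theorem Derives.ex_rename {B : Fml L} {x y : ℕ} (h : y ∉ B.vars) :
    Derives {ex x B} (ex y (B.subst (single x (Term.var y)))) := by
  by_cases hxy : x = y
  · subst hxy; rw [single_self, subst_var]; exact .self
  refine .exE (Set.empty_subset _) (by simp) ?_ .self
    (.exI (Term.var x) (substOK_single_single h) ?_)
  · simp only [fv, Finset.mem_erase, not_and]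
    intro _ hx
    obtain ⟨j, hj, hxj⟩ := mem_fv_subst hx
    by_cases hjx : j = x
    · subst hjx; simp [single, Term.varFinset, hxy] at hxj
    · simp only [single, Function.update_of_ne hjx, Term.varFinset, Finset.mem_singleton] at hxj
      exact hjx hxj.symm
  · rw [subst_single_single h]
    exact .assumption (Set.mem_insert _ _)

theorem Derives.ex_rename_symm {B : Fml L} {x y : ℕ} (h : y ∉ B.vars) :
    Derives {ex y (B.subst (single x (Term.var y)))} (ex x B) := by
  refine .exE (Set.empty_subset _) (by simp) ?_ .self (.exI (Term.var y) (substOK_single_var h) ?_)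
  · exact fun h' => h (fv_subset_vars B (Finset.mem_of_mem_erase h'))
  · exact .assumption (Set.mem_insert _ _)

theorem Derives.all_rename {B : Fml L} {x y : ℕ} (h : y ∉ B.vars) :
    Derives {all x B} (all y (B.subst (single x (Term.var y)))) := by
  refine .allI subset_rfl ?_ (.allE _ (substOK_single_var h) .self)
  rintro _ rfl h'
  exact h (fv_subset_vars B (Finset.mem_of_mem_erase h'))

theorem Derives.all_rename_symm {B : Fml L} {x y : ℕ} (h : y ∉ B.vars) :
    Derives {all y (B.subst (single x (Term.var y)))} (all x B) := by
  by_cases hxy : x = y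
  · subst hxy; rw [single_self, subst_var]; exact .self
  have := Derives.allI (Γ := {all y (B.subst (single x (Term.var y)))}) (x := x) subset_rfl ?_
    (.allE (Term.var x) (substOK_single_single h) .self)
  · rwa [subst_single_single h] at this
  rintro _ rfl hx
  simp only [fv, Finset.mem_erase] at hx
  obtain ⟨j, hj, hxj⟩ := mem_fv_subst hx.2
  by_cases hjx : j = x
  · subst hjx; simp [single, Term.varFinset, hxy] at hxj
  · simp only [single, Function.update_of_ne hjx, Term.varFinset, Finset.mem_singleton] at hxj
    exact hjx hxj.symm

end Renaming

/-! ### Formulas over countably many symbols. -/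

section Symbols

/-- The function symbols of the term belong to `S`. -/
def TermOver (S : Set L.Symbols) : L.Term ℕ → Prop
  | .var _ => True
  | .func (l := n) f ts => Sum.inl ⟨n, f⟩ ∈ S ∧ ∀ i, TermOver S (ts i)

/-- First-order formulas whose symbols belong to `S`. -/
def Over (S : Set L.Symbols) : Fml L → Prop
  | .eq t s => TermOver S t ∧ TermOver S s
  | .rel (n := n) R ts => Sum.inr ⟨n, R⟩ ∈ S ∧ ∀ i, TermOver S (ts i)
  | .dep _ => False
  | .neg A => Over S A
  | .and A B => Over S A ∧ Over S B
  | .or A B => Over S A ∧ Over S B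
  | .ex _ A => Over S A
  | .all _ A => Over S A

variable {S S' : Set L.Symbols}

theorem TermOver.mono (h : S ⊆ S') {t : L.Term ℕ} (ht : TermOver S t) : TermOver S' t := by
  induction t with
  | var => trivial
  | func f ts ih => exact ⟨h ht.1, fun i => ih i (ht.2 i)⟩

theorem Over.mono (h : S ⊆ S') {A : Fml L} (hA : Over S A) : Over S' A := by
  induction A with
  | eq t s => exact ⟨hA.1.mono h, hA.2.mono h⟩
  | rel R ts => exact ⟨h hA.1, fun i => (hA.2 i).mono h⟩
  | dep ts => exact hA
  | neg A ih | ex _ A ih | all _ A ih => exact ih hA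
  | and A B ihA ihB | or A B ihA ihB => exact ⟨ihA hA.1, ihB hA.2⟩

theorem Over.isFO {A : Fml L} (hA : Over S A) : A.IsFO := by
  induction A with
  | eq | rel => trivial
  | dep ts => exact hA
  | neg A ih | ex _ A ih | all _ A ih => exact ih hA
  | and A B ihA ihB | or A B ihA ihB => exact ⟨ihA hA.1, ihB hA.2⟩

theorem TermOver.subst {t : L.Term ℕ} (ht : TermOver S t) {σ : ℕ → L.Term ℕ}
    (hσ : ∀ i, TermOver S (σ i)) : TermOver S (t.subst σ) := by
  induction t with
  | var i => exact hσ i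
  | func f ts ih => exact ⟨ht.1, fun i => ih i (ht.2 i)⟩

theorem Over.subst {A : Fml L} (hA : Over S A) {σ : ℕ → L.Term ℕ}
    (hσ : ∀ i, TermOver S (σ i)) : Over S (A.subst σ) := by
  induction A generalizing σ with
  | eq t s => exact ⟨hA.1.subst hσ, hA.2.subst hσ⟩
  | rel R ts => exact ⟨hA.1, fun i => (hA.2 i).subst hσ⟩
  | dep ts => exact hA
  | neg A ih => exact ih hA hσ
  | and A B ihA ihB | or A B ihA ihB => exact ⟨ihA hA.1 hσ, ihB hA.2 hσ⟩
  | ex x A ih | all x A ih =>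
    refine ih hA fun i => ?_
    by_cases h : i = x
    · subst h; simp [TermOver]
    · simpa [h] using hσ i

theorem exists_termOver (t : L.Term ℕ) : ∃ S : Set L.Symbols, S.Countable ∧ TermOver S t := by
  induction t with
  | var i => exact ⟨∅, Set.countable_empty, trivial⟩
  | @func n f ts ih =>
    choose S hS hts using ih
    refine ⟨insert (Sum.inl ⟨n, f⟩) (⋃ i, S i), (Set.countable_iUnion hS).insert _,
      Set.mem_insert _ _, fun i => (hts i).mono ?_⟩
    exact (Set.subset_iUnion S i).trans (Set.subset_insert _ _)

/-- A formula mentions few symbols. Deciding only formulas over a countable `S` lets the Henkin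
construction end after ω steps of finite stages even if `L` is uncountable. -/
theorem exists_over {A : Fml L} (hA : A.IsFO) : ∃ S : Set L.Symbols, S.Countable ∧ Over S A := by
  induction A with
  | eq t s =>
    obtain ⟨S, hS, ht⟩ := exists_termOver t
    obtain ⟨S', hS', hs⟩ := exists_termOver s
    exact ⟨S ∪ S', hS.union hS', ht.mono Set.subset_union_left, hs.mono Set.subset_union_right⟩
  | @rel n R ts =>
    choose S hS hts using fun i => exists_termOver (ts i)
    refine ⟨insert (Sum.inr ⟨n, R⟩) (⋃ i, S i), (Set.countable_iUnion hS).insert _,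
      Set.mem_insert _ _, fun i => (hts i).mono ?_⟩
    exact (Set.subset_iUnion S i).trans (Set.subset_insert _ _)
  | dep ts => exact hA.elim
  | neg A ih | ex _ A ih | all _ A ih => exact ih hA
  | and A B ihA ihB | or A B ihA ihB =>
    obtain ⟨S, hS, ht⟩ := ihA hA.1
    obtain ⟨S', hS', hs⟩ := ihB hA.2
    exact ⟨S ∪ S', hS.union hS', ht.mono Set.subset_union_left, hs.mono Set.subset_union_right⟩

/-- These terms are images of terms of a language whose only function symbols are those in `S`. -/
theorem countable_termOver (hS : S.Countable) : {t : L.Term ℕ | TermOver S t}.Countable := by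
  let L' : FirstOrder.Language.{u, v} :=
    ⟨fun n => {f : L.Functions n // Sum.inl ⟨n, f⟩ ∈ S}, fun n => L.Relations n⟩
  let ι : L' →ᴸ L := ⟨fun _ f => f.1, fun _ R => R⟩
  have : Countable S := hS
  have : Countable (Σ n, L'.Functions n) := by
    refine Function.Injective.countable
      (f := fun f : (Σ n, L'.Functions n) => (⟨Sum.inl ⟨f.1, f.2.1⟩, f.2.2⟩ : S)) ?_
    rintro ⟨n, f, hf⟩ ⟨m, g, hg⟩ h
    simp only [Subtype.mk.injEq, Sum.inl.injEq, Sigma.mk.injEq] at h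
    obtain ⟨rfl, h⟩ := h
    obtain rfl := eq_of_heq h
    rfl
  refine (Set.countable_range (ι.onTerm : L'.Term ℕ → L.Term ℕ)).mono fun t ht => ?_
  induction t with
  | var i => exact ⟨.var i, rfl⟩
  | @func n f ts ih =>
    choose us hus using fun i => ih i (ht.2 i)
    exact ⟨.func (⟨f, ht.1⟩ : L'.Functions n) us, by
      simp only [FirstOrder.Language.LHom.onTerm, hus]; rfl⟩

/-- The formulas obtained from `K` by at most `n` steps. -/
def formulaLevel (K : Set (Fml L)) : ℕ → Set (Fml L)
  | 0 => K
  | n + 1 => formulaLevel K n ∪ (neg '' formulaLevel K n ∪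
      (Set.image2 and (formulaLevel K n) (formulaLevel K n) ∪
      (Set.image2 or (formulaLevel K n) (formulaLevel K n) ∪
      ((⋃ x, ex x '' formulaLevel K n) ∪ ⋃ x, all x '' formulaLevel K n))))

theorem countable_formulaLevel {K : Set (Fml L)} (hK : K.Countable) (n : ℕ) :
    (formulaLevel K n).Countable := by
  induction n with
  | zero => exact hK
  | succ n ih =>
    exact ih.union ((ih.image _).union ((ih.image2 ih _).union ((ih.image2 ih _).union
      ((Set.countable_iUnion fun x => ih.image _).union
        (Set.countable_iUnion fun x => ih.image _)))))

theorem formulaLevel_mono (K : Set (Fml L)) : Monotone (formulaLevel K) :=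
  monotone_nat_of_le_succ fun _ => Set.subset_union_left

/-- The atoms over `S` are countable in number, each `formulaLevel` over them remains countable, and
every formula over `S` occurs at some level. -/
theorem countable_over (hS : S.Countable) : {A : Fml L | Over S A}.Countable := by
  have hT := countable_termOver hS
  let K : Set (Fml L) := Set.image2 eq {t | TermOver S t} {t | TermOver S t} ∪
    ⋃ r ∈ {r : Σ n, L.Relations n | Sum.inr r ∈ S},
      (fun ts => rel r.2 ts) '' {ts | ∀ i, ts i ∈ {t | TermOver S t}}
  have hK : K.Countable := by
    refine (hT.image2 hT _).union (Set.Countable.biUnion ?_ fun r _ => ?_)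
    · exact hS.preimage Sum.inr_injective
    · exact (Set.countable_pi fun _ => hT).image _
  refine (Set.countable_iUnion (countable_formulaLevel hK)).mono fun A hA => ?_
  simp only [Set.mem_iUnion]
  induction A with
  | eq t s => exact ⟨0, Or.inl ⟨t, hA.1, s, hA.2, rfl⟩⟩
  | @rel n R ts =>
    exact ⟨0, Or.inr (Set.mem_iUnion₂.2 ⟨⟨n, R⟩, hA.1, ts, hA.2, rfl⟩)⟩
  | dep ts => exact hA.elim
  | neg A ih =>
    obtain ⟨n, h⟩ := ih hA
    exact ⟨n + 1, .inr (.inl ⟨A, h, rfl⟩)⟩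
  | and A B ihA ihB =>
    obtain ⟨n, h⟩ := ihA hA.1
    obtain ⟨m, h'⟩ := ihB hA.2
    exact ⟨max n m + 1, .inr (.inr (.inl ⟨A, formulaLevel_mono K (le_max_left _ _) h, B,
      formulaLevel_mono K (le_max_right _ _) h', rfl⟩))⟩
  | or A B ihA ihB =>
    obtain ⟨n, h⟩ := ihA hA.1
    obtain ⟨m, h'⟩ := ihB hA.2
    exact ⟨max n m + 1, .inr (.inr (.inr (.inl ⟨A, formulaLevel_mono K (le_max_left _ _) h, B,
      formulaLevel_mono K (le_max_right _ _) h', rfl⟩)))⟩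
  | ex x A ih =>
    obtain ⟨n, h⟩ := ih hA
    exact ⟨n + 1, .inr (.inr (.inr (.inr (.inl (Set.mem_iUnion.2 ⟨x, A, h, rfl⟩)))))⟩
  | all x A ih =>
    obtain ⟨n, h⟩ := ih hA
    exact ⟨n + 1, .inr (.inr (.inr (.inr (.inr (Set.mem_iUnion.2 ⟨x, A, h, rfl⟩)))))⟩

end Symbols

end DepLogic

/-! ### The term model of a Henkin set. -/

namespace DepLogic

open FirstOrder.Language (Term)
open FirstOrder.Language.Structure (RelMap funMap)
open Fml

variable {L : FirstOrder.Language.{u, v}}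

section HenkinModel

/-- Variables are identified if their equality is derivable from `H`. -/
def henkinSetoid (H : Set (Fml L)) : Setoid (ULift.{max u v} ℕ) where
  r a b := Derives H (varEq a.down b.down)
  iseqv := ⟨fun _ => .eqRefl _, fun h => h.eq_symm, fun h₁ h₂ => h₁.eq_trans h₂⟩

/-- The universe of the term model of `H`. -/
def HenkinModel (H : Set (Fml L)) : Type (max u v) := Quotient (henkinSetoid H)

namespace HenkinModel

/-- The class of a variable. -/
def cls (H : Set (Fml L)) (x : ℕ) : HenkinModel H := Quotient.mk (henkinSetoid H) ⟨x⟩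

/-- A variable in the class. -/
noncomputable def rep {H : Set (Fml L)} (m : HenkinModel H) : ℕ :=
  (@Quotient.out _ (henkinSetoid H) m).down

variable {H : Set (Fml L)}

theorem cls_eq_cls {x y : ℕ} : cls H x = cls H y ↔ Derives H (varEq x y) :=
  @Quotient.eq _ (henkinSetoid H) _ _

theorem cls_rep (m : HenkinModel H) : cls H (rep m) = m := @Quotient.out_eq _ (henkinSetoid H) m

/-- The value of `f` is a variable provably equal to the term. For symbols outside `S` there may be
none and the value is arbitrary; truth is compared with derivability only for formulas over `S`. -/
noncomputable instance : L.Structure (HenkinModel H) where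
  funMap f m := cls H (Classical.epsilon fun y =>
    Derives H (eq (Term.var y) (Term.func f fun i => Term.var (rep (m i)))))
  RelMap R m := Derives H (rel R fun i => Term.var (rep (m i)))

end HenkinModel

open HenkinModel

/-- Consistent sets that decide all formulas over `S` and contain witnesses. -/
structure IsHenkin (S : Set L.Symbols) (H : Set (Fml L)) : Prop where
  con : ¬ Derives H falsum
  dec : ∀ A, Over S A → A ∈ H ∨ neg A ∈ H
  wit : ∀ x B, Over S (ex x B) → ex x B ∈ H →
    ∃ y, y ∉ B.vars ∧ B.subst (single x (Term.var y)) ∈ H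
  term : ∀ t, TermOver S t → ∀ k, ∃ y, k ≤ y ∧ eq (Term.var y) t ∈ H

/-- The number of connectives and quantifiers. -/
def size : Fml L → ℕ
  | .eq _ _ | .rel _ _ | .dep _ => 0
  | .neg A | .ex _ A | .all _ A => size A + 1
  | .and A B | .or A B => size A + size B + 1

theorem size_subst (A : Fml L) (σ : ℕ → L.Term ℕ) : size (A.subst σ) = size A := by
  induction A generalizing σ <;> simp_all [size, Fml.subst]

theorem Derives.ex_neg_of_neg_all {Γ : Set (Fml L)} (hΓ : Γ.Finite) {x : ℕ} {B : Fml L}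
    (hB : B.IsFO) (h : Derives Γ (neg (all x B))) : Derives Γ (ex x (neg B)) := by
  refine of_singleton hΓ h (byContra (A := ex x (neg B)) hB ?_)
  refine contra (A := all x B) hB ?_ (assumption (Set.mem_insert_of_mem _ rfl))
  refine allI (Δ := {neg (ex x (neg B))}) (by simp) (by simp [fv]) (byContra hB ?_)
  exact contra (A := ex x (neg B)) hB (exI_self (assumption (Set.mem_insert _ _)))
    (assumption (Set.mem_insert_of_mem _ rfl))

namespace IsHenkin

variable {S : Set L.Symbols} {H : Set (Fml L)}

theorem mem_of_derives (hH : IsHenkin S H) {A : Fml L} (hA : Over S A) (h : Derives H A) :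
    A ∈ H :=
  (hH.dec A hA).resolve_right fun h' => hH.con (.contra hA.isFO h (.assumption h'))

theorem derives_neg (hH : IsHenkin S H) {A : Fml L} (hA : Over S A) :
    Derives H (neg A) ↔ ¬ Derives H A :=
  ⟨fun h h' => hH.con (.contra hA.isFO h' h), fun h => (hH.dec A hA).elim
    (fun h' => absurd (.assumption h') h) .assumption⟩

theorem exists_eq (hH : IsHenkin S H) {t : L.Term ℕ} (ht : TermOver S t) (k : ℕ) :
    ∃ y, k ≤ y ∧ Derives H (eq (Term.var y) t) :=
  (hH.term t ht k).imp fun _ h => ⟨h.1, .assumption h.2⟩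

theorem exists_cls (hH : IsHenkin S H) (m : HenkinModel H) (k : ℕ) :
    ∃ y, k ≤ y ∧ cls H y = m := by
  obtain ⟨y, hy, h⟩ := hH.exists_eq (t := Term.var (rep m)) trivial k
  exact ⟨y, hy, by rw [← cls_rep m]; exact cls_eq_cls.2 h⟩

/-- Every subterm over `S` is named by a variable. Congruence passes from the arguments to their
names, and the value of a function symbol was chosen as such a name. For the converse, `v` is
compared with some name of `t`. -/
theorem realize_cls (hH : IsHenkin S H) {t : L.Term ℕ} (ht : TermOver S t) {v : ℕ} :
    cls H v = t.realize (cls H) ↔ Derives H (eq (Term.var v) t) := by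
  have key : ∀ v, Derives H (eq (Term.var v) t) → cls H v = t.realize (cls H) := by
    induction t with
    | var i => exact fun v h => cls_eq_cls.2 h
    | @func n f ts ih =>
      intro v h
      choose y _ hy using fun i => hH.exists_eq (ht.2 i) 0
      have e : ∀ i, (ts i).realize (cls H) = cls H (y i) := fun i => (ih i (ht.2 i) _ (hy i)).symm
      simp only [Term.realize_func, e, funMap]
      have hf : TermOver S (Term.func f fun i => Term.var (rep (cls H (y i)))) :=
        ⟨ht.1, fun _ => trivial⟩
      have hex : ∃ z, Derives H (eq (Term.var z)
        (Term.func f fun i => Term.var (rep (cls H (y i))))) := by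
        obtain ⟨z, _, hz⟩ := hH.exists_eq hf 0
        exact ⟨z, hz⟩
      refine cls_eq_cls.2 (h.eq_trans (.eq_trans (.func_congr fun i => ?_)
        (Classical.epsilon_spec hex).eq_symm))
      exact (hy i).eq_symm.eq_trans (cls_eq_cls.1 (cls_rep _).symm)
  refine ⟨fun h => ?_, key v⟩
  obtain ⟨y, _, hy⟩ := hH.exists_eq ht 0
  have := key y hy
  exact (cls_eq_cls.1 (h.trans this.symm)).eq_trans hy

theorem derives_ex (hH : IsHenkin S H) {x : ℕ} {B : Fml L} (hB : Over S B)
    (h : Derives H (ex x B)) :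
    ∃ y, y ∉ B.vars ∧ Derives H (B.subst (single x (Term.var y))) :=
  (hH.wit x B hB (hH.mem_of_derives (A := ex x B) hB h)).imp fun _ h => ⟨h.1, .assumption h.2⟩

theorem FOSat_update_cls {x y : ℕ} {B : Fml L} (hy : y ∉ B.vars) :
    FOSat B (Function.update (cls H) x (cls H y)) ↔
      FOSat (B.subst (single x (Term.var y))) (cls H) := by
  rw [FOSat_subst (substOK_single_var hy), realize_single]
  rfl

theorem over_rename {x y : ℕ} {B : Fml L} (hB : Over S B) :
    Over S (B.subst (single x (Term.var y))) :=
  hB.subst fun i => by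
    by_cases h : i = x
    · subst h; simp [single, TermOver]
    · simp [single, h, TermOver]

/-- Since terms have names beyond every bound, each element is the class of arbitrarily large
variables; one that does not appear in a given formula can be substituted there without capture. -/
theorem exists_cls_notMem (hH : IsHenkin S H) (m : HenkinModel H) (V : Finset ℕ) :
    ∃ y, y ∉ V ∧ cls H y = m := by
  obtain ⟨y, hy, h⟩ := hH.exists_cls m (V.sup id + 1)
  refine ⟨y, fun hyV => ?_, h⟩
  have := Finset.le_sup (f := id) hyV
  simp only [id] at this
  omega

/-- Truth in the term model is derivability. -/
theorem FOSat_cls (hH : IsHenkin S H) {A : Fml L} (hA : Over S A) :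
    FOSat A (cls H) ↔ Derives H A := by
  -- The quantifier cases pass to substitution instances of the body, which have its size but are
  -- not subformulas.
  induction hn : size A using Nat.strong_induction_on generalizing A with
  | _ n IH =>
  cases A with
  | eq t s =>
    obtain ⟨y, _, hy⟩ := hH.exists_eq hA.1 0
    simp only [FOSat]
    rw [← (hH.realize_cls hA.1).2 hy, hH.realize_cls hA.2]
    exact ⟨fun h => hy.eq_symm.eq_trans h, fun h => hy.eq_trans h⟩
  | rel R ts =>
    choose y _ hy using fun i => hH.exists_eq (hA.2 i) 0
    have e : ∀ i, (ts i).realize (cls H) = cls H (y i) := fun i =>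
      ((hH.realize_cls (hA.2 i)).2 (hy i)).symm
    simp only [FOSat, e, RelMap]
    have h1 : ∀ i, Derives H (eq (Term.var (rep (cls H (y i)))) (ts i)) := fun i =>
      (cls_eq_cls.1 (cls_rep _)).eq_trans (hy i)
    exact ⟨fun h => h.rel_congr h1, fun h => h.rel_congr fun i => (h1 i).eq_symm⟩
  | dep ts => exact hA.elim
  | neg A =>
    replace hA : Over S A := hA
    simp only [size] at hn
    rw [hH.derives_neg hA, ← IH (size A) (by omega) hA rfl]
    rfl
  | and A B =>
    simp only [size] at hn
    simp only [FOSat, IH (size A) (by omega) hA.1 rfl, IH (size B) (by omega) hA.2 rfl]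
    exact ⟨fun h => .andI h.1 h.2, fun h => ⟨.andE₁ h, .andE₂ h⟩⟩
  | or A B =>
    simp only [size] at hn
    simp only [FOSat, IH (size A) (by omega) hA.1 rfl, IH (size B) (by omega) hA.2 rfl]
    constructor
    · rintro (h | h)
      exacts [.orI₁ hA.2.isFO.isD h, .orI₂ hA.1.isFO.isD h]
    · intro h
      by_contra! hcon
      have h1 := (hH.derives_neg hA.1).2 hcon.1
      have h2 := (hH.derives_neg hA.2).2 hcon.2
      exact hH.con (.orE (C := falsum) trivial h
        (.contra hA.1.isFO (.assumption (Set.mem_insert _ _)) (h1.weaken (Set.subset_insert _ _)))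
        (.contra hA.2.isFO (.assumption (Set.mem_insert _ _)) (h2.weaken (Set.subset_insert _ _))))
  | ex x B =>
    replace hA : Over S B := hA
    simp only [size] at hn
    constructor
    · rintro ⟨m, hm⟩
      obtain ⟨y, hy, rfl⟩ := hH.exists_cls_notMem m B.vars
      rw [FOSat_update_cls hy, IH _ (by rw [size_subst]; omega) (over_rename hA) rfl] at hm
      exact .exI _ (substOK_single_var hy) hm
    · intro h
      obtain ⟨y, hy, h⟩ := hH.derives_ex hA h
      refine ⟨cls H y, ?_⟩
      rwa [FOSat_update_cls hy, IH _ (by rw [size_subst]; omega) (over_rename hA) rfl]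
  | all x B =>
    replace hA : Over S B := hA
    simp only [size] at hn
    constructor
    · intro h
      by_contra hcon
      have hcon := hH.mem_of_derives (A := neg (all x B)) hA
        ((hH.derives_neg (A := all x B) hA).2 hcon)
      have := ((Derives.self (A := neg (all x B))).ex_neg_of_neg_all (Set.finite_singleton _)
        hA.isFO).weaken (Γ' := H) (by simpa using hcon)
      obtain ⟨y, hy, h'⟩ := hH.derives_ex (B := neg B) hA this
      replace hy : y ∉ B.vars := hy
      have h'' := h (cls H y)
      rw [FOSat_update_cls hy, IH _ (by rw [size_subst]; omega) (over_rename hA) rfl] at h''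
      exact (hH.derives_neg (over_rename hA)).1 h' h''
    · intro h m
      obtain ⟨y, hy, rfl⟩ := hH.exists_cls_notMem m B.vars
      rw [FOSat_update_cls hy, IH _ (by rw [size_subst]; omega) (over_rename hA) rfl]
      exact .allE _ (substOK_single_var hy) h

end IsHenkin

end HenkinModel

end DepLogic

/-! ### Normal sentences and iterated dependence elimination. -/

namespace DepLogic

open FirstOrder.Language (Term)
open FirstOrder.Language.Structure (RelMap funMap)
open Fml

variable {L : FirstOrder.Language.{u, v}}

/-- The data of a sentence `∀x⃗ ∃y⃗ (⋀ =(w⃗, y) ∧ C)` in normal form. -/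
structure NormalSentence (L : FirstOrder.Language.{u, v}) where
  xs : List ℕ
  l : List (List ℕ × ℕ)
  C : Fml L
  nodup : (xs ++ l.map Prod.snd).Nodup
  isFO : C.IsFO
  isQF : C.IsQF
  fv_subset : ∀ i ∈ C.fv, i ∈ xs ++ l.map Prod.snd
  dep_subset : ∀ d ∈ l, ∃ (p : ℕ) (hp : p < (l.map Prod.snd).length), d.2 = (l.map Prod.snd)[p] ∧
    ∀ x ∈ d.1, x ∈ xs ++ (l.map Prod.snd).take p

namespace NormalSentence

variable (N : NormalSentence L)

/-- The existentially quantified variables. -/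
def ys : List ℕ := N.l.map Prod.snd

/-- All variables. -/
def zs : List ℕ := N.xs ++ N.ys

/-- The sentence itself. -/
def toFml : Fml L := alls N.xs (depBlock N.l N.C)

/-- The renamed dependence atoms. -/
def deps (ρ : ℕ → ℕ) : Fml L := bigAnd (N.l.map fun d => depVar (d.1.map ρ, ρ d.2))

/-- The formula saying that two tuples of values conform to the same functions. -/
def link (ρ₁ ρ₂ : ℕ → ℕ) : Fml L :=
  bigAnd (N.l.map fun d => imp (bigAnd (d.1.map fun x => varEq (ρ₁ x) (ρ₂ x)))
    (varEq (ρ₁ d.2) (ρ₂ d.2)))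

/-- The renamed matrix, together with the links to earlier tuples. -/
def matrix (ρ : ℕ → ℕ) (P : List (ℕ → ℕ)) : Fml L :=
  and (N.deps ρ) (bigAnd (N.C.subst (fun x => Term.var (ρ x)) :: P.map fun ρ₁ => N.link ρ₁ ρ))

/-- The renamed sentence, with the functions restricted by earlier tuples. -/
def theta (ρ : ℕ → ℕ) (P : List (ℕ → ℕ)) : Fml L :=
  alls (N.xs.map ρ) (exs (N.ys.map ρ) (N.matrix ρ P))

variable {N}

theorem mem_zs_of_dep {d : List ℕ × ℕ} (hd : d ∈ N.l) : d.2 ∈ N.zs ∧ ∀ i ∈ d.1, i ∈ N.zs := by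
  obtain ⟨p, hp, h, h'⟩ := N.dep_subset d hd
  refine ⟨List.mem_append_right _ (List.mem_map_of_mem hd), fun i hi => ?_⟩
  rcases List.mem_append.1 (h' i hi) with h | h
  · exact List.mem_append_left _ h
  · exact List.mem_append_right _ (List.mem_of_mem_take h)

theorem subst_depVar (d : List ℕ × ℕ) (τ : ℕ → ℕ) :
    (depVar d : Fml L).subst (fun i => Term.var (τ i)) = depVar (d.1.map τ, τ d.2) := by
  simp [depVar, subst, Term.subst, Function.comp_def]

theorem subst_deps (ρ τ : ℕ → ℕ) :
    (N.deps ρ).subst (fun i => Term.var (τ i)) = N.deps (τ ∘ ρ) := by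
  simp only [deps, subst_bigAnd, List.map_map, Function.comp_def, subst_depVar]

theorem subst_varEq (x y : ℕ) (τ : ℕ → ℕ) :
    (varEq x y : Fml L).subst (fun i => Term.var (τ i)) = varEq (τ x) (τ y) := rfl

theorem subst_link {ρ₁ ρ₂ τ : ℕ → ℕ} (h : ∀ x ∈ N.zs, τ (ρ₁ x) = ρ₁ x) :
    (N.link ρ₁ ρ₂).subst (fun i => Term.var (τ i)) = N.link ρ₁ (τ ∘ ρ₂) := by
  simp only [link, subst_bigAnd, List.map_map]
  congr 1
  refine List.map_congr_left fun d hd => ?_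
  have hd' := mem_zs_of_dep hd
  simp only [Function.comp_apply, imp, subst, subst_bigAnd, subst_varEq, List.map_map, h _ hd'.1]
  congr 3
  refine List.map_congr_left fun x hx => ?_
  simp only [Function.comp_apply, subst_varEq, h _ (hd'.2 x hx)]

/-- A renaming that fixes the earlier tuples moves only the current end of each link. -/
theorem subst_matrix {ρ τ : ℕ → ℕ} {P : List (ℕ → ℕ)}
    (h : ∀ ρ' ∈ P, ∀ x ∈ N.zs, τ (ρ' x) = ρ' x) :
    (N.matrix ρ P).subst (fun i => Term.var (τ i)) = N.matrix (τ ∘ ρ) P := by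
  simp only [matrix, subst, subst_deps, subst_bigAnd, List.map_cons, List.map_map]
  rw [subst_subst_of_isQF N.isQF]
  congr 3
  exact List.map_congr_left fun ρ₁ hρ₁ => subst_link (h ρ₁ hρ₁)

/-- Dependence elimination in iterated form. -/
theorem derives_theta {ρ : ℕ → ℕ} {P : List (ℕ → ℕ)} (hρ : (N.zs.map ρ).Nodup)
    (hP : ∀ ρ' ∈ P, ∀ x ∈ N.zs, ∀ y ∈ N.zs, ρ' x ≠ ρ y) (V : Finset ℕ) :
    ∃ ρ' : ℕ → ℕ, (N.zs.map ρ').Nodup ∧ (∀ x ∈ N.zs, ρ' x ∉ V) ∧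
      (∀ x ∈ N.zs, ∀ y ∈ N.zs, ρ x ≠ ρ' y) ∧
      Derives {N.theta ρ P} (alls (N.xs.map ρ) (exs (N.ys.map ρ)
        (and (N.matrix ρ P) (N.theta ρ' (ρ :: P))))) := by
  classical
  obtain ⟨K, hK⟩ : ∃ K, ∀ i ∈ V ∪ (N.zs.map ρ).toFinset ∪ (N.matrix ρ P).vars, i < K :=
    ⟨(V ∪ (N.zs.map ρ).toFinset ∪ (N.matrix ρ P).vars).sup id + 1, fun i hi =>
      Nat.lt_succ_of_le (Finset.le_sup (f := id) hi)⟩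
  have hKV : ∀ i, i + K ∉ V := fun i hi => by
    have := hK (i + K) (by simp [hi]); omega
  have hKρ : ∀ i, i + K ∉ N.zs.map ρ := fun i hi => by
    have := hK (i + K) (by
      simp only [Finset.mem_union, List.mem_toFinset]; exact Or.inl (Or.inr hi))
    omega
  have hKB : ∀ i, i + K ∉ (N.matrix ρ P).vars := fun i hi => by
    have := hK (i + K) (by simp [hi]); omega
  -- `K` exceeds every variable in play, so the shifted tuple is new and disjoint from the current
  -- one.
  let τ : ℕ → ℕ := fun i => if i ∈ N.zs.map ρ then i + K else i
  have hτ : ∀ x ∈ N.zs, τ (ρ x) = ρ x + K := fun x hx => if_pos (List.mem_map_of_mem hx)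
  have hτ' : ∀ ρ' ∈ P, ∀ x ∈ N.zs, τ (ρ' x) = ρ' x := fun ρ' hρ' x hx => if_neg fun h => by
    obtain ⟨y, hy, h⟩ := List.mem_map.1 h
    exact hP ρ' hρ' x hx y hy h.symm
  have hzs : N.xs.map ρ ++ N.ys.map ρ = N.zs.map ρ := by simp [zs]
  have hnd : ((N.zs.map ρ).map τ).Nodup := by
    rw [List.nodup_map_iff_inj_on hρ]
    intro a ha b hb hab
    simp only [τ, if_pos ha, if_pos hb] at hab
    omega
  refine ⟨τ ∘ ρ, by rwa [← List.map_map], fun x hx => ?_, fun x hx y hy h => ?_, ?_⟩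
  · simp only [Function.comp_apply, hτ x hx]; exact hKV _
  · simp only [Function.comp_apply, hτ y hy] at h
    exact hKρ (ρ y) (h ▸ List.mem_map_of_mem hx)
  have hdeps : N.deps ρ = bigAnd ((N.l.map fun d => (d.1.map ρ, ρ d.2)).map depVar) := by
    simp [deps, Function.comp_def]
  -- The dependence atoms are duplicated. One copy is the prefix that the rule consumes; the other
  -- is part of the matrix `B`, so it returns in renamed form in the conclusion, and the rule can be
  -- applied again.
  have h1 : Derives {N.theta ρ P} (depElimPrem (N.xs.map ρ) (N.ys.map ρ)
      (N.l.map fun d => (d.1.map ρ, ρ d.2)) (N.matrix ρ P)) := by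
    refine .alls_mono (.exs_mono (.andI ?_ .self))
    rw [← hdeps]
    exact .andE₁ .self
  have h2 := Derives.depE τ (by
      rw [List.append_assoc, ← List.map_append (f := τ), hzs, List.nodup_append]
      refine ⟨hρ, hnd, fun a ha b hb => ?_⟩
      obtain ⟨c, hc, rfl⟩ := List.mem_map.1 hb
      rintro rfl
      simp only [τ, if_pos hc] at ha
      exact hKρ _ ha) (by
      intro x hx
      rw [hzs] at hx
      exact if_neg hx) (by
      intro x hx
      rw [hzs] at hx
      simp only [τ, if_pos hx]
      exact hKB x) (by
      intro d hd
      obtain ⟨d, hd', rfl⟩ := List.mem_map.1 hd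
      obtain ⟨p, hp, h, h'⟩ := N.dep_subset d hd'
      refine ⟨p, by simpa [ys] using hp, by simp [ys, h], fun x hx => ?_⟩
      obtain ⟨x, hx', rfl⟩ := List.mem_map.1 hx
      rw [← List.map_take, ← List.map_append]
      exact List.mem_map_of_mem (h' x hx')) h1
  refine h2.trans (.alls_mono (.exs_mono (.andI (.andE₁ .self)
    (.of_singleton (Set.finite_singleton _) (.andE₂ .self) ?_))))
  rw [subst_matrix hτ', theta, List.map_map, List.map_map]
  refine .alls_mono (.exs_mono ?_)
  have hm : Derives {and (N.matrix (τ ∘ ρ) P) (bigAnd (((depElimS (N.xs.map ρ) (N.ys.map ρ)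
      (N.l.map fun d => (d.1.map ρ, ρ d.2)))).map fun d =>
        imp (bigAnd (d.1.map fun x => varEq x (τ x))) (varEq d.2 (τ d.2))))}
      (N.matrix (τ ∘ ρ) P) := .andE₁ .self
  refine .andI (.andE₁ hm) (Derives.bigAnd_iff.2 fun A hA => ?_)
  have hm' := Derives.bigAnd_iff.1 (Derives.andE₂ hm)
  simp only [List.map_cons, List.mem_cons] at hA
  -- The matrix `C` and the links to earlier tuples come from the renamed matrix; the link to `ρ`
  -- comes from the implications supplied by the rule.
  rcases hA with rfl | rfl | hA
  · exact hm' _ List.mem_cons_self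
  · refine Derives.bigAnd_iff.2 fun A hA => ?_
    obtain ⟨d, hd, rfl⟩ := List.mem_map.1 hA
    refine Derives.bigAnd_iff.1 (Derives.andE₂ .self) _ (List.mem_map.2
      ⟨(d.1.map ρ, ρ d.2), List.mem_append_left _ (List.mem_map.2 ⟨d, hd, rfl⟩), ?_⟩)
    simp [List.map_map, Function.comp_def]
  · exact hm' _ (List.mem_cons_of_mem _ hA)

end NormalSentence

end DepLogic

/-! ### Stages of the construction. -/

namespace DepLogic

open FirstOrder.Language (Term)
open FirstOrder.Language.Structure (RelMap funMap)
open Fml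

variable {L : FirstOrder.Language.{u, v}}

/-- `∃x (x = t)` is derivable, so a new name for `t` may be assumed at no cost. -/
theorem Derives.of_eq_fresh {Γ : Set (Fml L)} {B : Fml L} {x : ℕ} {t : L.Term ℕ}
    (hΓ : ∀ A ∈ Γ, x ∉ A.fv) (hB : x ∉ B.fv) (ht : x ∉ t.varFinset)
    (h : Derives (insert (eq (Term.var x) t) Γ) B) : Derives Γ B := by
  refine .exE subset_rfl hΓ hB (.exI (A := eq (Term.var x) t) t trivial ?_) h
  have : t.subst (single x t) = t := by
    conv_rhs => rw [← term_subst_var t]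
    refine term_subst_congr fun i hi => ?_
    rw [single, Function.update_of_ne]
    rintro rfl
    exact ht hi
  simp only [subst, Term.subst, this]
  simp only [single, Function.update_self]
  exact .eqRefl t

/-- The names are introduced one at a time: the equations already assumed do not mention the names
still to come, which are distinct from the other names and from all the `a y`. -/
theorem Derives.of_eqs_fresh {Γ : Set (Fml L)} {B : Fml L} {ρ a : ℕ → ℕ} (xs : List ℕ)
    (hn : (xs.map ρ).Nodup) (hΓ : ∀ A ∈ Γ, ∀ x ∈ xs, ρ x ∉ A.fv) (hB : ∀ x ∈ xs, ρ x ∉ B.fv)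
    (ha : ∀ x ∈ xs, ∀ y ∈ xs, ρ x ≠ a y)
    (h : Derives (Γ ∪ {A | ∃ x ∈ xs, A = varEq (ρ x) (a x)}) B) : Derives Γ B := by
  induction xs generalizing Γ with
  | nil => simpa using h
  | cons x xs ih =>
    simp only [List.map_cons, List.nodup_cons] at hn
    refine of_eq_fresh (x := ρ x) (t := Term.var (a x))
      (fun A hA => hΓ A hA x List.mem_cons_self) (hB x List.mem_cons_self) ?_ (ih hn.2 ?_ ?_ ?_ ?_)
    · simpa [Term.varFinset] using ha x List.mem_cons_self x List.mem_cons_self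
    · rintro A (rfl | hA) y hy
      · simp only [fv, Term.varFinset, Finset.mem_union, Finset.mem_singleton, not_or]
        refine ⟨fun h => hn.1 (h ▸ List.mem_map_of_mem hy),
          ha y (List.mem_cons_of_mem _ hy) x List.mem_cons_self⟩
      · exact hΓ A hA y (List.mem_cons_of_mem _ hy)
    · exact fun y hy => hB y (List.mem_cons_of_mem _ hy)
    · exact fun y hy z hz => ha y (List.mem_cons_of_mem _ hy) z (List.mem_cons_of_mem _ hz)
    · refine h.weaken ?_
      rintro A (hA | ⟨y, hy, rfl⟩)
      · exact Or.inl (Or.inr hA)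
      · rcases List.mem_cons.1 hy with rfl | hy
        · exact Or.inl (Or.inl rfl)
        · exact Or.inr ⟨y, hy, rfl⟩

/-- A finite consistent set of formulas, with the tuples of values chosen so far for the
functions of the normal sentence `N`. -/
structure Stage (N : NormalSentence L) where
  Δ : Set (Fml L)
  ρ : ℕ → ℕ
  P : List (ℕ → ℕ)
  finite : Δ.Finite
  con : ¬ Derives Δ falsum
  theta_mem : N.theta ρ P ∈ Δ
  nodup : (N.zs.map ρ).Nodup
  disj : ∀ ρ' ∈ P, ∀ x ∈ N.zs, ∀ y ∈ N.zs, ρ' x ≠ ρ y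
  fresh : ∀ A ∈ Δ, ∀ x ∈ N.zs, ρ x ∉ A.fv
  matrix : ∀ ρ' ∈ P, Derives Δ (N.C.subst fun x => Term.var (ρ' x))
  link : ∀ ρ₁ ∈ P, ∀ ρ₂ ∈ P, ρ₁ = ρ₂ ∨ Derives Δ (N.link ρ₁ ρ₂) ∨ Derives Δ (N.link ρ₂ ρ₁)

namespace Stage

variable {N : NormalSentence L}

instance : LE (Stage N) := ⟨fun S S' => S.Δ ⊆ S'.Δ ∧ S.P ⊆ S'.P⟩

theorem le_refl (S : Stage N) : S ≤ S := ⟨subset_rfl, List.Subset.refl _⟩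

theorem le_trans {S₁ S₂ S₃ : Stage N} (h₁ : S₁ ≤ S₂) (h₂ : S₂ ≤ S₃) : S₁ ≤ S₃ :=
  ⟨h₁.1.trans h₂.1, List.Subset.trans h₁.2 h₂.2⟩

/-- Adjoin a formula. -/
def adjoin (S : Stage N) (A : Fml L) (hA : ¬ Derives (insert A S.Δ) falsum)
    (hf : ∀ x ∈ N.zs, S.ρ x ∉ A.fv) : Stage N where
  Δ := insert A S.Δ
  ρ := S.ρ
  P := S.P
  finite := S.finite.insert _
  con := hA
  theta_mem := Or.inr S.theta_mem
  nodup := S.nodup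
  disj := S.disj
  fresh := by
    rintro B (rfl | hB)
    · exact hf
    · exact S.fresh B hB
  matrix ρ' h := (S.matrix ρ' h).weaken (Set.subset_insert _ _)
  link ρ₁ h₁ ρ₂ h₂ := (S.link ρ₁ h₁ ρ₂ h₂).imp_right (Or.imp
    (fun h => h.weaken (Set.subset_insert _ _)) (fun h => h.weaken (Set.subset_insert _ _)))

theorem le_adjoin (S : Stage N) {A : Fml L} (hA : ¬ Derives (insert A S.Δ) falsum)
    (hf : ∀ x ∈ N.zs, S.ρ x ∉ A.fv) : S ≤ S.adjoin A hA hf :=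
  ⟨Set.subset_insert _ _, List.Subset.refl _⟩

theorem fv_falsum : (falsum : Fml L).fv = ∅ := fv_top

/-- The current tuple of variables becomes a tuple of constants, subject to the constraints `E`,
and a new one, that avoids `V`, takes its place. -/
theorem exists_play (S : Stage N) {E : Set (Fml L)} (hE : E.Finite)
    (hcon : ¬ Derives (S.Δ ∪ E) falsum) (hEy : ∀ A ∈ E, ∀ y ∈ N.ys, S.ρ y ∉ A.fv)
    (V : Finset ℕ) :
    ∃ S' : Stage N, S ≤ S' ∧ E ⊆ S'.Δ ∧ S.ρ ∈ S'.P ∧ ∀ x ∈ N.zs, S'.ρ x ∉ V := by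
  classical
  have hfin : (S.Δ ∪ E).Finite := S.finite.union hE
  obtain ⟨ρ', hnd, hV, hρρ', hd⟩ := N.derives_theta S.nodup S.disj
    (V ∪ hfin.toFinset.biUnion vars ∪ (N.matrix S.ρ S.P).vars ∪
      S.P.toFinset.biUnion fun σ => (N.zs.map σ).toFinset)
  simp only [Finset.mem_union, Finset.mem_biUnion, Set.Finite.mem_toFinset, List.mem_toFinset,
    not_or, not_exists, not_and] at hV
  have hsub : S.Δ ∪ E ⊆ insert (N.matrix S.ρ S.P) (insert (N.theta ρ' (S.ρ :: S.P)) (S.Δ ∪ E)) :=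
    (Set.subset_insert _ _).trans (Set.subset_insert _ _)
  have hm : Derives (insert (N.matrix S.ρ S.P) (insert (N.theta ρ' (S.ρ :: S.P)) (S.Δ ∪ E)))
      (N.matrix S.ρ S.P) := .assumption (Set.mem_insert _ _)
  have hm' := Derives.bigAnd_iff.1 (Derives.andE₂ hm)
  refine ⟨{
    Δ := insert (N.matrix S.ρ S.P) (insert (N.theta ρ' (S.ρ :: S.P)) (S.Δ ∪ E))
    ρ := ρ'
    P := S.ρ :: S.P
    finite := (hfin.insert _).insert _
    con := fun h => hcon ?_
    theta_mem := Or.inr (Or.inl rfl)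
    nodup := hnd
    disj := ?_
    fresh := ?_
    matrix := ?_
    link := ?_ }, ⟨Set.subset_union_left.trans hsub, List.subset_cons_self _ _⟩,
    Set.subset_union_right.trans hsub, List.mem_cons_self, fun x hx => (hV x hx).1.1.1⟩
  -- The universal quantifiers are stripped without substituting anything: their variables become
  -- constants, and `E` says what these stand for. The `y⃗` are free neither in `Δ` nor in `E`, so
  -- ∃-elimination makes constants of them too.
  · have h1 : Derives (S.Δ ∪ E) (exs (N.ys.map S.ρ)
        (and (N.matrix S.ρ S.P) (N.theta ρ' (S.ρ :: S.P)))) :=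
      (Derives.of_singleton hfin (.assumption (Or.inl S.theta_mem)) hd).alls_elim
    refine Derives.exs_elim ?_ ?_ h1 ?_ hfin
    · rintro A (hA | hA) y hy
      · obtain ⟨y, hy', rfl⟩ := List.mem_map.1 hy
        exact S.fresh A hA y (List.mem_append_right _ hy')
      · obtain ⟨y, hy', rfl⟩ := List.mem_map.1 hy
        exact hEy A hA y hy'
    · simp [fv_falsum]
    · refine .cut (hfin.insert _) (A := N.theta ρ' (S.ρ :: S.P))
        (.andE₂ (.assumption (Set.mem_insert _ _))) (.cut ((hfin.insert _).insert _)
        (A := N.matrix S.ρ S.P) (.andE₁ (.assumption (Or.inr (Or.inl rfl)))) (h.weaken ?_))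
      refine Set.insert_subset_insert (Set.insert_subset_insert (Set.subset_insert _ _))
  · intro σ hσ x hx y hy
    rcases List.mem_cons.1 hσ with rfl | hσ
    · exact hρρ' x hx y hy
    · exact fun h => (hV y hy).2 σ hσ (h ▸ List.mem_map_of_mem hx)
  · rintro A (rfl | rfl | hA) x hx h
    · exact (hV x hx).1.2 (fv_subset_vars _ h)
    · rw [NormalSentence.theta, mem_fv_alls, mem_fv_exs] at h
      rcases List.mem_append.1 hx with hx | hx
      · exact h.2 (List.mem_map_of_mem hx)
      · exact h.1.2 (List.mem_map_of_mem hx)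
    · exact (hV x hx).1.1.2 A hA (fv_subset_vars _ h)
  · intro σ hσ
    rcases List.mem_cons.1 hσ with rfl | hσ
    · exact hm' _ List.mem_cons_self
    · exact (S.matrix σ hσ).weaken (Set.subset_union_left.trans hsub)
  · have hl : ∀ σ ∈ S.P, Derives (insert (N.matrix S.ρ S.P)
        (insert (N.theta ρ' (S.ρ :: S.P)) (S.Δ ∪ E))) (N.link σ S.ρ) := fun σ hσ =>
      hm' _ (List.mem_cons_of_mem _ (List.mem_map.2 ⟨σ, hσ, rfl⟩))
    intro σ₁ h₁ σ₂ h₂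
    rcases List.mem_cons.1 h₁ with rfl | h₁ <;> rcases List.mem_cons.1 h₂ with rfl | h₂
    · exact Or.inl rfl
    · exact Or.inr (Or.inr (hl _ h₂))
    · exact Or.inr (Or.inl (hl _ h₁))
    · have hs := Set.subset_union_left.trans hsub
      exact (S.link σ₁ h₁ σ₂ h₂).imp_right (Or.imp (fun h => h.weaken hs) (fun h => h.weaken hs))

/-- A play without constraints: the surplus tuple is harmless, and the current variables are moved
out of the way of `V`. -/
theorem exists_refresh (S : Stage N) (V : Finset ℕ) :
    ∃ S' : Stage N, S ≤ S' ∧ ∀ x ∈ N.zs, S'.ρ x ∉ V := by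
  obtain ⟨S₁, h, _, _, hV⟩ := S.exists_play Set.finite_empty (by simpa using S.con) (by simp) V
  exact ⟨S₁, h, hV⟩

/-- A variable that is new to the stage. -/
theorem exists_new (S : Stage N) (V : Finset ℕ) :
    ∃ y, y ∉ V ∧ (∀ A ∈ S.Δ, y ∉ A.fv) ∧ ∀ x ∈ N.zs, S.ρ x ≠ y := by
  obtain ⟨y, hy, h⟩ := exists_fresh_of_finite S.finite (V ∪ (N.zs.map S.ρ).toFinset)
  simp only [Finset.mem_union, List.mem_toFinset, not_or] at hy
  exact ⟨y, hy.1, fun A hA hyA => h A hA (fv_subset_vars A hyA),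
    fun x hx h => hy.2 (h ▸ List.mem_map_of_mem hx)⟩

/-- A formula may be adjoined only if the current tuple is not free in it, hence the refresh. If
adding `A` is inconsistent, `¬A` is derivable, and adding it keeps consistency. -/
theorem exists_decide (S : Stage N) {A : Fml L} (hA : A.IsFO) :
    ∃ S' : Stage N, S ≤ S' ∧ (A ∈ S'.Δ ∨ neg A ∈ S'.Δ) := by
  obtain ⟨S₁, h₁, hV⟩ := S.exists_refresh A.vars
  have hf : ∀ x ∈ N.zs, S₁.ρ x ∉ A.fv := fun x hx h => hV x hx (fv_subset_vars A h)
  by_cases hcon : Derives (insert A S₁.Δ) falsum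
  · refine ⟨S₁.adjoin (neg A) (fun h => S₁.con ?_) hf, le_trans h₁ (S₁.le_adjoin _ _),
      Or.inr (Set.mem_insert _ _)⟩
    exact .contra hA (.byContra hA h) (.negI' hA hcon)
  · exact ⟨S₁.adjoin A hcon hf, le_trans h₁ (S₁.le_adjoin _ _), Or.inl (Set.mem_insert _ _)⟩

/-- The bound variable is first renamed to a new `y`; a contradiction from the instance at `y` would
then yield one from the existential formula by ∃-elimination. -/
theorem exists_witness (S : Stage N) {x : ℕ} {B : Fml L} (hB : ex x B ∈ S.Δ) :
    ∃ S' : Stage N, S ≤ S' ∧ ∃ y, y ∉ B.vars ∧ B.subst (single x (Term.var y)) ∈ S'.Δ := by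
  obtain ⟨S₁, h₁, hV⟩ := S.exists_refresh B.vars
  obtain ⟨y, hyB, hyΔ, hyρ⟩ := S₁.exists_new B.vars
  have hf : ∀ z ∈ N.zs, S₁.ρ z ∉ (B.subst (single x (Term.var y))).fv := by
    intro z hz h
    obtain ⟨j, hj, hzj⟩ := mem_fv_subst h
    by_cases hjx : j = x
    · subst hjx
      simp only [single, Function.update_self, Term.varFinset, Finset.mem_singleton] at hzj
      exact hyρ z hz hzj
    · simp only [single, Function.update_of_ne hjx, Term.varFinset, Finset.mem_singleton] at hzj
      exact hV z hz (hzj ▸ fv_subset_vars B hj)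
  refine ⟨S₁.adjoin _ (fun h => S₁.con ?_) hf, le_trans h₁ (S₁.le_adjoin _ _), y, hyB,
    Set.mem_insert _ _⟩
  exact .exE subset_rfl hyΔ (by simp [fv_falsum])
    (.of_singleton S₁.finite (.assumption (h₁.1 hB)) (.ex_rename hyB)) h

theorem exists_term (S : Stage N) (t : L.Term ℕ) (k : ℕ) :
    ∃ S' : Stage N, S ≤ S' ∧ ∃ y, k ≤ y ∧ eq (Term.var y) t ∈ S'.Δ := by
  obtain ⟨S₁, h₁, hV⟩ := S.exists_refresh t.varFinset
  obtain ⟨y, hy, hyΔ, hyρ⟩ := S₁.exists_new (t.varFinset ∪ Finset.range k)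
  simp only [Finset.mem_union, Finset.mem_range, not_or, not_lt] at hy
  refine ⟨S₁.adjoin (eq (Term.var y) t) (fun h => S₁.con ?_) ?_, le_trans h₁ (S₁.le_adjoin _ _), y,
    hy.2, Set.mem_insert _ _⟩
  · exact .of_eq_fresh hyΔ (by simp [fv_falsum]) hy.1 h
  · intro x hx
    simp only [fv, Term.varFinset, Finset.mem_union, Finset.mem_singleton, not_or]
    exact ⟨hyρ x hx, hV x hx⟩

/-- The play is made under the constraints `ρ x = a x`, so that the functions become defined at the
arguments `a`. Consistency survives because the left-hand variables are new. -/
theorem exists_tuple (S : Stage N) (a : ℕ → ℕ) :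
    ∃ S' : Stage N, S ≤ S' ∧ ∃ ρ ∈ S'.P, ∀ x ∈ N.xs, varEq (ρ x) (a x) ∈ S'.Δ := by
  classical
  obtain ⟨S₁, h₁, hV⟩ := S.exists_refresh (N.xs.map a).toFinset
  have hV' : ∀ x ∈ N.zs, ∀ y ∈ N.xs, S₁.ρ x ≠ a y := fun x hx y hy h =>
    hV x hx (by rw [h, List.mem_toFinset]; exact List.mem_map_of_mem hy)
  have hmem : ∀ x ∈ N.xs, x ∈ N.zs := fun x hx => List.mem_append_left _ hx
  have hnd := S₁.nodup
  simp only [NormalSentence.zs, List.map_append] at hnd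
  have hfin : {A : Fml L | ∃ x ∈ N.xs, A = varEq (S₁.ρ x) (a x)}.Finite := by
    refine ((List.finite_toSet N.xs).image fun x => varEq (S₁.ρ x) (a x)).subset ?_
    rintro _ ⟨x, hx, rfl⟩
    exact ⟨x, hx, rfl⟩
  have hcon : ¬ Derives (S₁.Δ ∪ {A | ∃ x ∈ N.xs, A = varEq (S₁.ρ x) (a x)}) falsum := by
    intro h
    exact S₁.con (.of_eqs_fresh N.xs hnd.of_append_left
      (fun A hA x hx => S₁.fresh A hA x (hmem x hx)) (by simp [fv_falsum])
      (fun x hx y hy => hV' x (hmem x hx) y hy) h)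
  obtain ⟨S₂, h₂, hE, hρ, _⟩ := S₁.exists_play hfin hcon (by
    rintro _ ⟨x, hx, rfl⟩ y hy h
    simp only [varEq, fv, Term.varFinset, Finset.mem_union, Finset.mem_singleton] at h
    rcases h with h | h
    · exact List.disjoint_of_nodup_append hnd (List.mem_map_of_mem hx)
        (h ▸ List.mem_map_of_mem hy)
    · exact hV' y (List.mem_append_right _ hy) x hx h) ∅
  exact ⟨S₂, le_trans h₁ h₂, S₁.ρ, hρ, fun x hx => hE ⟨x, hx, rfl⟩⟩

end Stage

end DepLogic

/-! ### A model of a consistent normal sentence. -/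

namespace DepLogic

open FirstOrder.Language (Term)
open FirstOrder.Language.Structure (RelMap funMap)
open Fml HenkinModel

variable {L : FirstOrder.Language.{u, v}} {N : NormalSentence L}

/-- Step `n` fulfils the `n`-th task of an enumeration; one visit is enough, since each task has to
be done at only one stage. -/
theorem Stage.exists_chain {Task : Type*} [Countable Task] (Done : Task → Stage N → Prop)
    (h : ∀ t S, ∃ S', S ≤ S' ∧ Done t S') (S₀ : Stage N) :
    ∃ f : ℕ → Stage N, f 0 = S₀ ∧ (∀ n m, n ≤ m → f n ≤ f m) ∧ ∀ t, ∃ n, Done t (f n) := by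
  rcases isEmpty_or_nonempty Task with hT | hT
  · exact ⟨fun _ => S₀, rfl, fun _ _ _ => le_refl _, fun t => hT.elim t⟩
  obtain ⟨g, hg⟩ := exists_surjective_nat Task
  choose F hF hD using h
  let f : ℕ → Stage N := fun n => Nat.rec S₀ (fun n S => F (g n) S) n
  refine ⟨f, rfl, fun n m hnm => ?_, fun t => ?_⟩
  · induction hnm with
    | refl => exact le_refl _
    | step _ ih => exact le_trans ih (hF _ _)
  · obtain ⟨n, rfl⟩ := hg t
    exact ⟨n + 1, hD _ _⟩

/-- With no earlier tuples the inner conjunction has the single member `C`, so `theta` is literally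
the sentence; this is where the construction starts. -/
theorem NormalSentence.theta_id : N.theta id [] = N.toFml := by
  simp only [theta, toFml, matrix, deps, depBlock, ys, List.map_id, List.map_nil, bigAnd, id]
  rw [show N.C.subst (fun x => Term.var x) = N.C from subst_var _]

theorem NormalSentence.over_link (S : Set L.Symbols) (ρ₁ ρ₂ : ℕ → ℕ) : Over S (N.link ρ₁ ρ₂) := by
  have key : ∀ As : List (Fml L), (∀ A ∈ As, Over S A) → Over S (bigAnd As) := by
    intro As
    induction As with
    | nil => exact fun _ => ⟨trivial, trivial⟩
    | cons B As ih =>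
      intro h
      by_cases hAs : As = []
      · subst hAs; exact h B List.mem_cons_self
      · rw [bigAnd_cons B hAs]
        exact ⟨h B List.mem_cons_self, ih fun A hA => h A (List.mem_cons_of_mem _ hA)⟩
  refine key _ fun A hA => ?_
  obtain ⟨d, _, rfl⟩ := List.mem_map.1 hA
  refine ⟨key _ fun A hA => ?_, ⟨trivial, trivial⟩⟩
  obtain ⟨x, _, rfl⟩ := List.mem_map.1 hA
  exact ⟨trivial, trivial⟩

theorem NormalSentence.FOSat_link {M : Type w} [L.Structure M] {ρ₁ ρ₂ : ℕ → ℕ} {e : ℕ → M} :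
    FOSat (N.link ρ₁ ρ₂) e ↔ ∀ d ∈ N.l, (∀ x ∈ d.1, e (ρ₁ x) = e (ρ₂ x)) →
      e (ρ₁ d.2) = e (ρ₂ d.2) := by
  simp only [link, FOSat_bigAnd, List.forall_mem_map, imp, FOSat, varEq, Term.realize_var]
  exact forall₂_congr fun d _ => imp_iff_not_or.symm

/-- A normal sentence that is consistent with finitely many first-order formulas has a model in
which these formulas are true. -/
theorem NormalSentence.exists_model (N : NormalSentence L) {Γ : Set (Fml L)} (hfin : Γ.Finite)
    (hFO : ∀ A ∈ Γ, A.IsFO) (hfv : ∀ A ∈ Γ, ∀ x ∈ N.zs, x ∉ A.fv)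
    (hcon : ¬ Derives (insert N.toFml Γ) falsum) :
    ∃ (M : Type (max u v)) (_ : L.Structure M) (e : ℕ → M),
      (∀ A ∈ Γ, FOSat A e) ∧ TSat N.toFml {e} := by
  classical
  obtain ⟨S, hS, hSC, hSΓ⟩ : ∃ S : Set L.Symbols, S.Countable ∧ Over S N.C ∧
      ∀ A ∈ Γ, Over S A := by
    obtain ⟨S, hS, hSC⟩ := exists_over N.isFO
    choose! S' hS' hSA using fun A (hA : A ∈ Γ) => exists_over (hFO A hA)
    refine ⟨S ∪ ⋃ A ∈ Γ, S' A, hS.union (hfin.countable.biUnion hS'),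
      hSC.mono Set.subset_union_left, fun A hA => (hSA A hA).mono ?_⟩
    exact (Set.subset_biUnion_of_mem hA).trans Set.subset_union_right
  have : Countable {A : Fml L // Over S A} := countable_over hS
  have : Countable {t : L.Term ℕ // TermOver S t} := countable_termOver hS
  let S₀ : Stage N := {
    Δ := insert N.toFml Γ
    ρ := id
    P := []
    finite := hfin.insert _
    con := hcon
    theta_mem := Or.inl N.theta_id
    nodup := by simpa [zs, ys] using N.nodup
    disj := by simp
    fresh := by
      rintro A (rfl | hA) x hx h
      · rw [toFml, mem_fv_alls, depBlock, mem_fv_exs] at h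
        rcases List.mem_append.1 hx with hx | hx
        · exact h.2 hx
        · exact h.1.2 hx
      · exact hfv A hA x hx h
    matrix := by simp
    link := by simp }
  -- Three kinds of task: decide a formula and, if it is existential and accepted, give a witness at
  -- the same stage; name a term beyond a bound; play a tuple at prescribed arguments. Restricting
  -- arguments to the finite set `N.xs.toFinset` keeps the tasks countable.
  let Task := {A : Fml L // Over S A} ⊕ ({t : L.Term ℕ // TermOver S t} × ℕ) ⊕
    (N.xs.toFinset → ℕ)
  let Done : Task → Stage N → Prop := fun t T => match t with
    | .inl A => (A.1 ∈ T.Δ ∨ neg A.1 ∈ T.Δ) ∧ ∀ x B, A.1 = ex x B → ex x B ∈ T.Δ →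
        ∃ y, y ∉ B.vars ∧ B.subst (single x (Term.var y)) ∈ T.Δ
    | .inr (.inl t) => ∃ y, t.2 ≤ y ∧ eq (Term.var y) t.1.1 ∈ T.Δ
    | .inr (.inr a) => ∃ ρ ∈ T.P, ∀ x (hx : x ∈ N.xs),
        varEq (ρ x) (a ⟨x, List.mem_toFinset.2 hx⟩) ∈ T.Δ
  have hDone : ∀ t T, ∃ T', T ≤ T' ∧ Done t T' := by
    rintro (A | t | a) T
    · obtain ⟨T₁, h₁, hA⟩ := T.exists_decide A.2.isFO
      by_cases hex : ∃ x B, A.1 = ex x B ∧ ex x B ∈ T₁.Δ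
      · obtain ⟨x, B, hAB, hB⟩ := hex
        obtain ⟨T₂, h₂, hy⟩ := T₁.exists_witness hB
        refine ⟨T₂, Stage.le_trans h₁ h₂, hA.imp (fun h => h₂.1 h) (fun h => h₂.1 h), ?_⟩
        intro x' B' h' _
        rw [hAB] at h'
        cases h'
        exact hy
      · exact ⟨T₁, h₁, hA, fun x B h h' => absurd ⟨x, B, h, h'⟩ hex⟩
    · exact T.exists_term t.1.1 t.2
    · obtain ⟨T₁, h₁, ρ, hρ, h⟩ := T.exists_tuple
        fun x => if hx : x ∈ N.xs then a ⟨x, List.mem_toFinset.2 hx⟩ else 0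
      refine ⟨T₁, h₁, ρ, hρ, fun x hx => ?_⟩
      have := h x hx
      rwa [dif_pos hx] at this
  obtain ⟨f, hf0, hmono, hf⟩ := Stage.exists_chain Done hDone S₀
  let H : Set (Fml L) := ⋃ n, (f n).Δ
  have hsub : ∀ n, (f n).Δ ⊆ H := fun n => Set.subset_iUnion (fun n => (f n).Δ) n
  have hHcon : ¬ Derives H falsum := by
    intro h
    obtain ⟨Γ₀, h₁, h₂, h₃⟩ := h.exists_finite
    choose! n hn using fun A (hA : A ∈ Γ₀) => Set.mem_iUnion.1 (h₁ hA)
    refine (f (h₂.toFinset.sup n)).con (h₃.weaken fun A hA => ?_)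
    exact (hmono _ _ (Finset.le_sup (h₂.mem_toFinset.2 hA))).1 (hn A hA)
  have hH : IsHenkin S H := by
    refine ⟨hHcon, fun A hA => ?_, fun x B hB hm => ?_, fun t ht k => ?_⟩
    · obtain ⟨n, hn⟩ := hf (.inl ⟨A, hA⟩)
      exact hn.1.imp (fun h => hsub n h) (fun h => hsub n h)
    · obtain ⟨n, hn⟩ := hf (.inl ⟨ex x B, hB⟩)
      have hm' : ex x B ∈ (f n).Δ := hn.1.resolve_right fun h =>
        hHcon (.contra hB.isFO (.assumption hm) (.assumption (hsub n h)))
      obtain ⟨y, hy, h⟩ := hn.2 x B rfl hm'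
      exact ⟨y, hy, hsub n h⟩
    · obtain ⟨n, y, hy, h⟩ := hf (.inr (.inl (⟨t, ht⟩, k)))
      exact ⟨y, hy, hsub n h⟩
  refine ⟨HenkinModel H, inferInstance, cls H, fun A hA => ?_, ?_⟩
  · rw [hH.FOSat_cls (hSΓ A hA)]
    refine .assumption (hsub 0 ?_)
    rw [hf0]
    exact Or.inr hA
  rw [toFml, TSat_alls]
  -- The inner team consists of the tuples played at any stage. Two of them are linked at a common
  -- later stage, which gives the dependence atoms; the tuple tasks make every value of `x⃗` occur.
  refine ⟨{e | ∀ i ∉ N.xs, e i = cls H i}, (TSat_depBlock N.isFO).2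
    ⟨{e | ∃ n, ∃ ρ ∈ (f n).P, ∀ i ∈ N.zs, e i = cls H (ρ i)}, ?_, ?_, ?_⟩, ?_⟩
  · rintro d hd a ⟨n, ρ₁, h₁, ha⟩ b ⟨m, ρ₂, h₂, hb⟩ hab
    have hd' := mem_zs_of_dep hd
    rw [ha _ hd'.1, hb _ hd'.1]
    have hab' : ∀ i ∈ d.1, cls H (ρ₁ i) = cls H (ρ₂ i) := fun i hi => by
      rw [← ha _ (hd'.2 i hi), ← hb _ (hd'.2 i hi), hab i hi]
    have key : ∀ σ₁ σ₂, Derives (f (max n m)).Δ (N.link σ₁ σ₂) →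
        (∀ i ∈ d.1, cls H (σ₁ i) = cls H (σ₂ i)) → cls H (σ₁ d.2) = cls H (σ₂ d.2) := by
      intro σ₁ σ₂ h
      exact FOSat_link.1 ((hH.FOSat_cls (N.over_link S σ₁ σ₂)).2 (h.weaken (hsub _))) d hd
    rcases (f (max n m)).link ρ₁ ((hmono _ _ (le_max_left n m)).2 h₁) ρ₂
      ((hmono _ _ (le_max_right n m)).2 h₂) with h | h | h
    · rw [h]
    · exact key _ _ h hab'
    · exact (key _ _ h fun i hi => (hab' i hi).symm).symm
  · rintro e ⟨n, ρ, hρ, he⟩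
    have h := (hH.FOSat_cls (hSC.subst (σ := fun x => Term.var (ρ x)) fun _ => trivial)).2
      (((f n).matrix ρ hρ).weaken (hsub n))
    rw [FOSat_subst (substOK_of_isQF N.isQF _)] at h
    exact (FOSat_congr fun i hi => he i (N.fv_subset i hi)).2 h
  · intro e he
    obtain ⟨n, ρ, hρ, h⟩ := hf (.inr (.inr fun x => rep (e x)))
    refine ⟨fun i => if i ∈ N.ys then cls H (ρ i) else e i, ⟨n, ρ, hρ, fun i hi => ?_⟩,
      fun i hi => if_neg hi⟩
    by_cases hiy : i ∈ N.ys
    · exact if_pos hiy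
    · have hix : i ∈ N.xs := (List.mem_append.1 hi).resolve_right hiy
      simp only [if_neg hiy]
      rw [cls_eq_cls.2 (.assumption (hsub n (h i hix))), cls_rep]
  · rintro _ rfl e' he'
    exact he'

end DepLogic

/-! ### First-order completeness. -/

namespace DepLogic

open FirstOrder.Language (Term)
open Fml

variable {L : FirstOrder.Language.{u, v}}

/-- The normal sentence `∀x (x = x)`. -/
def trivialSentence (x : ℕ) : NormalSentence L where
  xs := [x]
  l := []
  C := varEq x x
  nodup := by simp
  isFO := trivial
  isQF := trivial
  fv_subset := by simp [varEq, fv, Term.varFinset]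
  dep_subset := by simp

theorem derives_trivialSentence (Γ : Set (Fml L)) (x : ℕ) :
    Derives Γ (trivialSentence x : NormalSentence L).toFml :=
  .allI (Set.empty_subset _) (by simp) (.andI .top (.eqRefl _))

/-- Completeness for first-order consequences of a first-order formula. -/
theorem derives_of_FOSat {A B : Fml L} (hA : A.IsFO) (hB : B.IsFO)
    (h : ∀ (M : Type (max u v)) [L.Structure M] (e : ℕ → M), FOSat A e → FOSat B e) :
    Derives {A} B := by
  by_contra hcon
  obtain ⟨x, hx⟩ := exists_fresh (A.fv ∪ B.fv)
  simp only [Finset.mem_union, not_or] at hx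
  have hfin : ({A, neg B} : Set (Fml L)).Finite := by simp
  -- Adjoining a derivable normal sentence costs nothing and reduces the construction to the
  -- ordinary Henkin argument for `A` and `¬B`.
  obtain ⟨M, _, e, he, _⟩ := (trivialSentence x : NormalSentence L).exists_model hfin
    (by rintro _ (rfl | rfl); exacts [hA, hB])
    (by
      rintro _ (rfl | rfl) y hy <;>
      · simp only [NormalSentence.zs, NormalSentence.ys, trivialSentence, List.map_nil,
          List.append_nil, List.mem_singleton] at hy
        subst hy
        first | exact hx.1 | exact hx.2)
    (fun h' => hcon (.byContra hB ((Derives.cut hfin (derives_trivialSentence _ x) h').weaken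
      (by rw [Set.pair_comm]))))
  exact he (neg B) (by simp) (h M e (he A (by simp)))

/-! ### Negation normal form. -/

section NegationNormalForm

/-- Negation is applied only to quantifier-free first-order formulas. -/
def NegQF : Fml L → Prop
  | .eq _ _ | .rel _ _ | .dep _ => True
  | .neg A => A.IsFO ∧ A.IsQF
  | .and A B | .or A B => NegQF A ∧ NegQF B
  | .ex _ A | .all _ A => NegQF A

theorem NegQF.subst {A : Fml L} (hA : NegQF A) (σ : ℕ → L.Term ℕ) : NegQF (A.subst σ) := by
  induction A generalizing σ with
  | eq | rel | dep => trivial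
  | neg A ih => exact ⟨isFO_subst.2 hA.1, isQF_subst.2 hA.2⟩
  | and A B ihA ihB | or A B ihA ihB => exact ⟨ihA hA.1 _, ihB hA.2 _⟩
  | ex _ A ih | all _ A ih => exact ih hA _

/-- The negation normal form of a first-order formula (`b = true`) or of its negation. -/
def nnf : Bool → Fml L → Fml L
  | true, .eq t s => .eq t s
  | false, .eq t s => .neg (.eq t s)
  | true, .rel R ts => .rel R ts
  | false, .rel R ts => .neg (.rel R ts)
  | _, .dep ts => .dep ts
  | b, .neg A => nnf (!b) A
  | true, .and A B => .and (nnf true A) (nnf true B)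
  | false, .and A B => .or (nnf false A) (nnf false B)
  | true, .or A B => .or (nnf true A) (nnf true B)
  | false, .or A B => .and (nnf false A) (nnf false B)
  | true, .ex x A => .ex x (nnf true A)
  | false, .ex x A => .all x (nnf false A)
  | true, .all x A => .all x (nnf true A)
  | false, .all x A => .ex x (nnf false A)

theorem isFO_nnf {A : Fml L} (hA : A.IsFO) (b : Bool) : (nnf b A).IsFO := by
  induction A generalizing b with
  | eq | rel => cases b <;> trivial
  | dep => exact hA.elim
  | neg A ih => simp only [nnf]; exact ih hA _
  | and A B ihA ihB | or A B ihA ihB =>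
    cases b <;> simp only [nnf] <;> exact ⟨ihA hA.1 _, ihB hA.2 _⟩
  | ex _ A ih | all _ A ih => cases b <;> simp only [nnf] <;> exact ih hA _

theorem negQF_nnf {A : Fml L} (hA : A.IsFO) (b : Bool) : NegQF (nnf b A) := by
  induction A generalizing b with
  | eq | rel => cases b <;> simp [nnf, NegQF, IsFO, IsQF]
  | dep => exact hA.elim
  | neg A ih => simp only [nnf]; exact ih hA _
  | and A B ihA ihB | or A B ihA ihB =>
    cases b <;> simp only [nnf] <;> exact ⟨ihA hA.1 _, ihB hA.2 _⟩
  | ex _ A ih | all _ A ih => cases b <;> simp only [nnf] <;> exact ih hA _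

theorem fv_nnf (A : Fml L) (b : Bool) : (nnf b A).fv = A.fv := by
  induction A generalizing b with
  | eq | rel | dep => cases b <;> rfl
  | neg A ih => simp only [nnf, ih]; rfl
  | and A B ihA ihB | or A B ihA ihB => cases b <;> simp only [nnf, fv, ihA, ihB]
  | ex _ A ih | all _ A ih => cases b <;> simp only [nnf, fv, ih]

theorem FOSat_nnf {M : Type w} [L.Structure M] {A : Fml L} (hA : A.IsFO) (e : ℕ → M) :
    (FOSat (nnf true A) e ↔ FOSat A e) ∧ (FOSat (nnf false A) e ↔ ¬ FOSat A e) := by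
  induction A generalizing e with
  | eq | rel => simp [nnf, FOSat]
  | dep => exact hA.elim
  | neg A ih => simp [nnf, FOSat, ih hA e]
  | and A B ihA ihB => simp [nnf, FOSat, ihA hA.1 e, ihB hA.2 e]; tauto
  | or A B ihA ihB => simp [nnf, FOSat, ihA hA.1 e, ihB hA.2 e]
  | ex x A ih | all x A ih => simp [nnf, FOSat, fun e => ih hA e]

/-- Negated formulas are first-order, so there first-order completeness supplies the deduction; the
other connectives and the quantifiers are monotone. The semantic converse is kept in order to carry
a model of `B` back to `A`. -/
theorem exists_negQF {A : Fml L} (hA : A.IsD) : ∃ B : Fml L, NegQF B ∧ B.fv = A.fv ∧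
    Derives {A} B ∧ ∀ (M : Type (max u v)) [L.Structure M] (X : Set (ℕ → M)),
      TSat B X → TSat A X := by
  induction A with
  | eq | rel | dep =>
    refine ⟨_, ?_, rfl, .self, fun _ _ _ h => h⟩
    trivial
  | neg A ih =>
    refine ⟨nnf false A, negQF_nnf hA _, fv_nnf A _, derives_of_FOSat (A := neg A) hA
      (isFO_nnf hA _) fun M _ e h => (FOSat_nnf hA e).2.2 h, fun M _ X h e he => ?_⟩
    exact (FOSat_nnf hA e).2.1 ((TSat_iff_of_isFO (isFO_nnf hA _)).1 h e he)
  | and A B ihA ihB =>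
    obtain ⟨A', h₁, h₂, h₃, h₄⟩ := ihA hA.1
    obtain ⟨B', k₁, k₂, k₃, k₄⟩ := ihB hA.2
    exact ⟨and A' B', ⟨h₁, k₁⟩, by simp [fv, h₂, k₂],
      .andI (.of_singleton (Set.finite_singleton _) (.andE₁ .self) h₃)
        (.of_singleton (Set.finite_singleton _) (.andE₂ .self) k₃),
      fun M _ X h => ⟨h₄ M X h.1, k₄ M X h.2⟩⟩
  | or A B ihA ihB =>
    obtain ⟨A', h₁, h₂, h₃, h₄⟩ := ihA hA.1
    obtain ⟨B', k₁, k₂, k₃, k₄⟩ := ihB hA.2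
    exact ⟨or A' B', ⟨h₁, k₁⟩, by simp [fv, h₂, k₂], .or_mono h₃ k₃,
      fun M _ X ⟨Y, Z, h, hY, hZ⟩ => ⟨Y, Z, h, h₄ M Y hY, k₄ M Z hZ⟩⟩
  | ex x A ih =>
    obtain ⟨A', h₁, h₂, h₃, h₄⟩ := ih hA
    exact ⟨ex x A', h₁, by simp [fv, h₂], .ex_mono h₃, fun M _ X ⟨Y, hY, h⟩ => ⟨Y, h₄ M Y hY, h⟩⟩
  | all x A ih =>
    obtain ⟨A', h₁, h₂, h₃, h₄⟩ := ih hA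
    exact ⟨all x A', h₁, by simp [fv, h₂], .all_mono h₃,
      fun M _ X ⟨Y, hY, h⟩ => ⟨Y, h₄ M Y hY, h⟩⟩

end NegationNormalForm

/-! ### Normal forms of dependence logic formulas. -/

section NormalForm

/-- The variables in the tuples `z⃗` belong to `W` or precede the dependent variable. -/
def Scoped : Set ℕ → List (List ℕ × ℕ) → Prop
  | _, [] => True
  | W, d :: l => (∀ i ∈ d.1, i ∈ W) ∧ Scoped (insert d.2 W) l

theorem Scoped.mono {W W' : Set ℕ} {l : List (List ℕ × ℕ)} (h : Scoped W l) (hW : W ⊆ W') :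
    Scoped W' l := by
  induction l generalizing W W' with
  | nil => trivial
  | cons d l ih => exact ⟨fun i hi => hW (h.1 i hi), ih h.2 (Set.insert_subset_insert hW)⟩

theorem Scoped.append {W : Set ℕ} {l₁ l₂ : List (List ℕ × ℕ)} (h₁ : Scoped W l₁)
    (h₂ : Scoped W l₂) : Scoped W (l₁ ++ l₂) := by
  induction l₁ generalizing W with
  | nil => exact h₂
  | cons d l ih => exact ⟨h₁.1, ih h₁.2 (h₂.mono (Set.subset_insert _ _))⟩

theorem Scoped.mem {W : Set ℕ} {l : List (List ℕ × ℕ)} (h : Scoped W l) {d : List ℕ × ℕ}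
    (hd : d ∈ l) {i : ℕ} (hi : i ∈ d.1) : i ∈ W ∨ i ∈ l.map Prod.snd := by
  induction l generalizing W with
  | nil => simp at hd
  | cons d' l ih =>
    rcases List.mem_cons.1 hd with rfl | hd
    · exact Or.inl (h.1 i hi)
    · rcases ih h.2 hd with (rfl | h) | h
      · exact Or.inr (by simp)
      · exact Or.inl h
      · exact Or.inr (List.mem_cons_of_mem _ h)

theorem Scoped.exists_index {W : Set ℕ} {l : List (List ℕ × ℕ)} (h : Scoped W l)
    {d : List ℕ × ℕ} (hd : d ∈ l) :
    ∃ (p : ℕ) (hp : p < (l.map Prod.snd).length), d.2 = (l.map Prod.snd)[p] ∧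
      ∀ x ∈ d.1, x ∈ W ∨ x ∈ (l.map Prod.snd).take p := by
  induction l generalizing W with
  | nil => simp at hd
  | cons d' l ih =>
    rcases List.mem_cons.1 hd with rfl | hd
    · exact ⟨0, by simp, rfl, fun x hx => Or.inl (h.1 x hx)⟩
    · obtain ⟨p, hp, h₁, h₂⟩ := ih h.2 hd
      refine ⟨p + 1, by simpa using hp, by simpa using h₁, fun x hx => ?_⟩
      rcases h₂ x hx with (rfl | h) | h
      · exact Or.inr (by simp)
      · exact Or.inl h
      · exact Or.inr (List.mem_cons_of_mem _ h)

/-- Scoping allows only earlier dependent variables in a tuple, and distinctness excludes the later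
ones; this is the ordering condition of dependence distribution. -/
theorem Scoped.get_notMem {W : Set ℕ} {l : List (List ℕ × ℕ)} (h : Scoped W l)
    (hW : ∀ y ∈ l.map Prod.snd, y ∉ W) (hn : (l.map Prod.snd).Nodup) (i j : Fin l.length)
    (hij : i ≤ j) : (l.get j).2 ∉ (l.get i).1 := by
  induction l generalizing W with
  | nil => exact i.elim0
  | cons d l ih =>
    simp only [List.map_cons, List.nodup_cons, List.forall_mem_cons] at hn hW
    cases i using Fin.cases with
    | zero =>
      intro hmem
      refine absurd (h.1 _ hmem) ?_
      cases j using Fin.cases with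
      | zero => exact hW.1
      | succ j => exact hW.2 _ (List.mem_map_of_mem (List.get_mem l j))
    | succ i =>
      cases j using Fin.cases with
      | zero => exact absurd hij (by simp)
      | succ j =>
        refine ih h.2 (fun y hy hyW => ?_) hn.2 i j (by simpa using hij)
        rcases hyW with rfl | hyW
        · exact hn.1 hy
        · exact hW.2 y hy hyW

/-- The formula `A` has a normal form whose bound variables avoid `V`. -/
def HasNF (A : Fml L) (V : Finset ℕ) : Prop :=
  ∃ (xs : List ℕ) (l : List (List ℕ × ℕ)) (C : Fml L),
    (xs ++ l.map Prod.snd).Nodup ∧ (∀ x ∈ xs ++ l.map Prod.snd, x ∉ V) ∧ C.IsFO ∧ C.IsQF ∧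
    Scoped {i | i ∈ A.fv ∨ i ∈ xs} l ∧ (∀ i ∈ C.fv, i ∈ A.fv ∨ i ∈ xs ++ l.map Prod.snd) ∧
    Derives {A} (alls xs (depBlock l C)) ∧
    ∀ (M : Type (max u v)) [L.Structure M] (X : Set (ℕ → M)),
      TSat (alls xs (depBlock l C)) X → TSat A X

theorem HasNF.of_derives {A B : Fml L} {V : Finset ℕ} (hB : HasNF B V) (hfv : B.fv ⊆ A.fv)
    (hd : Derives {A} B)
    (hs : ∀ (M : Type (max u v)) [L.Structure M] (X : Set (ℕ → M)), TSat B X → TSat A X) :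
    HasNF A V := by
  obtain ⟨xs, l, C, h₁, h₂, h₃, h₄, h₅, h₆, h₇, h₈⟩ := hB
  exact ⟨xs, l, C, h₁, h₂, h₃, h₄, h₅.mono fun i hi => hi.imp_left fun h => hfv h,
    fun i hi => (h₆ i hi).imp_left fun h => hfv h, hd.trans h₇, fun M _ X h => hs M X (h₈ M X h)⟩

theorem hasNF_of_isQF {A : Fml L} (hA : A.IsFO) (hQ : A.IsQF) (V : Finset ℕ) : HasNF A V :=
  ⟨[], [], A, by simp, by simp, hA, hQ, trivial, fun i hi => Or.inl hi, .andI .top .self,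
    fun _ _ _ h => h.2⟩

/-- The empty atom always holds, so `∀x (x = x)` serves. -/
theorem hasNF_dep_nil (V : Finset ℕ) : HasNF (dep [] : Fml L) V := by
  obtain ⟨x, hx⟩ := exists_fresh V
  refine ⟨[x], [], varEq x x, by simp, by simpa using hx, trivial, trivial, trivial, ?_, ?_, ?_⟩
  · simp [varEq, fv, Term.varFinset]
  · exact derives_trivialSentence _ x
  · intro M _ X _
    simp [TSat]

theorem fv_depBlock {l : List (List ℕ × ℕ)} {C : Fml L} {W : Set ℕ} (hl : Scoped W l)
    (hC : ∀ i ∈ C.fv, i ∈ W ∨ i ∈ l.map Prod.snd) {i : ℕ} (hi : i ∈ (depBlock l C).fv) :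
    i ∈ W ∧ i ∉ l.map Prod.snd := by
  rw [depBlock, mem_fv_exs] at hi
  refine ⟨?_, hi.2⟩
  rcases Finset.mem_union.1 hi.1 with h | h
  · obtain ⟨_, hd', h⟩ := mem_fv_bigAnd.1 h
    obtain ⟨d, hd, rfl⟩ := List.mem_map.1 hd'
    rcases mem_fv_depVar.1 h with h | rfl
    · exact (hl.mem hd h).resolve_right hi.2
    · exact absurd (List.mem_map_of_mem hd) hi.2
  · exact (hC i h).resolve_right hi.2

/-- Unnesting the last term gives a new `y` with `y = t`, and the atom becomes one on variables.
Conversely, the witnesses for `y` change nothing that the original atom sees. -/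
theorem hasNF_dep_vars (pre : List ℕ) (t : L.Term ℕ) (V : Finset ℕ)
    (hV : (dep (pre.map Term.var ++ [t]) : Fml L).fv ⊆ V) :
    HasNF (dep (pre.map Term.var ++ [t])) V := by
  obtain ⟨y, hy⟩ := exists_fresh V
  refine ⟨[], [(pre, y)], eq (Term.var y) t, by simp, by simpa using hy, trivial, trivial,
    ⟨fun i hi => Or.inl ?_, trivial⟩, fun i hi => ?_, ?_, ?_⟩
  · rw [fv, mem_listVars]
    exact ⟨Term.var i, by simp [hi], by simp [Term.varFinset]⟩
  · simp only [fv, Term.varFinset, Finset.mem_union, Finset.mem_singleton] at hi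
    rcases hi with rfl | hi
    · exact Or.inr (by simp)
    · exact Or.inl (by rw [fv, mem_listVars]; exact ⟨t, by simp, hi⟩)
  · have := Derives.unnest (Γ := {dep (pre.map Term.var ++ [t])}) (z := y) pre.length (by simp)
      (fun h => hy (hV h)) .self
    simpa [depBlock, exs, bigAnd, depVar, alls] using this
  · intro M _ X h
    rw [alls, List.foldr_nil, TSat_depBlock (by trivial)] at h
    obtain ⟨Y, hY, hC, hX⟩ := h
    have hdep : ∀ a b : ℕ → M, (∀ i ∉ [y], a i = b i) → ∀ s ∈ pre.map Term.var ++ [t],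
        s.realize a = s.realize b := by
      intro a b hab s hs
      refine realize_congr fun i hi => hab i ?_
      rw [List.mem_singleton]
      rintro rfl
      exact hy (hV (by rw [fv, mem_listVars]; exact ⟨s, hs, hi⟩))
    simp only [TSat, List.getLast?_append, List.getLast?_singleton, Option.some_or,
      Option.mem_def, Option.some.injEq, forall_eq', List.dropLast_concat, List.forall_mem_map,
      Term.realize_var]
    intro a ha b hb hab
    obtain ⟨a', ha', haa⟩ := hX a ha
    obtain ⟨b', hb', hbb⟩ := hX b hb
    simp only [List.map_cons, List.map_nil] at haa hbb
    rw [← hdep a' a haa t (by simp), ← hdep b' b hbb t (by simp)]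
    have h1 := hC a' ha'
    have h2 := hC b' hb'
    simp only [FOSat, Term.realize_var] at h1 h2
    rw [← h1, ← h2]
    refine hY (pre, y) (by simp) a' ha' b' hb' fun i hi => ?_
    have h3 := hdep a' a haa (Term.var i) (by simp [hi])
    have h4 := hdep b' b hbb (Term.var i) (by simp [hi])
    simp only [Term.realize_var] at h3 h4
    rw [h3, h4, hab i hi]

end NormalForm

end DepLogic

/-! ### Normal forms under connectives and quantifiers. -/

namespace DepLogic

open FirstOrder.Language (Term)
open Fml

variable {L : FirstOrder.Language.{u, v}}

theorem alls_append (xs₁ xs₂ : List ℕ) (A : Fml L) :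
    alls (xs₁ ++ xs₂) A = alls xs₁ (alls xs₂ A) := by
  simp [alls]

theorem vars_eq_fv_of_isQF {A : Fml L} (hA : A.IsQF) : A.vars = A.fv := by
  induction A with
  | eq | rel | dep => rfl
  | neg A ih => exact ih hA
  | and A B ihA ihB | or A B ihA ihB => simp only [vars, fv, ihA hA.1, ihB hA.2]
  | ex | all => exact hA.elim

theorem vars_bigAnd_subset {As : List (Fml L)} {i : ℕ} (hi : i ∈ (bigAnd As).vars) :
    i = 0 ∨ ∃ A ∈ As, i ∈ A.vars := by
  induction As with
  | nil =>
    left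
    simpa [bigAnd, top, vars, Term.varFinset] using hi
  | cons B As ih =>
    by_cases hAs : As = []
    · subst hAs
      exact Or.inr ⟨B, by simp, hi⟩
    · rw [bigAnd_cons B hAs] at hi
      rcases Finset.mem_union.1 hi with hi | hi
      · exact Or.inr ⟨B, by simp, hi⟩
      · exact (ih hi).imp_right fun ⟨A, hA, h⟩ => ⟨A, List.mem_cons_of_mem _ hA, h⟩

theorem vars_depBlock_subset {l : List (List ℕ × ℕ)} {C : Fml L} {W : Set ℕ} (hl : Scoped W l)
    (hQ : C.IsQF) (hC : ∀ i ∈ C.fv, i ∈ W ∨ i ∈ l.map Prod.snd) {i : ℕ}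
    (hi : i ∈ (depBlock l C).vars) : i = 0 ∨ i ∈ W ∨ i ∈ l.map Prod.snd := by
  rw [depBlock, vars_exs, vars, Finset.mem_union, Finset.mem_union, List.mem_toFinset,
    vars_eq_fv_of_isQF hQ] at hi
  rcases hi with hi | hi | hi
  · exact Or.inr (Or.inr hi)
  · refine (vars_bigAnd_subset hi).imp_right ?_
    rintro ⟨_, hd', h⟩
    obtain ⟨d, hd, rfl⟩ := List.mem_map.1 hd'
    rcases mem_fv_depVar.1 h with h | rfl
    · exact hl.mem hd h
    · exact Or.inr (List.mem_map_of_mem hd)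
  · exact Or.inr (hC i hi)

namespace Derives

theorem alls_scope {xs : List ℕ} {A B : Fml L} (h : ∀ x ∈ xs, x ∉ B.fv) :
    Derives {or (alls xs A) B} (alls xs (or A B)) := by
  induction xs with
  | nil => exact .self
  | cons x xs ih =>
    exact (allScope (A := alls xs A) (h x List.mem_cons_self) self).trans
      (all_mono (ih fun y hy => h y (List.mem_cons_of_mem _ hy)))

/-- Dependence introduction with a vacuous `∀u`: the value of `x` can be taken to depend on the
other free variables only. -/
theorem ex_dep {x : ℕ} {A : Fml L} {z : List ℕ} (hz : ∀ i, i ∈ z ↔ i ∈ A.fv ∧ i ≠ x) :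
    Derives {ex x A} (ex x (and (depVar (z, x)) A)) := by
  obtain ⟨u, hu⟩ := exists_fresh A.fv
  have h : Derives {ex x A} (ex x (all u A)) :=
    ex_mono (allI subset_rfl (by simpa using hu) self)
  refine allE_self (depI (y := u) z (fun i => ?_) h)
  rw [hz]
  refine and_congr_right fun hi => (and_iff_left ?_).symm
  rintro rfl
  exact hu hi

/-- Dependence introduction with the new atom thrown away. -/
theorem ex_all_swap {x y : ℕ} {A : Fml L} : Derives {ex x (all y A)} (all y (ex x A)) := by
  have := depI (Γ := {ex x (all y A)}) (x := x) (y := y) (A := A)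
    ((A.fv.erase x).erase y).toList (fun i => by simp; tauto) self
  exact this.trans (all_mono (ex_mono (andE₂ self)))

theorem ex_alls_swap {x : ℕ} {xs : List ℕ} {A : Fml L} :
    Derives {ex x (alls xs A)} (alls xs (ex x A)) := by
  induction xs with
  | nil => exact self
  | cons y xs ih => exact ex_all_swap.trans (all_mono ih)

end Derives

theorem HasNF.all {A : Fml L} {V : Finset ℕ} {x : ℕ} (hx : x ∉ V) (hA : HasNF A (insert x V)) :
    HasNF (all x A) V := by
  obtain ⟨xs, l, C, h₁, h₂, h₃, h₄, h₅, h₆, h₇, h₈⟩ := hA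
  have hx' : x ∉ xs ++ l.map Prod.snd := fun h => h₂ x h (Finset.mem_insert_self _ _)
  refine ⟨x :: xs, l, C, ?_, ?_, h₃, h₄, h₅.mono fun i hi => ?_, fun i hi => ?_, .all_mono h₇, ?_⟩
  · simp only [List.cons_append, List.nodup_cons]; exact ⟨hx', h₁⟩
  · intro y hy
    rcases List.mem_cons.1 hy with rfl | hy
    · exact hx
    · exact fun h => h₂ y hy (Finset.mem_insert_of_mem h)
  · by_cases hix : i = x
    · exact Or.inr (by simp [hix])
    · exact hi.imp (fun h => Finset.mem_erase.2 ⟨hix, h⟩) fun h => List.mem_cons_of_mem _ h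
  · by_cases hix : i = x
    · exact Or.inr (by simp [hix])
    · exact (h₆ i hi).imp (fun h => Finset.mem_erase.2 ⟨hix, h⟩) fun h => List.mem_cons_of_mem _ h
  · rintro M _ X ⟨Y, hY, hX⟩
    exact ⟨Y, h₈ M Y hY, hX⟩

/-- Moving `∃x` inside `∀x⃗` would let `x` depend on `x⃗`. The atom `=(z⃗, x)`, with `z⃗` the other
free variables of the normal form, is added first; it records that `x` does not depend on `x⃗`, so
the semantic converse holds. -/
theorem HasNF.ex {A : Fml L} {V : Finset ℕ} {x : ℕ} (hx : x ∉ V) (hV : (Fml.ex x A).fv ⊆ V)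
    (hA : HasNF A (insert x V)) : HasNF (ex x A) V := by
  classical
  obtain ⟨xs, l, C, h₁, h₂, h₃, h₄, h₅, h₆, h₇, h₈⟩ := hA
  have hx' : x ∉ xs ++ l.map Prod.snd := fun h => h₂ x h (Finset.mem_insert_self _ _)
  have hx'' : x ∉ xs ∧ x ∉ l.map Prod.snd := by simpa only [List.mem_append, not_or] using hx'
  have hCfv : ∀ i ∈ C.fv, i ∈ {i | i ∈ A.fv ∨ i ∈ xs} ∨ i ∈ l.map Prod.snd := fun i hi => by
    rcases h₆ i hi with h | h
    · exact Or.inl (Or.inl h)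
    · exact (List.mem_append.1 h).imp_left Or.inr
  have hNfv : ∀ i ∈ (alls xs (depBlock l C)).fv, i ∈ A.fv := fun i hi => by
    rw [mem_fv_alls] at hi
    exact (fv_depBlock h₅ hCfv hi.1).1.resolve_right hi.2
  let z : List ℕ := ((alls xs (depBlock l C)).fv.erase x).toList
  have hz : ∀ i, i ∈ z ↔ i ∈ (alls xs (depBlock l C)).fv ∧ i ≠ x := fun i => by
    simp [z, and_comm]
  have hzA : ∀ i ∈ z, i ∈ (Fml.ex x A).fv := fun i hi =>
    Finset.mem_erase.2 ⟨((hz i).1 hi).2, hNfv i ((hz i).1 hi).1⟩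
  have hzb : ∀ i ∈ z, i ∉ xs ++ l.map Prod.snd := fun i hi h =>
    h₂ i h (Finset.mem_insert_of_mem (hV (hzA i hi)))
  refine ⟨xs, (z, x) :: l, C, ?_, ?_, h₃, h₄, ⟨fun i hi => Or.inl (hzA i hi),
    h₅.mono fun i hi => ?_⟩, fun i hi => ?_, ?_, ?_⟩
  · rw [List.map_cons, List.perm_middle.nodup_iff, List.nodup_cons]
    exact ⟨hx', h₁⟩
  · intro y hy
    rw [List.map_cons, List.perm_middle.mem_iff, List.mem_cons] at hy
    rcases hy with rfl | hy
    · exact hx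
    · exact fun h => h₂ y hy (Finset.mem_insert_of_mem h)
  · by_cases hix : i = x
    · exact Or.inl hix
    · exact Or.inr (hi.imp_left fun h => Finset.mem_erase.2 ⟨hix, h⟩)
  · rw [List.map_cons, List.perm_middle.mem_iff, List.mem_cons]
    by_cases hix : i = x
    · exact Or.inr (Or.inl hix)
    · exact (h₆ i hi).imp (fun h => Finset.mem_erase.2 ⟨hix, h⟩) Or.inr
  · refine (Derives.ex_mono h₇).trans ((Derives.ex_dep hz).trans (.trans
      (B := Fml.ex x (alls xs (and (depVar (z, x)) (depBlock l C)))) (.ex_mono ?_)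
      (Derives.ex_alls_swap.trans (.alls_mono ?_))))
    · refine .alls_intro ?_ (.andI (.andE₁ .self) (.alls_elim (.andE₂ .self)))
      rintro _ rfl y hy h
      rcases Finset.mem_union.1 h with h | h
      · rcases mem_fv_depVar.1 h with h | rfl
        · exact hzb y h (List.mem_append_left _ hy)
        · exact hx''.1 hy
      · exact (mem_fv_alls.1 h).2 hy
    · change Derives _ (Fml.ex x (exs (l.map Prod.snd) _))
      refine .ex_mono (.exs_elim (ys := l.map Prod.snd) ?_ ?_ (.andE₂ .self) ?_
        (Set.finite_singleton _))
      · rintro _ rfl y hy h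
        rcases Finset.mem_union.1 h with h | h
        · rcases mem_fv_depVar.1 h with h | rfl
          · exact hzb y h (List.mem_append_right _ hy)
          · exact hx''.2 hy
        · exact (fv_depBlock h₅ hCfv h).2 hy
      · exact fun y hy h => (mem_fv_exs.1 h).2 hy
      · refine .exs_intro (.andI (Derives.bigAnd_iff.2 fun B hB => ?_)
          (.andE₂ (.assumption (Set.mem_insert _ _))))
        rw [List.map_cons, List.mem_cons] at hB
        rcases hB with rfl | hB
        · exact .andE₁ (.assumption (Set.mem_insert_of_mem _ rfl))
        · exact Derives.bigAnd_iff.1 (.andE₁ (.assumption (Set.mem_insert _ _))) B hB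
  · intro M _ X h
    rw [TSat_alls] at h
    obtain ⟨Z, hZ, hX⟩ := h
    rw [TSat_depBlock h₃] at hZ
    obtain ⟨Y, hYd, hYC, hY⟩ := hZ
    refine ⟨{e | ∀ e' : ℕ → M, (∀ i ∉ xs, e' i = e i) → ∃ w ∈ Y, ∀ i ∉ l.map Prod.snd,
      w i = e' i}, h₈ M _ (TSat_alls.2 ⟨_, (TSat_depBlock h₃).2 ⟨Y,
        fun d hd => hYd d (List.mem_cons_of_mem _ hd), hYC, fun e he => he⟩,
        fun e he e' h' => he e' h'⟩), fun e he => ?_⟩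
    obtain ⟨w, hw, hwe⟩ := hY e (hX e he e fun _ _ => rfl)
    refine ⟨w x, fun e' he' => ?_⟩
    -- Resetting `x` to its old value brings `e'` among the `x⃗`-variants of `e`; the values on `z⃗`
    -- are the same, so the atom gives the witness `w'` the same value at `x` as `w`.
    obtain ⟨w', hw', hwe'⟩ := hY (Function.update e' x (e x)) (hX e he _ fun i hi => by
      by_cases hix : i = x
      · subst hix; simp
      · rw [Function.update_of_ne hix, he' i hi, Function.update_of_ne hix])
    have hww : w' x = w x := hYd (z, x) (by simp) w' hw' w hw fun i hi => by
      have hix : i ≠ x := ((hz i).1 hi).2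
      have hib := hzb i hi
      simp only [List.mem_append, not_or] at hib
      have hi' : i ∉ ((z, x) :: l).map Prod.snd := by
        simp only [List.map_cons, List.mem_cons, not_or]; exact ⟨hix, hib.2⟩
      rw [hwe i hi', hwe' i hi', Function.update_of_ne hix, he' i hib.1,
        Function.update_of_ne hix]
    refine ⟨w', hw', fun i hi => ?_⟩
    by_cases hix : i = x
    · subst hix
      rw [hww, he' i hx''.1, Function.update_self]
    · rw [hwe' i (by simp only [List.map_cons, List.mem_cons, not_or]; exact ⟨hix, hi⟩),
        Function.update_of_ne hix]

theorem mem_fv_depBlock_matrix {l : List (List ℕ × ℕ)} {C : Fml L} {W : Set ℕ} (hl : Scoped W l)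
    (hC : ∀ i ∈ C.fv, i ∈ W ∨ i ∈ l.map Prod.snd) {i : ℕ}
    (hi : i ∈ (Fml.and (bigAnd (l.map depVar)) C).fv) : i ∈ W ∨ i ∈ l.map Prod.snd := by
  by_cases h : i ∈ l.map Prod.snd
  · exact Or.inr h
  · exact Or.inl (fv_depBlock hl hC (by rw [depBlock, mem_fv_exs]; exact ⟨hi, h⟩)).1

/-- Two normal forms with distinct variables. -/
structure NFPair (A B : Fml L) (V : Finset ℕ) where
  xs₁ : List ℕ
  l₁ : List (List ℕ × ℕ)
  C₁ : Fml L
  xs₂ : List ℕ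
  l₂ : List (List ℕ × ℕ)
  C₂ : Fml L
  isFO₁ : C₁.IsFO
  isQF₁ : C₁.IsQF
  isFO₂ : C₂.IsFO
  isQF₂ : C₂.IsQF
  nodup : (xs₁ ++ xs₂ ++ (l₁ ++ l₂).map Prod.snd).Nodup
  avoid : ∀ x ∈ xs₁ ++ xs₂ ++ (l₁ ++ l₂).map Prod.snd, x ∉ V
  scoped₁ : Scoped {i | i ∈ A.fv ∨ i ∈ xs₁} l₁
  scoped₂ : Scoped {i | i ∈ B.fv ∨ i ∈ xs₂} l₂
  fv₁ : ∀ i ∈ C₁.fv, i ∈ {i | i ∈ A.fv ∨ i ∈ xs₁} ∨ i ∈ l₁.map Prod.snd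
  fv₂ : ∀ i ∈ C₂.fv, i ∈ {i | i ∈ B.fv ∨ i ∈ xs₂} ∨ i ∈ l₂.map Prod.snd
  derives₁ : Derives {A} (alls xs₁ (depBlock l₁ C₁))
  derives₂ : Derives {B} (alls xs₂ (depBlock l₂ C₂))
  sound₁ : ∀ (M : Type (max u v)) [L.Structure M] (X : Set (ℕ → M)),
    TSat (alls xs₁ (depBlock l₁ C₁)) X → TSat A X
  sound₂ : ∀ (M : Type (max u v)) [L.Structure M] (X : Set (ℕ → M)),
    TSat (alls xs₂ (depBlock l₂ C₂)) X → TSat B X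
  fvA : A.fv ⊆ V
  fvB : B.fv ⊆ V

/-- The second normal form is chosen after the first and avoids its variables as well as `V`. -/
theorem exists_nfPair {A B : Fml L} {V : Finset ℕ} (hAV : A.fv ⊆ V) (hBV : B.fv ⊆ V)
    (hA : HasNF A V) (hB : ∀ V', V ⊆ V' → HasNF B V') : Nonempty (NFPair A B V) := by
  obtain ⟨xs₁, l₁, C₁, a₁, a₂, a₃, a₄, a₅, a₆, a₇, a₈⟩ := hA
  obtain ⟨xs₂, l₂, C₂, b₁, b₂, b₃, b₄, b₅, b₆, b₇, b₈⟩ :=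
    hB (V ∪ (xs₁ ++ l₁.map Prod.snd).toFinset) Finset.subset_union_left
  simp only [Finset.mem_union, List.mem_toFinset, not_or] at b₂
  have hperm : (xs₁ ++ xs₂ ++ (l₁ ++ l₂).map Prod.snd).Perm
      ((xs₁ ++ l₁.map Prod.snd) ++ (xs₂ ++ l₂.map Prod.snd)) := by
    rw [List.map_append, List.append_assoc, List.append_assoc]
    refine List.Perm.append_left _ ?_
    rw [← List.append_assoc, ← List.append_assoc]
    exact List.Perm.append_right _ List.perm_append_comm
  refine ⟨⟨xs₁, l₁, C₁, xs₂, l₂, C₂, a₃, a₄, b₃, b₄, ?_, ?_, a₅, b₅, fun i hi => ?_,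
    fun i hi => ?_, a₇, b₇, a₈, b₈, hAV, hBV⟩⟩
  · rw [hperm.nodup_iff, List.nodup_append]
    refine ⟨a₁, b₁, ?_⟩
    rintro x hx _ hy rfl
    exact (b₂ x hy).2 hx
  · intro x hx
    rw [hperm.mem_iff, List.mem_append] at hx
    exact hx.elim (a₂ x) fun h => (b₂ x h).1
  · have := a₆ i hi
    rwa [List.mem_append, ← or_assoc] at this
  · have := b₆ i hi
    rwa [List.mem_append, ← or_assoc] at this

namespace NFPair

variable {A B : Fml L} {V : Finset ℕ}

theorem scoped_append (P : NFPair A B V) :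
    Scoped {i | i ∈ A.fv ∪ B.fv ∨ i ∈ P.xs₁ ++ P.xs₂} (P.l₁ ++ P.l₂) := by
  refine (P.scoped₁.mono fun i hi => ?_).append (P.scoped₂.mono fun i hi => ?_)
  · exact hi.imp (Finset.mem_union_left _) (List.mem_append_left _)
  · exact hi.imp (Finset.mem_union_right _) (List.mem_append_right _)

theorem fv_or (P : NFPair A B V) {i : ℕ} (hi : i ∈ P.C₁.fv ∪ P.C₂.fv) :
    i ∈ A.fv ∪ B.fv ∨ i ∈ P.xs₁ ++ P.xs₂ ++ (P.l₁ ++ P.l₂).map Prod.snd := by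
  simp only [Finset.mem_union, List.map_append, List.mem_append] at hi ⊢
  rcases hi with hi | hi
  · rcases P.fv₁ i hi with (h | h) | h <;> simp [h]
  · rcases P.fv₂ i hi with (h | h) | h <;> simp [h]

theorem notMem_left (P : NFPair A B V) {i : ℕ} (hi : i ∈ P.xs₂ ++ P.l₂.map Prod.snd) :
    i ∉ A.fv ∧ i ∉ B.fv ∧ i ∉ P.xs₁ ∧ i ∉ P.l₁.map Prod.snd := by
  have hav : i ∉ V := P.avoid i (by simp only [List.map_append, List.mem_append] at hi ⊢; tauto)
  refine ⟨fun h => hav (P.fvA h), fun h => hav (P.fvB h), fun h => ?_, fun h => ?_⟩ <;>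
  · have := P.nodup
    simp only [List.map_append, List.nodup_append, List.mem_append] at this hi
    rcases hi with hi | hi
    · grind
    · grind

theorem notMem_right (P : NFPair A B V) {i : ℕ} (hi : i ∈ P.xs₁ ++ P.l₁.map Prod.snd) :
    i ∉ A.fv ∧ i ∉ B.fv ∧ i ∉ P.xs₂ ∧ i ∉ P.l₂.map Prod.snd := by
  have hav : i ∉ V := P.avoid i (by simp only [List.map_append, List.mem_append] at hi ⊢; tauto)
  exact ⟨fun h => hav (P.fvA h), fun h => hav (P.fvB h),
    fun h => by
      have := P.notMem_left (List.mem_append_left _ h)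
      exact (List.mem_append.1 hi).elim this.2.2.1 this.2.2.2,
    fun h => by
      have := P.notMem_left (List.mem_append_right _ h)
      exact (List.mem_append.1 hi).elim this.2.2.1 this.2.2.2⟩

theorem nodup₁ (P : NFPair A B V) : (P.xs₁ ++ P.l₁.map Prod.snd).Nodup := by
  have := P.nodup
  simp only [List.map_append, List.nodup_append, List.mem_append] at this ⊢
  grind

theorem nodup₂ (P : NFPair A B V) : (P.xs₂ ++ P.l₂.map Prod.snd).Nodup := by
  have := P.nodup
  simp only [List.map_append, List.nodup_append, List.mem_append] at this ⊢
  grind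

theorem notMem_scope₁ (P : NFPair A B V) {i : ℕ} (hi : i ∈ P.l₁.map Prod.snd) :
    i ∉ {i | i ∈ A.fv ∨ i ∈ P.xs₁} := by
  rintro (h | h)
  · exact (P.notMem_right (List.mem_append_right _ hi)).1 h
  · exact List.disjoint_of_nodup_append P.nodup₁ h hi

theorem notMem_scope₂ (P : NFPair A B V) {i : ℕ} (hi : i ∈ P.l₂.map Prod.snd) :
    i ∉ {i | i ∈ B.fv ∨ i ∈ P.xs₂} := by
  rintro (h | h)
  · exact (P.notMem_left (List.mem_append_right _ hi)).2.1 h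
  · exact List.disjoint_of_nodup_append P.nodup₂ h hi

/-- Prefixes in distinct variables merge by quantifier rules. For the semantic converse, each of the
two normal forms is deduced from the merged one, and soundness applies. -/
theorem hasNF_and (P : NFPair A B V) : HasNF (and A B) V := by
  have hT : ∀ i ∈ (depBlock P.l₁ P.C₁).fv, i ∈ A.fv ∨ i ∈ P.xs₁ := fun i hi =>
    (fv_depBlock P.scoped₁ P.fv₁ hi).1
  have hT' : ∀ i ∈ (depBlock P.l₂ P.C₂).fv, i ∈ B.fv ∨ i ∈ P.xs₂ := fun i hi =>
    (fv_depBlock P.scoped₂ P.fv₂ hi).1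
  refine ⟨P.xs₁ ++ P.xs₂, P.l₁ ++ P.l₂, and P.C₁ P.C₂, P.nodup, P.avoid, ⟨P.isFO₁, P.isFO₂⟩,
    ⟨P.isQF₁, P.isQF₂⟩, P.scoped_append, fun i hi => P.fv_or hi, ?_, ?_⟩
  · refine .trans (B := and (alls P.xs₁ (depBlock P.l₁ P.C₁)) (alls P.xs₂ (depBlock P.l₂ P.C₂)))
      (.andI (.of_singleton (Set.finite_singleton _) (.andE₁ .self) P.derives₁)
        (.of_singleton (Set.finite_singleton _) (.andE₂ .self) P.derives₂)) ?_
    have hΓ : ∀ i ∈ (and (alls P.xs₁ (depBlock P.l₁ P.C₁))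
        (alls P.xs₂ (depBlock P.l₂ P.C₂))).fv, i ∈ A.fv ∨ i ∈ B.fv := by
      intro i hi
      rcases Finset.mem_union.1 hi with h | h <;> rw [mem_fv_alls] at h
      · exact Or.inl ((hT i h.1).resolve_right h.2)
      · exact Or.inr ((hT' i h.1).resolve_right h.2)
    refine .alls_intro ?_ ?_
    · rintro _ rfl x hx h
      rcases List.mem_append.1 hx with hx | hx
      · have := P.notMem_right (List.mem_append_left _ hx)
        exact (hΓ x h).elim this.1 this.2.1
      · have := P.notMem_left (List.mem_append_left _ hx)
        exact (hΓ x h).elim this.1 this.2.1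
    · refine .exs_elim (ys := P.l₁.map Prod.snd) ?_ ?_ (.alls_elim (.andE₁ .self)) ?_
        (Set.finite_singleton _)
      · rintro _ rfl y hy h
        have := P.notMem_right (List.mem_append_right _ hy)
        exact (hΓ y h).elim this.1 this.2.1
      · intro y hy h
        exact (mem_fv_exs.1 h).2 (by simp only [List.map_append, List.mem_append]; exact Or.inl hy)
      refine .exs_elim (ys := P.l₂.map Prod.snd) ?_ ?_
        (.alls_elim (.andE₂ (.assumption (Set.mem_insert_of_mem _ rfl)))) ?_
        ((Set.finite_singleton _).insert _)
      · rintro _ (rfl | rfl) y hy h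
        · have := P.notMem_left (List.mem_append_right _ hy)
          rcases mem_fv_depBlock_matrix P.scoped₁ P.fv₁ h with (h | h) | h
          exacts [this.1 h, this.2.2.1 h, this.2.2.2 h]
        · have := P.notMem_left (List.mem_append_right _ hy)
          exact (hΓ y h).elim this.1 this.2.1
      · intro y hy h
        exact (mem_fv_exs.1 h).2 (by simp only [List.map_append, List.mem_append]; exact Or.inr hy)
      refine .exs_intro (.andI (Derives.bigAnd_iff.2 fun D hD => ?_)
        (.andI (.andE₂ (.assumption (Or.inr (Or.inl rfl)))) (.andE₂ (.assumption (Or.inl rfl)))))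
      rw [List.map_append, List.mem_append] at hD
      rcases hD with hD | hD
      · exact Derives.bigAnd_iff.1 (.andE₁ (.assumption (Or.inr (Or.inl rfl)))) D hD
      · exact Derives.bigAnd_iff.1 (.andE₁ (.assumption (Or.inl rfl))) D hD
  · intro M _ X h
    rcases isEmpty_or_nonempty M with hM | hM
    · rw [Set.eq_empty_of_isEmpty X]; exact TSat_empty _
    have hN : ∀ y ∈ (P.l₁ ++ P.l₂).map Prod.snd,
        y ∉ (alls (P.xs₁ ++ P.xs₂) (depBlock (P.l₁ ++ P.l₂) (and P.C₁ P.C₂))).fv := by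
      intro y hy h
      rw [mem_fv_alls, depBlock, mem_fv_exs] at h
      exact h.1.2 hy
    have hN' : ∀ y ∈ P.xs₁ ++ P.xs₂,
        y ∉ (alls (P.xs₁ ++ P.xs₂) (depBlock (P.l₁ ++ P.l₂) (and P.C₁ P.C₂))).fv :=
      fun y hy h => (mem_fv_alls.1 h).2 hy
    constructor
    · refine P.sound₁ M X (Derives.sound (Γ := {_}) ?_ (X := X) (by rintro _ rfl; exact h))
      refine .alls_intro (by rintro _ rfl x hx; exact hN' x (List.mem_append_left _ hx)) ?_
      refine .exs_elim (by rintro _ rfl; exact hN) ?_ (.alls_elim .self) ?_ (Set.finite_singleton _)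
      · intro y hy h
        rw [List.map_append, List.mem_append] at hy
        have h' := fv_depBlock P.scoped₁ P.fv₁ h
        rcases hy with hy | hy
        · exact h'.2 hy
        · have := P.notMem_left (List.mem_append_right _ hy)
          exact h'.1.elim this.1 this.2.2.1
      · refine .exs_intro (.andI (Derives.bigAnd_iff.2 fun D hD => ?_)
          (.andE₁ (.andE₂ (.assumption (Or.inl rfl)))))
        exact Derives.bigAnd_iff.1 (.andE₁ (.assumption (Or.inl rfl))) D
          (by rw [List.map_append]; exact List.mem_append_left _ hD)
    · refine P.sound₂ M X (Derives.sound (Γ := {_}) ?_ (X := X) (by rintro _ rfl; exact h))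
      refine .alls_intro (by rintro _ rfl x hx; exact hN' x (List.mem_append_right _ hx)) ?_
      refine .exs_elim (by rintro _ rfl; exact hN) ?_ (.alls_elim .self) ?_ (Set.finite_singleton _)
      · intro y hy h
        rw [List.map_append, List.mem_append] at hy
        have h' := fv_depBlock P.scoped₂ P.fv₂ h
        rcases hy with hy | hy
        · have := P.notMem_right (List.mem_append_right _ hy)
          exact h'.1.elim this.2.1 this.2.2.1
        · exact h'.2 hy
      · refine .exs_intro (.andI (Derives.bigAnd_iff.2 fun D hD => ?_)
          (.andE₂ (.andE₂ (.assumption (Or.inl rfl)))))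
        exact Derives.bigAnd_iff.1 (.andE₁ (.assumption (Or.inl rfl))) D
          (by rw [List.map_append]; exact List.mem_append_right _ hD)

/-- Scope extension pulls out the universal prefixes and dependence distribution merges the blocks.
The hypothesis `0 ∈ V` is there because the empty conjunction `top` contains the variable `0`, which
the bound variables must therefore avoid. -/
theorem hasNF_or (P : NFPair A B V) (h0 : 0 ∈ V) : HasNF (or A B) V := by
  classical
  have hT' : ∀ i ∈ (depBlock P.l₂ P.C₂).fv, i ∈ B.fv ∨ i ∈ P.xs₂ := fun i hi =>
    (fv_depBlock P.scoped₂ P.fv₂ hi).1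
  have hT : ∀ i ∈ (depBlock P.l₁ P.C₁).fv, i ∈ A.fv ∨ i ∈ P.xs₁ := fun i hi =>
    (fv_depBlock P.scoped₁ P.fv₁ hi).1
  have hfo : (or P.C₁ P.C₂).IsFO := ⟨P.isFO₁, P.isFO₂⟩
  refine ⟨P.xs₁ ++ P.xs₂, P.l₁ ++ P.l₂, or P.C₁ P.C₂, P.nodup, P.avoid, hfo,
    ⟨P.isQF₁, P.isQF₂⟩, P.scoped_append, fun i hi => P.fv_or hi, ?_, ?_⟩
  · refine (Derives.or_mono P.derives₁ P.derives₂).trans ((Derives.alls_scope ?_).trans ?_)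
    · intro x hx h
      rw [mem_fv_alls] at h
      have := P.notMem_right (List.mem_append_left _ hx)
      exact (hT' x h.1).elim this.2.1 this.2.2.1
    rw [alls_append]
    refine .alls_mono (.trans (B := or (alls P.xs₂ (depBlock P.l₂ P.C₂)) (depBlock P.l₁ P.C₁))
      (.orComm .self) ((Derives.alls_scope ?_).trans (.alls_mono ?_)))
    · intro x hx h
      have := P.notMem_left (List.mem_append_left _ hx)
      exact (hT x h).elim this.1 this.2.2.1
    · refine .depDistr P.isFO₁ P.isQF₁ P.isFO₂ P.isQF₂ P.nodup₁.of_append_right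
        P.nodup₂.of_append_right (P.scoped₁.get_notMem (fun _ => P.notMem_scope₁)
        P.nodup₁.of_append_right) (P.scoped₂.get_notMem (fun _ => P.notMem_scope₂)
        P.nodup₂.of_append_right) ?_ ?_ (.orComm .self)
      · intro d hd h
        have hd' := List.mem_map_of_mem (f := Prod.snd) hd
        have := P.notMem_right (List.mem_append_right _ hd')
        rcases vars_depBlock_subset P.scoped₂ P.isQF₂ P.fv₂ h with h | (h | h) | h
        · exact P.avoid d.2 (by simp only [List.map_append, List.mem_append]; tauto) (h ▸ h0)
        exacts [this.2.1 h, this.2.2.1 h, this.2.2.2 h]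
      · intro d hd h
        have hd' := List.mem_map_of_mem (f := Prod.snd) hd
        have := P.notMem_left (List.mem_append_right _ hd')
        rcases vars_depBlock_subset P.scoped₁ P.isQF₁ P.fv₁ h with h | (h | h) | h
        · exact P.avoid d.2 (by simp only [List.map_append, List.mem_append]; tauto) (h ▸ h0)
        exacts [this.1 h, this.2.2.1 h, this.2.2.2 h]
  · intro M _ X h
    rw [TSat_alls] at h
    obtain ⟨Z, hZ, hX⟩ := h
    rw [TSat_depBlock hfo] at hZ
    obtain ⟨Y, hYd, hYC, hY⟩ := hZ
    let W₁ : Set ℕ := {i | i ∈ {i | i ∈ A.fv ∨ i ∈ P.xs₁} ∨ i ∈ P.l₁.map Prod.snd}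
    let W₂ : Set ℕ := {i | i ∈ {i | i ∈ B.fv ∨ i ∈ P.xs₂} ∨ i ∈ P.l₂.map Prod.snd}
    -- Each part retains from `Y` only the values that its own normal form can see.
    let Y₁ : Set (ℕ → M) := {u | FOSat P.C₁ u ∧ ∃ w ∈ Y, ∀ i ∈ W₁, u i = w i}
    let Y₂ : Set (ℕ → M) := {u | FOSat P.C₂ u ∧ ∃ w ∈ Y, ∀ i ∈ W₂, u i = w i}
    have hd₁ : ∀ d ∈ P.l₁, ∀ a ∈ Y₁, ∀ b ∈ Y₁, (∀ i ∈ d.1, a i = b i) → a d.2 = b d.2 := by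
      rintro d hd a ⟨_, a', ha', ha⟩ b ⟨_, b', hb', hb⟩ hab
      rw [ha _ (Or.inr (List.mem_map_of_mem hd)), hb _ (Or.inr (List.mem_map_of_mem hd))]
      refine hYd d (List.mem_append_left _ hd) a' ha' b' hb' fun i hi => ?_
      rw [← ha i (P.scoped₁.mem hd hi), ← hb i (P.scoped₁.mem hd hi), hab i hi]
    have hd₂ : ∀ d ∈ P.l₂, ∀ a ∈ Y₂, ∀ b ∈ Y₂, (∀ i ∈ d.1, a i = b i) → a d.2 = b d.2 := by
      rintro d hd a ⟨_, a', ha', ha⟩ b ⟨_, b', hb', hb⟩ hab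
      rw [ha _ (Or.inr (List.mem_map_of_mem hd)), hb _ (Or.inr (List.mem_map_of_mem hd))]
      refine hYd d (List.mem_append_right _ hd) a' ha' b' hb' fun i hi => ?_
      rw [← ha i (P.scoped₂.mem hd hi), ← hb i (P.scoped₂.mem hd hi), hab i hi]
    refine ⟨{e | ∀ e' : ℕ → M, (∀ i ∉ P.xs₁, e' i = e i) →
        ∃ u ∈ Y₁, ∀ i ∉ P.l₁.map Prod.snd, u i = e' i},
      {e | ∀ e' : ℕ → M, (∀ i ∉ P.xs₂, e' i = e i) →
        ∃ u ∈ Y₂, ∀ i ∉ P.l₂.map Prod.snd, u i = e' i}, ?_,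
      P.sound₁ M _ (TSat_alls.2 ⟨_, (TSat_depBlock P.isFO₁).2 ⟨Y₁, hd₁, fun e he => he.1,
        fun e he => he⟩, fun e he e' h' => he e' h'⟩),
      P.sound₂ M _ (TSat_alls.2 ⟨_, (TSat_depBlock P.isFO₂).2 ⟨Y₂, hd₂, fun e he => he.1,
        fun e he => he⟩, fun e he e' h' => he e' h'⟩)⟩
    intro e he
    by_contra hcon
    simp only [Set.mem_union, Set.mem_ofPred_eq, not_or, not_forall] at hcon
    obtain ⟨⟨e₁, h₁, hn₁⟩, e₂, h₂, hn₂⟩ := hcon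
    -- If `e` fell in neither half, there would be bad values `e₁`, `e₂` for the two prefixes. The
    -- prefixes are disjoint, so one assignment carries both, and its witness in `Y` satisfies `C₁`
    -- or `C₂`, a contradiction.
    let e' : ℕ → M := fun i => if i ∈ P.xs₁ then e₁ i else if i ∈ P.xs₂ then e₂ i else e i
    obtain ⟨w, hw, hwe⟩ := hY e' (hX e he e' fun i hi => by
      simp only [List.mem_append, not_or] at hi
      simp [e', hi.1, hi.2])
    simp only [List.map_append, List.mem_append, not_or, and_imp] at hwe
    rcases hYC w hw with hC | hC
    · have hu : ∀ i ∈ W₁, (if i ∈ P.l₁.map Prod.snd then w i else e₁ i) = w i := by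
        intro i hi
        by_cases hiy : i ∈ P.l₁.map Prod.snd
        · rw [if_pos hiy]
        · rw [if_neg hiy]
          have hi₂ : i ∉ P.xs₂ ++ P.l₂.map Prod.snd := fun h => by
            have := P.notMem_left h
            rcases hi with (hi | hi) | hi
            exacts [this.1 hi, this.2.2.1 hi, this.2.2.2 hi]
          simp only [List.mem_append, not_or] at hi₂
          rw [hwe i hiy hi₂.2]
          by_cases hix : i ∈ P.xs₁
          · simp [e', hix]
          · simp [e', hix, hi₂.1, h₁ i hix]
      refine hn₁ ⟨fun i => if i ∈ P.l₁.map Prod.snd then w i else e₁ i,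
        ⟨(FOSat_congr fun i hi => hu i (P.fv₁ i hi)).2 hC, w, hw, hu⟩, fun i hi => if_neg hi⟩
    · have hu : ∀ i ∈ W₂, (if i ∈ P.l₂.map Prod.snd then w i else e₂ i) = w i := by
        intro i hi
        by_cases hiy : i ∈ P.l₂.map Prod.snd
        · rw [if_pos hiy]
        · rw [if_neg hiy]
          have hi₁ : i ∉ P.xs₁ ++ P.l₁.map Prod.snd := fun h => by
            have := P.notMem_right h
            rcases hi with (hi | hi) | hi
            exacts [this.2.1 hi, this.2.2.1 hi, this.2.2.2 hi]
          simp only [List.mem_append, not_or] at hi₁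
          rw [hwe i hi₁.2 hiy]
          by_cases hix : i ∈ P.xs₂
          · simp [e', hix, hi₁.1]
          · simp [e', hix, hi₁.1, h₂ i hix]
      refine hn₂ ⟨fun i => if i ∈ P.l₂.map Prod.snd then w i else e₂ i,
        ⟨(FOSat_congr fun i hi => hu i (P.fv₂ i hi)).2 hC, w, hw, hu⟩, fun i hi => if_neg hi⟩

end NFPair

end DepLogic

/-! ### Dependence atoms on arbitrary terms; the normal form theorem. -/

namespace DepLogic

open FirstOrder.Language (Term)
open Fml

variable {L : FirstOrder.Language.{u, v}}

/-- The terms are unnested from the left, with `pre` accumulating the variables that replace them.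
Each step yields `∃z` of a conjunction of a simpler atom with `z = s`, to which the closure under
`∧` and `∃` applies. -/
theorem hasNF_dep_append (pre : List ℕ) (ts : List (L.Term ℕ)) (t : L.Term ℕ) (V : Finset ℕ)
    (hV : (dep (pre.map Term.var ++ (ts ++ [t])) : Fml L).fv ⊆ V) :
    HasNF (dep (pre.map Term.var ++ (ts ++ [t]))) V := by
  induction ts generalizing pre V with
  | nil => exact hasNF_dep_vars pre t V hV
  | cons s ts ih =>
    obtain ⟨z, hz⟩ := exists_fresh V
    set D : Fml L := dep ((pre ++ [z]).map Term.var ++ (ts ++ [t])) with hD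
    have hmem : ∀ r ∈ pre.map Term.var ++ (s :: ts ++ [t]), ∀ i ∈ r.varFinset,
        i ∈ (dep (pre.map Term.var ++ (s :: ts ++ [t])) : Fml L).fv := fun r hr i hi => by
      rw [fv, mem_listVars]; exact ⟨r, hr, hi⟩
    have hDfv : ∀ i ∈ D.fv, i = z ∨
        i ∈ (dep (pre.map Term.var ++ (s :: ts ++ [t])) : Fml L).fv := by
      intro i hi
      rw [hD, fv, mem_listVars] at hi
      obtain ⟨r, hr, hi⟩ := hi
      simp only [List.map_append, List.map_cons, List.map_nil, List.append_assoc,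
        List.mem_append, List.mem_singleton] at hr
      rcases hr with hr | rfl | hr
      · exact Or.inr (hmem r (List.mem_append_left _ hr) i hi)
      · exact Or.inl (by simpa [Term.varFinset] using hi)
      · exact Or.inr (hmem r (by simp at hr ⊢; tauto) i hi)
    have hEfv : ∀ i ∈ (eq (Term.var z) s : Fml L).fv, i = z ∨
        i ∈ (dep (pre.map Term.var ++ (s :: ts ++ [t])) : Fml L).fv := by
      intro i hi
      simp only [fv, Term.varFinset, Finset.mem_union, Finset.mem_singleton] at hi
      exact hi.imp_right (hmem s (by simp) i)
    have hDV : D.fv ⊆ insert z V := fun i hi =>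
      Finset.mem_insert.2 ((hDfv i hi).imp_right fun h => hV h)
    have hEV : (eq (Term.var z) s : Fml L).fv ⊆ insert z V := fun i hi =>
      Finset.mem_insert.2 ((hEfv i hi).imp_right fun h => hV h)
    obtain ⟨P⟩ := exists_nfPair hDV hEV (ih _ _ hDV) fun V' _ =>
      hasNF_of_isQF (A := eq (Term.var z) s) trivial trivial V'
    have hfv : (ex z (and D (eq (Term.var z) s))).fv ⊆
        (dep (pre.map Term.var ++ (s :: ts ++ [t])) : Fml L).fv := by
      intro i hi
      rw [fv, Finset.mem_erase] at hi
      rcases Finset.mem_union.1 hi.2 with h | h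
      · exact (hDfv i h).resolve_left hi.1
      · exact (hEfv i h).resolve_left hi.1
    refine (HasNF.ex hz (hfv.trans hV) P.hasNF_and).of_derives hfv ?_ ?_
    · have := Derives.unnest (Γ := {dep (pre.map Term.var ++ (s :: ts ++ [t]))}) (z := z)
        pre.length (by simp) (fun h => hz (hV h)) .self
      simpa [hD] using this
    · rintro M _ X ⟨Y, ⟨hY, hE⟩, hX⟩
      have hval : ∀ (a : ℕ → M) (m : M), ∀ r ∈ pre.map Term.var ++ (s :: ts ++ [t]),
          r.realize (Function.update a z m) = r.realize a := fun a m r hr => by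
        refine realize_congr fun i hi => Function.update_of_ne ?_ _ _
        rintro rfl
        exact hz (hV (hmem r hr _ hi))
      have hlast : ∀ pr : List (L.Term ℕ), (pr ++ (ts ++ [t])).getLast? = some t := by
        intro pr; rw [← List.append_assoc, List.getLast?_concat]
      have hdrop : ∀ pr : List (L.Term ℕ), (pr ++ (ts ++ [t])).dropLast = pr ++ ts := by
        intro pr; rw [← List.append_assoc, List.dropLast_concat]
      have key : pre.map Term.var ++ (s :: ts ++ [t]) =
          (pre.map Term.var ++ [s]) ++ (ts ++ [t]) := by simp
      rw [key] at hval ⊢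
      simp only [hD, TSat, hlast, hdrop, Option.mem_def, Option.some.injEq, forall_eq'] at hY ⊢
      intro a ha b hb hab
      obtain ⟨m, hm⟩ := hX a ha
      obtain ⟨n, hn⟩ := hX b hb
      rw [← hval a m t (by simp), ← hval b n t (by simp)]
      refine hY _ hm _ hn fun r hr => ?_
      simp only [List.map_append, List.map_cons, List.map_nil, List.append_assoc,
        List.mem_append, List.mem_singleton] at hr
      by_cases hrz : r = Term.var z
      · have h1 := hE _ hm
        have h2 := hE _ hn
        rw [hrz, h1, h2, hval a m s (by simp), hval b n s (by simp)]
        exact hab s (by simp)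
      · have hr' : r ∈ pre.map Term.var ++ [s] ++ ts := by
          simp only [List.mem_append]; tauto
        have hr'' : r ∈ (pre.map Term.var ++ [s]) ++ (ts ++ [t]) := by
          rw [← List.append_assoc]; exact List.mem_append_left _ hr'
        rw [hval a m r hr'', hval b n r hr'']
        exact hab r hr'

theorem hasNF_dep (ts : List (L.Term ℕ)) (V : Finset ℕ) (hV : (dep ts : Fml L).fv ⊆ V) :
    HasNF (dep ts) V := by
  rcases List.eq_nil_or_concat ts with rfl | ⟨ts, t, rfl⟩
  · exact hasNF_dep_nil V
  · rw [List.concat_eq_append] at hV ⊢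
    exact hasNF_dep_append [] ts t V hV

theorem TSat_of_derives {A B : Fml L} (h : Derives {A} B) {M : Type w} [L.Structure M]
    {X : Set (ℕ → M)} (hX : TSat A X) : TSat B X := by
  rcases isEmpty_or_nonempty M with hM | hM
  · rw [Set.eq_empty_of_isEmpty X]
    exact TSat_empty B
  · exact h.sound (by simpa using hX)

theorem fv_subst_single_var {A : Fml L} {x y i : ℕ}
    (hi : i ∈ (A.subst (single x (Term.var y))).fv) : i = y ∨ i ∈ A.fv.erase x := by
  obtain ⟨j, hj, hi⟩ := mem_fv_subst hi
  by_cases hjx : j = x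
  · subst hjx
    exact Or.inl (by simpa [single, Term.varFinset] using hi)
  · have : i = j := by simpa [single, Function.update_of_ne hjx, Term.varFinset] using hi
    exact Or.inr (Finset.mem_erase.2 ⟨this ▸ hjx, this ▸ hj⟩)

/-- Every formula of dependence logic in negation normal form has a normal form. -/
theorem NegQF.hasNF {A : Fml L} (hA : NegQF A) {V : Finset ℕ} (hV : A.fv ⊆ V) (h0 : 0 ∈ V) :
    HasNF A V := by
  -- Quantified variables are renamed away from `V` before the quantifier cases, so the hypothesis
  -- is needed for substitution instances.
  induction hn : size A using Nat.strong_induction_on generalizing A V with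
  | _ n ih =>
  subst hn
  cases A with
  | eq t s => exact hasNF_of_isQF (A := eq t s) trivial trivial V
  | rel R ts => exact hasNF_of_isQF (A := rel R ts) trivial trivial V
  | dep ts => exact hasNF_dep ts V hV
  | neg A => exact hasNF_of_isQF (A := neg A) hA.1 hA.2 V
  | and A B =>
    have hAV := Finset.union_subset_left hV
    have hBV := Finset.union_subset_right hV
    obtain ⟨P⟩ := exists_nfPair hAV hBV (ih (size A) (by simp only [size]; omega) hA.1 hAV h0 rfl)
      fun V' h => ih (size B) (by simp only [size]; omega) hA.2 (hBV.trans h) (h h0) rfl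
    exact P.hasNF_and
  | or A B =>
    have hAV := Finset.union_subset_left hV
    have hBV := Finset.union_subset_right hV
    obtain ⟨P⟩ := exists_nfPair hAV hBV (ih (size A) (by simp only [size]; omega) hA.1 hAV h0 rfl)
      fun V' h => ih (size B) (by simp only [size]; omega) hA.2 (hBV.trans h) (h h0) rfl
    exact P.hasNF_or h0
  | ex x A =>
    obtain ⟨y, hy⟩ := exists_fresh (V ∪ A.vars)
    simp only [Finset.mem_union, not_or] at hy
    have hfv : (ex y (A.subst (single x (Term.var y)))).fv ⊆ (ex x A).fv := fun i hi => by
      rw [fv, Finset.mem_erase] at hi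
      exact (fv_subst_single_var hi.2).resolve_left hi.1
    have hnf := ih (size (A.subst (single x (Term.var y)))) (by simp [size, size_subst])
      (NegQF.subst (A := A) hA _) (V := insert y V) (fun i hi => Finset.mem_insert.2
        ((fv_subst_single_var hi).imp_right fun h => hV h)) (Finset.mem_insert_of_mem h0) rfl
    exact (HasNF.ex hy.1 (hfv.trans hV) hnf).of_derives hfv (.ex_rename hy.2)
      fun M _ X h => TSat_of_derives (.ex_rename_symm hy.2) h
  | all x A =>
    obtain ⟨y, hy⟩ := exists_fresh (V ∪ A.vars)
    simp only [Finset.mem_union, not_or] at hy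
    have hfv : (all y (A.subst (single x (Term.var y)))).fv ⊆ (all x A).fv := fun i hi => by
      rw [fv, Finset.mem_erase] at hi
      exact (fv_subst_single_var hi.2).resolve_left hi.1
    have hnf := ih (size (A.subst (single x (Term.var y)))) (by simp [size, size_subst])
      (NegQF.subst (A := A) hA _) (V := insert y V) (fun i hi => Finset.mem_insert.2
        ((fv_subst_single_var hi).imp_right fun h => hV h)) (Finset.mem_insert_of_mem h0) rfl
    exact (HasNF.all hy.1 hnf).of_derives hfv (.all_rename hy.2)
      fun M _ X h => TSat_of_derives (.all_rename_symm hy.2) h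

/-! ### Completeness. -/

theorem isD_bigAnd {As : List (Fml L)} (h : ∀ A ∈ As, A.IsD) : (bigAnd As).IsD := by
  induction As with
  | nil => trivial
  | cons A As ih =>
    cases As with
    | nil => exact h A (by simp)
    | cons B As =>
      exact ⟨h A (by simp), ih fun C hC => h C (List.mem_cons_of_mem _ hC)⟩

/-- Completeness for a single sentence of dependence logic, in contrapositive form. -/
theorem exists_model_of_not_derives {Φ φ : Fml L} (hD : Φ.IsD) (hS : Φ.IsSentence) (hφ : φ.IsFO)
    (h : ¬ Derives {Φ} φ) : ∃ (M : Type (max u v)) (_ : L.Structure M) (e : ℕ → M),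
      TSat Φ {e} ∧ ¬ FOSat φ e := by
  obtain ⟨B, hB, hBfv, hΦB, hBΦ⟩ := exists_negQF hD
  have hB0 : B.fv = ∅ := hBfv.trans hS
  -- Avoiding `φ.fv` makes the initial tuple of variables fresh for `¬φ`; `0` is included on account
  -- of `top`.
  obtain ⟨xs, l, C, hn, hav, hC, hQ, hl, hCfv, hd, hs⟩ :=
    hB.hasNF (V := insert 0 φ.fv) (by simp [hB0]) (Finset.mem_insert_self _ _)
  let N : NormalSentence L :=
    { xs := xs, l := l, C := C, nodup := hn, isFO := hC, isQF := hQ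
      fv_subset := fun i hi => (hCfv i hi).resolve_left (by simp [hB0])
      dep_subset := fun d hd => by
        obtain ⟨p, hp, h₁, h₂⟩ := hl.exists_index hd
        refine ⟨p, hp, h₁, fun x hx => ?_⟩
        simpa [hB0] using h₂ x hx }
  obtain ⟨M, _, e, he, hN⟩ := N.exists_model (Γ := {neg φ}) (Set.finite_singleton _)
    (by rintro _ rfl; exact hφ)
    (by
      rintro _ rfl x hx hx'
      exact hav x hx (Finset.mem_insert_of_mem hx'))
    (fun hcon => h ((hΦB.trans hd).trans (.byContra hφ (by rwa [Set.pair_comm] at hcon))))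
  exact ⟨M, _, e, hBΦ M _ (hs M _ hN), he _ rfl⟩

theorem Derives.entails {T : Set (Fml L)} {φ : Fml L} (h : Derives T φ) : Entails T φ :=
  fun _ _ _ _ _ _ _ hX => Sat_iff_TSat.2 (h.sound fun B hB => Sat_iff_TSat.1 (hX B hB))

/-- By compactness a countermodel is needed only for finite subsets, and the conjunction of such a
subset is a single sentence from which `φ` is not derivable. -/
theorem derives_of_entails {T : Set (Fml L)} (hT : ∀ A ∈ T, A.IsD ∧ A.IsSentence) {φ : Fml L}
    (hφ : φ.IsFO) (h : Entails T φ) : Derives T φ := by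
  by_contra hcon
  obtain ⟨M, _, e, he, hne⟩ := exists_model_of_finite (T := T) (φ := φ) fun T₀ hT₀ hfin => by
    have hmem : ∀ A, A ∈ hfin.toFinset.toList ↔ A ∈ T₀ := by simp
    obtain ⟨M, i, e, he, hne⟩ := exists_model_of_not_derives (Φ := bigAnd hfin.toFinset.toList)
      (isD_bigAnd fun A hA => (hT A (hT₀ ((hmem A).1 hA))).1)
      (by
        refine Finset.eq_empty_of_forall_notMem fun i hi => ?_
        obtain ⟨A, hA, hi⟩ := mem_fv_bigAnd.1 hi
        have hA' : A.fv = ∅ := (hT A (hT₀ ((hmem A).1 hA))).2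
        simp [hA'] at hi)
      hφ
      fun hd => hcon ((Derives.of_singleton hfin (Derives.bigAnd_iff.2 fun A hA =>
        .assumption ((hmem A).1 hA)) hd).weaken hT₀)
    exact ⟨M, i, e, fun B hB => TSat_bigAnd.1 he B ((hmem B).2 hB), hne⟩
  have : Nonempty M := ⟨e 0⟩
  -- The refuting team has one member, `e` restricted to the free variables of `φ`; the members of
  -- `T` are sentences, so they remain true there.
  have hsat := h M φ.fv {fun i : φ.fv => e i} (fun B hB => by
    have hB' : B.fv = ∅ := (hT B hB).2
    simp [hB']) subset_rfl fun B hB => Sat_iff_TSat.2 ((he B hB).local fun e' _ => ⟨e, rfl, by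
      have hB' : B.fv = ∅ := (hT B hB).2
      simp [hB']⟩)
  have hφe := (TSat_iff_of_isFO hφ).1 (Sat_iff_TSat.1 hsat) _ ⟨_, rfl, rfl⟩
  refine hne ((FOSat_congr fun i hi => ?_).1 hφe)
  simp [ext, hi]

end DepLogic

theorem mainTheorem1 {L : FirstOrder.Language.{u, v}} (T : Set (DepLogic.Fml L))
    (hT : ∀ A ∈ T, A.IsD ∧ A.IsSentence) (φ : DepLogic.Fml L) (hφ : φ.IsFO) :
    DepLogic.Entails T φ ↔ DepLogic.Derives T φ :=
  ⟨DepLogic.derives_of_entails hT hφ, DepLogic.Derives.entails⟩
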